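/- **Setting.** Let $w:[0,1]\to[0,1]$ be a probability weighting function: continuous, strictly increasing, $w(0)=0$, $w(1)=1$, three times differentiable on $(0,1)$ with $w'''>0$, and with one-sided derivatives $w'(0),w'(1)\in(1,\infty]$. Let $\theta>0$ be the buyer's value for the good. The rank-dependent expected utility (RDEU) of an ex post payoff $Y$ (bounded above) is $$RDEU(Y)=\int_0^\infty w(P(Y>y))\,dy+\int_{-\infty}^0\big(w(P(Y>y))-1\big)\,dy\in[-\infty,\infty).$$ Put $w_-(p)=1-w(1-p)$ and $\lambda=1$. **(a) Payoffs.** If $X=1$ almost surely and $T\ge 0$ is a random price, then $RDEU(\theta X-T)$ equals the cumulative prospect theory payoff $\theta w_+(P(X=1))-\lambda\int_0^\infty w_-(P(T>y))\,dy=\theta-\int_0^\infty w_-(P(T>y))\,dy$, for every probability weighting function $w_+$. **(b) Static problem.** A static mechanism is a pair of jointly distributed random variables $X\in\{0,1\}$ (delivery) and $T\ge0$ (payment); it is feasible if $RDEU(\theta X-T)\ge 0$, and its revenue is $\int_0^\infty P(T>y)\,dy$. The maximum $\mu^*=\max_{p\in(0,1]}p/w_-(p)$ exists, $\mu^*>1$,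 and there is a unique $p^*\in(0,1)$ with $\mu^*w_-(p^*)=p^*$. The maximal revenue of a feasible mechanism is attained and equals $\mu^*\theta$, and $(X,T)$ is optimal if and only if $P(X=1)=1$ and, for all $y\ge0$, $$P(T>y)=\begin{cases}p^*& y<\mu^*\theta/p^*,\\ 0& y\ge\mu^*\theta/p^*.\end{cases}$$ **(c) Dynamic problem.** A dynamic pricing process $(\tau,T)$ consists of a random delivery time $\tau\in[0,\infty]$ whose distribution function is the sum of an increasing absolutely continuous function and an increasing jump function, and of a deterministic cumulative payment $T(t)=\int_0^t f(r)\,dr+\sum_i 1_{t_i<t}T_i$, $t\ge 0$, finite for every $t$, with $f\ge0$ locally integrable and countably many $t_i,T_i\ge0$; put $T(\infty)=\sup_tT(t)$. It satisfies dynamic individual rationality (DIR) if for every $s\ge0$ with $P(\tau>s)>0$ the RDEU of $\theta1_{\tau<\infty}-(T(\tau)-T(s))$ under the conditional probability $P(\,\cdot\mid\tau>s)$ is $\ge0$. A process is optimal if it satisfies DIR and maximizes the revenue $\int_0^\infty P(T(\tau)>y)\,dy$ among all processes that satisfy DIR. There is a unique $p_1\in(0,1)$ with $w_-(p_1)=p_1$.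 There is a unique (up to null sets) $g_0\in L^1[0,-\log p_1]$ with $$e^{-t}-w_-(e^{-t})-\int_0^t w_-(e^{-t+s})g_0(s)\,ds=0\qquad\text{for all }t\in[0,-\log p_1];$$ it has a version continuous on $(0,-\log p_1]$, and for this version $t_0=\min\{t\in(0,-\log p_1]: g_0(t)\le0\}$ exists. There is a unique (up to null sets) $f\in L^1[0,t_0]$ with $$w_-(e^{-t_0+t})+\int_t^{t_0}w_-(e^{-s+t})f(s)\,ds=1\qquad\text{for all }t\in[0,t_0].$$ Let $P(\tau_0>t)=e^{-t}$ for $t\ge0$, and $$T^*(t)=\theta\Big(1_{t>t_0}+\int_0^{\min\{t,t_0\}}f(s)\,ds\Big).$$ Then $(\tau_0,T^*)$ is an optimal dynamic pricing process, and a dynamic pricing process $(\tau,T)$ is optimal if and only if $P(\tau<\infty)=1$ and $P(T(\tau)\le y)=P(T^*(\tau_0)\le y)$ for all $y\ge0$. -/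

import Mathlib

open MeasureTheory ProbabilityTheory Filter Set
open scoped ENNReal Topology

noncomputable section

/-- A reverse-S-shaped probability weighting function on `[0,1]` (values of `w` outside `[0,1]` are
never used): continuous, strictly increasing, `w 0 = 0`, `w 1 = 1`, three times differentiable on
`(0,1)` with `w''' > 0` there, and with one-sided derivatives at `0` and at `1` that exist in the
extended sense (the value `+∞` is allowed) and exceed `1`. -/
structure IsWeightingFunction (w : ℝ → ℝ) : Prop where
  continuousOn : ContinuousOn w (Icc 0 1)
  strictMonoOn : StrictMonoOn w (Icc 0 1)
  map_zero : w 0 = 0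
  map_one : w 1 = 1
  differentiableAt : ∀ k < 3, ∀ p ∈ Ioo (0 : ℝ) 1, DifferentiableAt ℝ (iteratedDeriv k w) p
  third_deriv_pos : ∀ p ∈ Ioo (0 : ℝ) 1, 0 < iteratedDeriv 3 w p
  deriv_zero : ∃ d : EReal, 1 < d ∧
    Tendsto (fun p : ℝ => ((slope w 0 p : ℝ) : EReal)) (𝓝[>] (0 : ℝ)) (𝓝 d)
  deriv_one : ∃ d : EReal, 1 < d ∧
    Tendsto (fun p : ℝ => ((slope w 1 p : ℝ) : EReal)) (𝓝[<] (1 : ℝ)) (𝓝 d)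

/-- The loss weighting attached to a rank-dependent weighting `w`: `w₋(p) = 1 - w(1 - p)`. -/
def dualWeight (w : ℝ → ℝ) : ℝ → ℝ := fun p => 1 - w (1 - p)

/-- Rank-dependent expected utility of an ex post payoff `Y` under `Q`:
`∫₀^∞ w(Q(Y > y)) dy + ∫_{-∞}^0 (w(Q(Y > y)) - 1) dy`, as an extended real number.
In every use below `Y` is bounded above by a constant, so that the first integral is finite. -/
def rdeu {Ω : Type*} [MeasurableSpace Ω] (w : ℝ → ℝ) (Q : Measure Ω) (Y : Ω → EReal) : EReal :=
  ((∫⁻ y in Ioi (0 : ℝ), ENNReal.ofReal (w (Q.real {ω | (y : EReal) < Y ω})) : ℝ≥0∞) : EReal)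
    - ((∫⁻ y in Iio (0 : ℝ),
        ENNReal.ofReal (1 - w (Q.real {ω | (y : EReal) < Y ω})) : ℝ≥0∞) : EReal)

/-- Rank-dependent expected utility of a menu: delivery indicator `X`, payment `T`, value `θ`. -/
def rdeuMenu {Ω : Type*} [MeasurableSpace Ω] (w : ℝ → ℝ) (θ : ℝ) (P : Measure Ω)
    (X T : Ω → ℝ) : EReal :=
  rdeu w P (fun ω => ((θ * X ω - T ω : ℝ) : EReal))

/-- Cumulative prospect theory payoff of a menu (separate accounts, loss aversion `lam`):
`θ w₊(P(X = 1)) - lam ∫₀^∞ w₋(P(T > y)) dy`. -/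
def cptMenu {Ω : Type*} [MeasurableSpace Ω] (wplus wminus : ℝ → ℝ) (lam θ : ℝ) (P : Measure Ω)
    (X T : Ω → ℝ) : EReal :=
  ((θ * wplus (P.real {ω | X ω = 1}) : ℝ) : EReal)
    - (lam : EReal) *
      ((∫⁻ y in Ioi (0 : ℝ), ENNReal.ofReal (wminus (P.real {ω | y < T ω})) : ℝ≥0∞) : EReal)

/-! ### Static mechanisms -/

/-- A static mechanism: a delivery indicator `X ∈ {0,1}` and a payment `T ≥ 0`, jointly random. -/
structure StaticMechanism where
  Ω : Type
  [mΩ : MeasurableSpace Ω]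
  P : Measure Ω
  [prob : IsProbabilityMeasure P]
  X : Ω → ℝ
  measurable_X : Measurable X
  X_mem : ∀ ω, X ω = 0 ∨ X ω = 1
  T : Ω → ℝ
  measurable_T : Measurable T
  T_nonneg : ∀ ω, 0 ≤ T ω

attribute [instance] StaticMechanism.mΩ StaticMechanism.prob

namespace StaticMechanism

/-- Expected revenue `∫₀^∞ P(T > y) dy`. -/
def revenue (m : StaticMechanism) : ℝ≥0∞ := ∫⁻ y in Ioi (0 : ℝ), m.P {ω | y < m.T ω}

/-- Ex ante individual rationality of a rank-dependent buyer. -/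
def Feasible (w : ℝ → ℝ) (θ : ℝ) (m : StaticMechanism) : Prop :=
  0 ≤ rdeuMenu w θ m.P m.X m.T

/-- `m` maximizes expected revenue among all static mechanisms that the buyer accepts. -/
def IsOptimal (w : ℝ → ℝ) (θ : ℝ) (m : StaticMechanism) : Prop :=
  m.Feasible w θ ∧ ∀ m' : StaticMechanism, m'.Feasible w θ → m'.revenue ≤ m.revenue

end StaticMechanism

/-! ### Dynamic pricing processes -/

/-- `T(t) = ∫₀ᵗ f(r) dr + ∑ᵢ 1_{tᵢ < t} Jᵢ` for all `t ≥ 0`, with a flow `f ≥ 0` and countably many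
lump sums `Jᵢ ≥ 0` at times `tᵢ ≥ 0`. In particular `T 0 = 0`, and on `[0,∞)` the function `T` is
nonnegative, increasing and left continuous. -/
def IsRegularPayment (T : ℝ → ℝ) : Prop :=
  ∃ (f : ℝ → ℝ) (times jumps : ℕ → ℝ),
    (∀ r, 0 ≤ f r) ∧ (∀ i, 0 ≤ times i) ∧ (∀ i, 0 ≤ jumps i) ∧
    (∀ t, 0 ≤ t → IntervalIntegrable f volume 0 t) ∧
    ∀ t, 0 ≤ t → HasSum (fun i => if times i < t then jumps i else 0) (T t - ∫ r in (0 : ℝ)..t, f r)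

/-- `F(t) = F₁(t) + F₂(t)` for all `t ≥ 0`, with `F₁` increasing and absolutely continuous
(an integral of a density `ρ ≥ 0`) and `F₂` an increasing right-continuous jump function. -/
def IsRegularCDF (F : ℝ → ℝ) : Prop :=
  ∃ (ρ : ℝ → ℝ) (times jumps : ℕ → ℝ),
    (∀ r, 0 ≤ ρ r) ∧ (∀ i, 0 ≤ times i) ∧ (∀ i, 0 ≤ jumps i) ∧
    (∀ t, 0 ≤ t → IntervalIntegrable ρ volume 0 t) ∧
    ∀ t, 0 ≤ t → HasSum (fun i => if times i ≤ t then jumps i else 0) (F t - ∫ r in (0 : ℝ)..t, ρ r)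

/-- A dynamic pricing process: the random time `τ ∈ [0,∞]` at which the good is delivered, and the
deterministic cumulative payment `T t` made by a buyer who stays until (not including) time `t`. -/
structure DynamicProcess where
  Ω : Type
  [mΩ : MeasurableSpace Ω]
  P : Measure Ω
  [prob : IsProbabilityMeasure P]
  τ : Ω → ℝ≥0∞
  measurable_τ : Measurable τ
  regular_τ : IsRegularCDF (fun t => P.real {ω | τ ω ≤ ENNReal.ofReal t})
  T : ℝ → ℝ
  regular_T : IsRegularPayment T

attribute [instance] DynamicProcess.mΩ DynamicProcess.prob

namespace DynamicProcess

/-- The total payment `T(τ)` of a buyer who never quits; `T(∞) = sup_t T(t)`. -/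
def payment (m : DynamicProcess) (ω : m.Ω) : ℝ≥0∞ :=
  if m.τ ω = ⊤ then ⨆ (t : ℝ) (_ : 0 ≤ t), ENNReal.ofReal (m.T t)
  else ENNReal.ofReal (m.T (m.τ ω).toReal)

/-- Expected revenue `∫₀^∞ P(T(τ) > y) dy`. -/
def revenue (m : DynamicProcess) : ℝ≥0∞ :=
  ∫⁻ y in Ioi (0 : ℝ), m.P {ω | ENNReal.ofReal y < m.payment ω}

/-- Ex post payoff, from time `s` on, of a buyer who stays forever: `θ 1_{τ < ∞} - (T(τ) - T(s))`. -/
def continuationPayoff (θ : ℝ) (m : DynamicProcess) (s : ℝ) (ω : m.Ω) : EReal :=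
  (if m.τ ω = ⊤ then 0 else (θ : EReal)) - ((m.payment ω : EReal) - (m.T s : EReal))

/-- Dynamic individual rationality of a rank-dependent buyer: at each time `s` with `P(τ > s) > 0`,
conditionally on `τ > s`, staying forever is at least as good as quitting (what has been paid up
to time `s` is sunk, so quitting is worth `0`). -/
def DIR (w : ℝ → ℝ) (θ : ℝ) (m : DynamicProcess) : Prop :=
  ∀ s : ℝ, 0 ≤ s → 0 < m.P {ω | ENNReal.ofReal s < m.τ ω} →
    0 ≤ rdeu w (ProbabilityTheory.cond m.P {ω | ENNReal.ofReal s < m.τ ω})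
      (m.continuationPayoff θ s)

/-- `m` maximizes expected revenue among all dynamic pricing processes satisfying DIR. -/
def IsOptimal (w : ℝ → ℝ) (θ : ℝ) (m : DynamicProcess) : Prop :=
  m.DIR w θ ∧ ∀ m' : DynamicProcess, m'.DIR w θ → m'.revenue ≤ m.revenue

/-- The delivery time is exponential with rate one: `P(τ > t) = e^{-t}`. -/
def HasExponentialTime (m : DynamicProcess) : Prop :=
  ∀ t : ℝ, 0 ≤ t → m.P {ω | ENNReal.ofReal t < m.τ ω} = ENNReal.ofReal (Real.exp (-t))

end DynamicProcess

/-! ### The integral equations behind the optimal payment function -/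

/-- `g ∈ L¹[0,a]` and
`e^{-t} - v(e^{-t}) - ∫₀ᵗ v(e^{-t+s}) g(s) ds = 0` for all `t ∈ [0,a]`. -/
def SolvesMultiplierEq (v : ℝ → ℝ) (a : ℝ) (g : ℝ → ℝ) : Prop :=
  IntegrableOn g (Icc 0 a) ∧ ∀ t ∈ Icc 0 a,
    Real.exp (-t) - v (Real.exp (-t)) - ∫ s in (0 : ℝ)..t, v (Real.exp (-t + s)) * g s = 0

/-- `f ∈ L¹[0,b]` and
`v(e^{-b+t}) + ∫ₜᵇ v(e^{-s+t}) f(s) ds = 1` for all `t ∈ [0,b]`. -/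
def SolvesFlowEq (v : ℝ → ℝ) (b : ℝ) (f : ℝ → ℝ) : Prop :=
  IntegrableOn f (Icc 0 b) ∧ ∀ t ∈ Icc 0 b,
    v (Real.exp (-b + t)) + ∫ s in t..b, v (Real.exp (-s + t)) * f s = 1

/-- The payment function `t ↦ θ (1_{t > t₀} + ∫₀^{min(t,t₀)} f(s) ds)`. -/
def paymentFunction (θ t₀ : ℝ) (f : ℝ → ℝ) (t : ℝ) : ℝ :=
  θ * ((if t₀ < t then 1 else 0) + ∫ s in (0 : ℝ)..(min t t₀), f s)

end

/-! Write `v` for the loss weighting `1 - w(1 - p)`. If a payoff is `θ - L` with a random loss `L ≥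
0`, a layer-cake computation gives RDEU `= θ - ∫ v(P(L > u)) du` (`rdeu_eq`). Nondelivery counts as
a loss of `θ`, so participation becomes a bound by `θ` on an integral of `v` over the tail
probabilities of the loss. This already yields the comparison with prospect theory.

Static problem. Revenue is at most `E L = ∫ P(L > u) du`, and `q ≤ μ v(q)` pointwise, so revenue is
at most `μθ`. Equality forces `X = 1` almost surely and a tail with values in `{0, p}`, where `p` is
the only interior point with `μ v(p) = p`. The third-derivative hypothesis enters through `hermite`:
a parabola through the origin tangent to `v` at `q` lies strictly below `v` on `(0,q)`.

Dynamic problem. Let `G` be the tail of the total payment. Time matters only through survival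
probabilities: DIR implies `∫ 1{G ≤ e^{-t}} v(G e^t) dy ≤ θ` for all `t ≥ 0`
(`DynamicProcess.tailConstraint_le`), and the converse holds under sure delivery (`dir_of_relaxed`).
The relaxed problem maximizes `∫ G` under these constraints and is solved by linear duality, with a
unit mass at `t = 0` and a density `g` on `(0,t₀)` as multiplier. Weak duality needs `z ≤ v(z) + ∫
1{z ≤ e^{-t}} v(z e^t) g(t) dt` for every `z ∈ [0,1]`. Equality for `z ≥ e^{-t₀}` is exactly the
multiplier equation (`dualBound_eq`). For `0 < z < e^{-t₀}` the inequality is strict: `hermite` is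
integrated against `g`, and the result collapses to `z` because `g(t₀) = 0` (`lt_dualBound`).

Both integral equations are solved by renewal theory. Let `κ(t) = v'(e^{-t}) e^{-t}` be the density
of `-log V`, where `V` has distribution function `v`, let `K(t) = v(e^{-t})` be its tail and `R = κ
+ κ⋆κ + ⋯`. Then `K + K⋆R = 1`. Hence `f(s) = R(t₀ - s)` is the optimal flow, and `g = R - (e +
R⋆e)` with `e(t) = e^{-t}` is the multiplier. With exponential delivery and this flow every
constraint on `[0,t₀]` binds (`IsCandidate.tailConstraint_eq`), so the process attains the dual
value.

Uniqueness. By complementary slackness an optimal `G` avoids `(0, e^{-t₀})` and has binding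
constraints at `0` and almost everywhere on `(0,t₀)`. Integrating these against `R` determines the
lengths of the level sets of `G` (`volume_level`), and a monotone right-continuous function is
determined by them. The binding constraint at `t = 0` also rules out nondelivery
(`τ_lt_top_of_tight`). -/

/-! ### The shape of the loss weighting. -/

/-- The analytic properties of a loss weighting `v` that are used below, with first and second
derivatives `v₁`, `v₂` on `(0,1)`. -/
structure IsLossWeight (v v₁ v₂ : ℝ → ℝ) : Prop where
  cont : Continuous v
  mono : Monotone v
  strictMono : StrictMonoOn v (Icc 0 1)
  map_zero : v 0 = 0
  map_one : v 1 = 1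
  hasDerivAt : ∀ p ∈ Ioo (0 : ℝ) 1, HasDerivAt v (v₁ p) p
  hasDerivAt₂ : ∀ p ∈ Ioo (0 : ℝ) 1, HasDerivAt v₁ (v₂ p) p
  strictMono₂ : StrictMonoOn v₂ (Ioo 0 1)
  near_zero : ∃ d > (1 : ℝ), ∃ δ ∈ Ioo (0 : ℝ) 1, ∀ p ∈ Ioo 0 δ, d * p ≤ v p
  near_one : ∃ d > (1 : ℝ), ∃ δ ∈ Ioo (0 : ℝ) 1, ∀ p ∈ Ioo δ 1, d * (1 - p) ≤ 1 - v p

/-- The dual weighting function, extended to a function on the line that is constant outside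
`[0,1]`. -/
noncomputable def clampDual (w : ℝ → ℝ) (x : ℝ) : ℝ := dualWeight w (max 0 (min 1 x))

theorem clampDual_eq (w : ℝ → ℝ) {x : ℝ} (hx : x ∈ Icc (0 : ℝ) 1) :
    clampDual w x = dualWeight w x := by
  simp [clampDual, hx.1, hx.2]

theorem exists_mul_le_of_tendsto_slope {w : ℝ → ℝ} {x₀ : ℝ} {l : Filter ℝ} {d : EReal}
    (hd : 1 < d) (h : Tendsto (fun p : ℝ => ((slope w x₀ p : ℝ) : EReal)) l (𝓝 d)) :
    ∃ c > (1 : ℝ), ∀ᶠ p in l, c ≤ slope w x₀ p := by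
  obtain ⟨c, hc1, hcd⟩ := EReal.lt_iff_exists_real_btwn.1 hd
  refine ⟨c, by exact_mod_cast hc1, ?_⟩
  filter_upwards [h.eventually (lt_mem_nhds hcd)] with p hp
  exact (EReal.coe_lt_coe_iff.1 hp).le

/-- The reflection `p ↦ 1 - p` exchanges the two ends, so the slope of `w` at `1` controls `v` near
`0` and conversely. Two sign changes leave the third derivative positive, so `v''` is strictly
increasing; only this monotonicity is used later. -/
theorem IsWeightingFunction.isLossWeight {w : ℝ → ℝ} (hw : IsWeightingFunction w) :
    IsLossWeight (clampDual w) (fun p => deriv w (1 - p)) (fun p => - iteratedDeriv 2 w (1 - p)) where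
  cont := by
    have : Continuous (fun x : ℝ => w (1 - max 0 (min 1 x))) := by
      refine hw.continuousOn.comp_continuous (by fun_prop) fun x => ?_
      have h1 : min 1 x ≤ 1 := min_le_left _ _
      have h2 : (0:ℝ) ≤ max 0 (min 1 x) := le_max_left _ _
      have h3 : max 0 (min 1 x) ≤ 1 := max_le zero_le_one h1
      exact ⟨by linarith, by linarith⟩
    exact continuous_const.sub this
  mono := by
    intro x y hxy
    have h : max 0 (min 1 x) ≤ max 0 (min 1 y) := max_le_max le_rfl (min_le_min le_rfl hxy)
    have h3 : ∀ z : ℝ, max 0 (min 1 z) ≤ 1 := fun z => max_le zero_le_one (min_le_left _ _)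
    have h2 : ∀ z : ℝ, 0 ≤ max 0 (min 1 z) := fun z => le_max_left _ _
    have := hw.strictMonoOn.monotoneOn (a := 1 - max 0 (min 1 y)) (b := 1 - max 0 (min 1 x))
      ⟨by linarith [h3 y], by linarith [h2 y]⟩ ⟨by linarith [h3 x], by linarith [h2 x]⟩
      (by linarith)
    simp only [clampDual, dualWeight]
    linarith
  strictMono := by
    intro x hx y hy hxy
    rw [clampDual_eq w hx, clampDual_eq w hy]
    have := hw.strictMonoOn (a := 1 - y) (b := 1 - x)
      ⟨by linarith [hy.2], by linarith [hy.1]⟩ ⟨by linarith [hx.2], by linarith [hx.1]⟩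
      (by linarith)
    simp only [dualWeight]
    linarith
  map_zero := by rw [clampDual_eq w ⟨le_rfl, zero_le_one⟩]; simp [dualWeight, hw.map_one]
  map_one := by rw [clampDual_eq w ⟨zero_le_one, le_rfl⟩]; simp [dualWeight, hw.map_zero]
  hasDerivAt := by
    intro p hp
    have hp' : 1 - p ∈ Ioo (0 : ℝ) 1 := ⟨by linarith [hp.2], by linarith [hp.1]⟩
    have h0 := (hw.differentiableAt 0 (by norm_num) _ hp').hasDerivAt
    simp only [iteratedDeriv_zero] at h0
    have h1 : HasDerivAt (dualWeight w) (deriv w (1 - p)) p := by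
      have := (h0.comp p ((hasDerivAt_id p).const_sub 1)).const_sub 1
      convert! this using 1
      simp
    refine h1.congr_of_eventuallyEq ?_
    filter_upwards [Ioo_mem_nhds hp.1 hp.2] with x hx
    exact clampDual_eq w ⟨hx.1.le, hx.2.le⟩
  hasDerivAt₂ := by
    intro p hp
    have hp' : 1 - p ∈ Ioo (0 : ℝ) 1 := ⟨by linarith [hp.2], by linarith [hp.1]⟩
    have h0 := (hw.differentiableAt 1 (by norm_num) _ hp').hasDerivAt
    rw [← iteratedDeriv_succ, iteratedDeriv_one] at h0
    have := h0.comp p ((hasDerivAt_id p).const_sub 1)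
    convert! this using 1
    simp
  strictMono₂ := by
    have h : StrictMonoOn (iteratedDeriv 2 w) (Ioo 0 1) := by
      refine strictMonoOn_of_deriv_pos (convex_Ioo 0 1)
        (fun x hx => (hw.differentiableAt 2 (by norm_num) x hx).continuousAt.continuousWithinAt) ?_
      intro x hx
      rw [interior_Ioo] at hx
      rw [← iteratedDeriv_succ]
      exact hw.third_deriv_pos x hx
    intro x hx y hy hxy
    have := h (a := 1 - y) (b := 1 - x)
      ⟨by linarith [hy.2], by linarith [hy.1]⟩ ⟨by linarith [hx.2], by linarith [hx.1]⟩
      (by linarith)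
    simp only
    linarith
  near_zero := by
    obtain ⟨d, hd, h⟩ := hw.deriv_one
    obtain ⟨c, hc, h⟩ := exists_mul_le_of_tendsto_slope hd h
    obtain ⟨l, hl, hl'⟩ := (mem_nhdsLT_iff_exists_Ioo_subset.1 h)
    have hl : l < 1 := hl
    refine ⟨c, hc, min (1 - l) (1/2), ⟨lt_min (by linarith) (by norm_num),
      lt_of_le_of_lt (min_le_right _ _) (by norm_num)⟩, fun p hp => ?_⟩
    have hp1 := lt_of_lt_of_le hp.2 (min_le_left _ _)
    have hp2 := lt_of_lt_of_le hp.2 (min_le_right _ _)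
    have hp0 := hp.1
    have := hl' (show 1 - p ∈ Ioo l 1 from ⟨by linarith, by linarith⟩)
    simp only [mem_ofPred_eq, slope_def_field, hw.map_one] at this
    rw [clampDual_eq w ⟨hp.1.le, by linarith⟩, dualWeight]
    rw [show w (1 - p) - 1 = -(1 - w (1 - p)) by ring, show 1 - p - 1 = -p by ring, neg_div_neg_eq,
      le_div_iff₀ hp.1] at this
    exact this
  near_one := by
    obtain ⟨d, hd, h⟩ := hw.deriv_zero
    obtain ⟨c, hc, h⟩ := exists_mul_le_of_tendsto_slope hd h
    obtain ⟨u, hu, hu'⟩ := (mem_nhdsGT_iff_exists_Ioo_subset.1 h)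
    have hu : 0 < u := hu
    refine ⟨c, hc, max (1 - u) (1/2), ⟨lt_of_lt_of_le (by norm_num) (le_max_right _ _),
      max_lt (by linarith) (by norm_num)⟩, fun p hp => ?_⟩
    have hp1 := lt_of_le_of_lt (le_max_left _ _) hp.1
    have hp2 := lt_of_le_of_lt (le_max_right _ _) hp.1
    have hp0 := hp.2
    have := hu' (show 1 - p ∈ Ioo 0 u from ⟨by linarith, by linarith⟩)
    simp only [mem_ofPred_eq, slope_def_field, hw.map_zero, sub_zero] at this
    rw [clampDual_eq w ⟨by linarith, hp.2.le⟩, dualWeight]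
    rw [le_div_iff₀ (by linarith)] at this
    linarith

namespace IsLossWeight

variable {v v₁ v₂ : ℝ → ℝ}

theorem nonneg (h : IsLossWeight v v₁ v₂) {x : ℝ} (hx : 0 ≤ x) : 0 ≤ v x := by
  rw [← h.map_zero]; exact h.mono hx

theorem le_one (h : IsLossWeight v v₁ v₂) {x : ℝ} (hx : x ≤ 1) : v x ≤ 1 := by
  rw [← h.map_one]; exact h.mono hx

theorem pos (h : IsLossWeight v v₁ v₂) {x : ℝ} (hx : 0 < x) (hx1 : x ≤ 1) : 0 < v x := by
  have := h.strictMono (left_mem_Icc.2 zero_le_one) ⟨hx.le, hx1⟩ hx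
  rwa [h.map_zero] at this

theorem injOn (h : IsLossWeight v v₁ v₂) : InjOn v (Icc 0 1) := h.strictMono.injOn

theorem deriv_nonneg (h : IsLossWeight v v₁ v₂) {p : ℝ} (hp : p ∈ Ioo (0 : ℝ) 1) : 0 ≤ v₁ p := by
  rw [← (h.hasDerivAt p hp).deriv]
  exact h.mono.deriv_nonneg

theorem continuousOn_deriv (h : IsLossWeight v v₁ v₂) : ContinuousOn v₁ (Ioo 0 1) :=
  fun p hp => (h.hasDerivAt₂ p hp).continuousAt.continuousWithinAt

/-- Since `v' ≥ 0`, a zero of `v'` is a minimum of `v'`, hence a zero of the injective function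
`v''`. -/
theorem deriv_zero_unique (h : IsLossWeight v v₁ v₂) {p q : ℝ} (hp : p ∈ Ioo (0 : ℝ) 1)
    (hq : q ∈ Ioo (0 : ℝ) 1) (hp0 : v₁ p = 0) (hq0 : v₁ q = 0) : p = q := by
  have key : ∀ r ∈ Ioo (0 : ℝ) 1, v₁ r = 0 → v₂ r = 0 := by
    intro r hr hr0
    refine IsLocalMin.hasDerivAt_eq_zero (f := v₁) ?_ (h.hasDerivAt₂ r hr)
    filter_upwards [Ioo_mem_nhds hr.1 hr.2] with x hx
    rw [hr0]; exact h.deriv_nonneg hx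
  exact h.strictMono₂.injOn hp hq ((key p hp hp0).trans (key q hq hq0).symm)

/-- A parabola through the origin that is tangent to the graph at `q` lies below the graph
on `(0,q)`. -/
theorem hermite (h : IsLossWeight v v₁ v₂) {q x : ℝ} (hq : q ∈ Ioo (0 : ℝ) 1) (hx : x ∈ Ioo 0 q) :
    (2 * v q / q - v₁ q) * x + (q * v₁ q - v q) * (x / q) ^ 2 < v x := by
  set a := 2 * v q / q - v₁ q with ha
  set b := (q * v₁ q - v q) / q ^ 2 with hb
  have hq0 : q ≠ 0 := hq.1.ne'
  -- `D` vanishes at `0` and doubly at `q`; the interpolation remainder would be `v'''(η) x (x - q)²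
  -- / 6 > 0`. The argument below obtains the sign from strict monotonicity of `v''` alone.
  set D : ℝ → ℝ := fun x => v x - (a * x + b * x ^ 2) with hD
  have hsub : Ioc 0 q ⊆ Ioo (0:ℝ) 1 := fun y hy => ⟨hy.1, hy.2.trans_lt hq.2⟩
  have hD1 : ∀ y ∈ Ioc 0 q, HasDerivAt D (v₁ y - (a + 2 * b * y)) y := by
    intro y hy
    have h1 : HasDerivAt (fun x : ℝ => a * x + b * x ^ 2) (a + 2 * b * y) y := by
      have := ((hasDerivAt_id y).const_mul a).add (((hasDerivAt_id y).pow 2).const_mul b)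
      convert! this using 1
      simp; ring
    exact (h.hasDerivAt y (hsub hy)).sub h1
  have hD2 : ∀ y ∈ Ioc 0 q, HasDerivAt (fun y => v₁ y - (a + 2 * b * y)) (v₂ y - 2 * b) y := by
    intro y hy
    have h1 : HasDerivAt (fun x : ℝ => a + 2 * b * x) (2 * b) y := by
      have := ((hasDerivAt_id y).const_mul (2 * b)).const_add a
      simpa using this
    exact (h.hasDerivAt₂ y (hsub hy)).sub h1
  have hDc : Continuous D := by
    have := h.cont
    fun_prop
  have hD0 : D 0 = 0 := by simp [hD, h.map_zero]
  have hDq : D q = 0 := by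
    simp only [hD, ha, hb]; field_simp; ring
  have hD'q : v₁ q - (a + 2 * b * q) = 0 := by
    simp only [ha, hb]; field_simp; ring
  -- Rolle twice: `D'` vanishes at `ξ` and at `q`, so `D''` vanishes at some `ζ` between them. As
  -- `D''` is increasing, `D'` falls before `ζ` and rises after it. Thus `D' > 0` before `ξ` and `D'
  -- < 0` on `(ξ,q)`: `D` climbs from `0` and returns to `0` at `q`.
  obtain ⟨ξ, hξ, hξ0⟩ := exists_hasDerivAt_eq_zero hq.1 hDc.continuousOn (hD0.trans hDq.symm)
    (fun y hy => hD1 y ⟨hy.1, hy.2.le⟩)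
  have hc1 : ContinuousOn (fun y => v₁ y - (a + 2 * b * y)) (Ioc 0 q) :=
    fun y hy => (hD2 y hy).continuousAt.continuousWithinAt
  obtain ⟨ζ, hζ, hζ0⟩ := exists_hasDerivAt_eq_zero hξ.2
    (hc1.mono fun y hy => ⟨hξ.1.trans_le hy.1, hy.2⟩) (hξ0.trans hD'q.symm)
    (fun y hy => hD2 y ⟨hξ.1.trans hy.1, hy.2.le⟩)
  have hζ1 : ζ ∈ Ioc 0 q := ⟨hξ.1.trans hζ.1, hζ.2.le⟩
  have hanti : StrictAntiOn (fun y => v₁ y - (a + 2 * b * y)) (Ioc 0 ζ) := by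
    refine strictAntiOn_of_deriv_neg (convex_Ioc 0 ζ)
      (hc1.mono fun y hy => ⟨hy.1, hy.2.trans hζ1.2⟩) fun y hy => ?_
    rw [interior_Ioc] at hy
    rw [(hD2 y ⟨hy.1, hy.2.le.trans hζ1.2⟩).deriv]
    have := h.strictMono₂ (hsub ⟨hy.1, hy.2.le.trans hζ1.2⟩) (hsub hζ1) hy.2
    linarith
  have hmono : StrictMonoOn (fun y => v₁ y - (a + 2 * b * y)) (Icc ζ q) := by
    refine strictMonoOn_of_deriv_pos (convex_Icc ζ q)
      (hc1.mono fun y hy => ⟨hζ1.1.trans_le hy.1, hy.2⟩) fun y hy => ?_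
    rw [interior_Icc] at hy
    rw [(hD2 y ⟨hζ1.1.trans hy.1, hy.2.le⟩).deriv]
    have := h.strictMono₂ (hsub hζ1) (hsub ⟨hζ1.1.trans hy.1, hy.2.le⟩) hy.1
    linarith
  have hDpos : StrictMonoOn D (Icc 0 ξ) := by
    refine strictMonoOn_of_deriv_pos (convex_Icc 0 ξ) hDc.continuousOn fun y hy => ?_
    rw [interior_Icc] at hy
    rw [(hD1 y ⟨hy.1, hy.2.le.trans hξ.2.le⟩).deriv]
    have := hanti ⟨hy.1, (hy.2.trans hζ.1).le⟩ ⟨hξ.1, hζ.1.le⟩ hy.2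
    simp only at this
    linarith
  have hDneg : StrictAntiOn D (Icc ξ q) := by
    refine strictAntiOn_of_deriv_neg (convex_Icc ξ q) hDc.continuousOn fun y hy => ?_
    rw [interior_Icc] at hy
    rw [(hD1 y ⟨hξ.1.trans hy.1, hy.2.le⟩).deriv]
    rcases le_or_gt y ζ with hyζ | hyζ
    · have := hanti ⟨hξ.1, hζ.1.le⟩ ⟨hξ.1.trans hy.1, hyζ⟩ hy.1
      simp only at this
      linarith
    · have := hmono ⟨hyζ.le, hy.2.le⟩ ⟨hζ1.2, le_rfl⟩ hy.2
      simp only at this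
      linarith
  have hDx : 0 < D x := by
    rcases le_or_gt x ξ with hxξ | hxξ
    · have := hDpos ⟨le_rfl, hξ.1.le⟩ ⟨hx.1.le, hxξ⟩ hx.1
      linarith
    · have := hDneg ⟨hxξ.le, hx.2.le⟩ ⟨hξ.2.le, le_rfl⟩ hx.2
      linarith
  have e : (q * v₁ q - v q) * (x / q) ^ 2 = b * x ^ 2 := by
    simp only [hb]; field_simp
  rw [e]
  simp only [hD] at hDx
  linarith

/-- Existence: `v` lies above the diagonal near `0` and below it near `1`. Uniqueness: with two
interior fixed points `v - id` has four zeros on `[0,1]`, so by Rolle `v''` has two zeros, against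
its strict monotonicity. -/
theorem exists_fixed (h : IsLossWeight v v₁ v₂) :
    ∃ p ∈ Ioo (0 : ℝ) 1, v p = p ∧ ∀ q ∈ Ioo (0 : ℝ) 1, v q = q → q = p := by
  obtain ⟨d, hd, δ, hδ, h0⟩ := h.near_zero
  obtain ⟨d', hd', δ', hδ', h1⟩ := h.near_one
  have hlt : ∃ x ∈ Ioo (0 : ℝ) 1, x < v x := by
    refine ⟨δ / 2, ⟨by linarith [hδ.1], by linarith [hδ.2, hδ.1]⟩, ?_⟩
    have := h0 (δ / 2) ⟨by linarith [hδ.1], by linarith [hδ.1]⟩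
    nlinarith [hδ.1]
  have hgt : ∃ x ∈ Ioo (0 : ℝ) 1, v x < x := by
    refine ⟨(δ' + 1) / 2, ⟨by linarith [hδ'.1], by linarith [hδ'.2]⟩, ?_⟩
    have := h1 ((δ' + 1) / 2) ⟨by linarith [hδ'.2], by linarith [hδ'.2]⟩
    nlinarith [hδ'.2]
  obtain ⟨x, hx, hx'⟩ := hlt
  obtain ⟨y, hy, hy'⟩ := hgt
  have hc : ContinuousOn (fun t => v t - t) (Ioo (0:ℝ) 1) := (h.cont.sub continuous_id).continuousOn
  obtain ⟨p, hp, hp0⟩ := isPreconnected_Ioo.intermediate_value hy hx hc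
    (show (0:ℝ) ∈ Icc (v y - y) (v x - x) from ⟨by linarith, by linarith⟩)
  have hp0 : v p = p := by simp only at hp0; linarith
  have key : ∀ a ∈ Ioo (0 : ℝ) 1, ∀ b ∈ Ioo (0 : ℝ) 1, v a = a → v b = b → a < b → False := by
    intro a ha b hb hva hvb hab
    have hD : ∀ y ∈ Ioo (0:ℝ) 1, HasDerivAt (fun t => v t - t) (v₁ y - 1) y :=
      fun y hy => (h.hasDerivAt y hy).sub (hasDerivAt_id y)
    have hD2 : ∀ y ∈ Ioo (0:ℝ) 1, HasDerivAt (fun t => v₁ t - 1) (v₂ y) y :=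
      fun y hy => (h.hasDerivAt₂ y hy).sub_const 1
    have hcc : Continuous (fun t => v t - t) := h.cont.sub continuous_id
    have hc1 : ContinuousOn (fun t => v₁ t - 1) (Ioo 0 1) := h.continuousOn_deriv.sub continuousOn_const
    obtain ⟨r, hr, hr0⟩ := exists_hasDerivAt_eq_zero ha.1 hcc.continuousOn
      (by simp [h.map_zero, hva]) (fun y hy => hD y ⟨hy.1, hy.2.trans ha.2⟩)
    obtain ⟨s, hs, hs0⟩ := exists_hasDerivAt_eq_zero hab hcc.continuousOn
      (by simp [hva, hvb]) (fun y hy => hD y ⟨ha.1.trans hy.1, hy.2.trans hb.2⟩)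
    obtain ⟨t, ht, ht0⟩ := exists_hasDerivAt_eq_zero hb.2 hcc.continuousOn
      (by simp [h.map_one, hvb]) (fun y hy => hD y ⟨hb.1.trans hy.1, hy.2⟩)
    have hrs : r < s := hr.2.trans hs.1
    have hst : s < t := hs.2.trans ht.1
    obtain ⟨y, hy, hy0⟩ := exists_hasDerivAt_eq_zero hrs
      (hc1.mono fun z hz => ⟨hr.1.trans_le hz.1, (hz.2.trans_lt hst).trans ht.2⟩) (hr0.trans hs0.symm)
      (fun y hy => hD2 y ⟨hr.1.trans hy.1, (hy.2.trans hst).trans ht.2⟩)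
    obtain ⟨z, hz, hz0⟩ := exists_hasDerivAt_eq_zero hst
      (hc1.mono fun z hz => ⟨(hr.1.trans hrs).trans_le hz.1, hz.2.trans_lt ht.2⟩) (hs0.trans ht0.symm)
      (fun y hy => hD2 y ⟨(hr.1.trans hrs).trans hy.1, hy.2.trans ht.2⟩)
    have := h.strictMono₂ ⟨hr.1.trans hy.1, (hy.2.trans hst).trans ht.2⟩
      ⟨(hr.1.trans hrs).trans hz.1, hz.2.trans ht.2⟩ (hy.2.trans hz.1)
    linarith
  refine ⟨p, hp, hp0, fun q hq hq0 => ?_⟩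
  rcases lt_trichotomy q p with hlt | heq | hgt
  · exact (key q hq p hp hq0 hp0 hlt).elim
  · exact heq
  · exact (key p hp q hq hp0 hq0 hgt).elim

/-- The maximum of `q / v q` and its unique maximizer. -/
theorem exists_max_ratio (h : IsLossWeight v v₁ v₂) :
    ∃ μ p : ℝ, 1 < μ ∧ p ∈ Ioo (0 : ℝ) 1 ∧ μ * v p = p ∧ (∀ q ∈ Icc (0 : ℝ) 1, q ≤ μ * v q) ∧
      ∀ q ∈ Ioo (0 : ℝ) 1, μ * v q = q → q = p := by
  obtain ⟨d, hd, δ, hδ, h0⟩ := h.near_zero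
  obtain ⟨d', hd', δ', hδ', h1⟩ := h.near_one
  have hpos : ∀ q ∈ Ioc (0 : ℝ) 1, 0 < v q := fun q hq => h.pos hq.1 hq.2
  -- Below `δ` the ratio is at most `1/d < 1`, so the maximum over `[δ/2, 1]` is the global one.
  have hc : ContinuousOn (fun q => q / v q) (Icc (δ / 2) 1) :=
    continuousOn_id.div h.cont.continuousOn fun q hq => (hpos q ⟨by linarith [hδ.1, hq.1], hq.2⟩).ne'
  obtain ⟨p, hp, hmax⟩ := isCompact_Icc.exists_isMaxOn
    ⟨1, show (1:ℝ) ∈ Icc (δ / 2) 1 from ⟨by linarith [hδ.2, hδ.1], le_rfl⟩⟩ hc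
  have hp0 : 0 < p := by linarith [hδ.1, hp.1]
  have hgt : ∃ x ∈ Icc (δ / 2) 1, v x < x := by
    have hm : max δ ((δ' + 1) / 2) < 1 := max_lt hδ.2 (by linarith [hδ'.2])
    refine ⟨max δ ((δ' + 1) / 2), ⟨le_trans (by linarith [hδ.1]) (le_max_left _ _), hm.le⟩, ?_⟩
    have := h1 (max δ ((δ' + 1) / 2)) ⟨lt_of_lt_of_le (by linarith [hδ'.2]) (le_max_right _ _), hm⟩
    nlinarith
  obtain ⟨x, hx, hx'⟩ := hgt
  have hμ1 : 1 < p / v p := by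
    have hm := hmax hx
    simp only [mem_ofPred_eq] at hm
    have : 1 < x / v x := by
      rw [one_lt_div (hpos x ⟨by linarith [hδ.1, hx.1], hx.2⟩)]
      exact hx'
    linarith
  have hvp := hpos p ⟨hp0, hp.2⟩
  have hp1 : p < 1 := by
    refine lt_of_le_of_ne hp.2 fun e => ?_
    rw [e, h.map_one] at hμ1
    norm_num at hμ1
  have hall : ∀ q ∈ Icc (0 : ℝ) 1, q ≤ p / v p * v q := by
    intro q hq
    rcases eq_or_lt_of_le hq.1 with e | hq0
    · rw [← e, h.map_zero]; simp
    · have hvq := hpos q ⟨hq0, hq.2⟩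
      rcases lt_or_ge q δ with hlt | hge
      · have := h0 q ⟨hq0, hlt⟩
        nlinarith
      · have := hmax (show q ∈ Icc (δ / 2) 1 from ⟨by linarith [hδ.1], hq.2⟩)
        simp only [mem_ofPred_eq] at this
        rwa [div_le_iff₀ hvq] at this
  set μ := p / v p with hμ
  have hμp : μ * v p = p := by rw [hμ]; field_simp
  have hμ0 : 0 < μ := by linarith
  have hder : ∀ a ∈ Ioo (0 : ℝ) 1, μ * v a = a → μ * v₁ a = 1 := by
    intro a ha hva
    have : μ * v₁ a - 1 = 0 := by
      refine IsLocalMin.hasDerivAt_eq_zero (f := fun t => μ * v t - t) ?_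
        (((h.hasDerivAt a ha).const_mul μ).sub (hasDerivAt_id a))
      filter_upwards [Ioo_mem_nhds ha.1 ha.2] with t ht
      have := hall t ⟨ht.1.le, ht.2.le⟩
      simp only [hva]
      linarith
    linarith
  -- At a contact point `b` the line `x/μ` is tangent to `v`, so the parabola of `hermite` at `b`
  -- degenerates to that line. Its strict inequality forbids contact at any `a < b`.
  have key : ∀ a ∈ Ioo (0 : ℝ) 1, ∀ b ∈ Ioo (0 : ℝ) 1, μ * v a = a → μ * v b = b → a < b → False := by
    intro a ha b hb hva hvb hab
    have hh := h.hermite hb ⟨ha.1, hab⟩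
    have e1 : v b = b / μ := by rw [eq_div_iff hμ0.ne']; linarith
    have e2 : v₁ b = 1 / μ := by rw [eq_div_iff hμ0.ne']; linarith [hder b hb hvb]
    have e3 : v a = a / μ := by rw [eq_div_iff hμ0.ne']; linarith
    have hb0 := hb.1.ne'
    rw [e1, e2, e3] at hh
    have : (2 * (b / μ) / b - 1 / μ) * a + (b * (1 / μ) - b / μ) * (a / b) ^ 2 = a / μ := by
      field_simp; ring
    linarith
  refine ⟨μ, p, hμ1, ⟨hp0, hp1⟩, hμp, hall, fun q hq hq0 => ?_⟩
  rcases lt_trichotomy q p with hlt | heq | hgt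
  · exact (key q hq p ⟨hp0, hp1⟩ hq0 hμp hlt).elim
  · exact heq
  · exact (key p ⟨hp0, hp1⟩ q hq hμp hq0 hgt).elim

/-- If `v'' ≤ 0` throughout, `v` is concave and lies above its chord, the diagonal; this contradicts
slope greater than one at `1`. Once `v''` is positive it stays positive. -/
theorem exists_convex_near_one (h : IsLossWeight v v₁ v₂) :
    ∃ c ∈ Ioo (0 : ℝ) 1, StrictMonoOn v₁ (Ioo c 1) := by
  obtain ⟨d', hd', δ', hδ', h1⟩ := h.near_one
  have hc : ∃ c ∈ Ioo (0 : ℝ) 1, 0 < v₂ c := by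
    by_contra! hcon
    have hconc : ConcaveOn ℝ (Icc 0 1) v := by
      refine AntitoneOn.concaveOn_of_deriv (convex_Icc 0 1) h.cont.continuousOn
        (fun y hy => ?_) ?_
      · rw [interior_Icc] at hy
        exact (h.hasDerivAt y hy).differentiableAt.differentiableWithinAt
      · rw [interior_Icc]
        have : AntitoneOn v₁ (Ioo 0 1) := by
          refine antitoneOn_of_deriv_nonpos (convex_Ioo 0 1) h.continuousOn_deriv
            (fun y hy => ?_) fun y hy => ?_
          · rw [interior_Ioo] at hy
            exact (h.hasDerivAt₂ y hy).differentiableAt.differentiableWithinAt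
          · rw [interior_Ioo] at hy
            rw [(h.hasDerivAt₂ y hy).deriv]
            exact hcon y hy
        exact this.congr fun y hy => (h.hasDerivAt y hy).deriv.symm
    set x := (δ' + 1) / 2 with hx
    have hx1 : x < 1 := by rw [hx]; linarith [hδ'.2]
    have hx0 : 0 < x := by rw [hx]; linarith [hδ'.1]
    have h2 := h1 x ⟨by rw [hx]; linarith [hδ'.2], hx1⟩
    have h3 := hconc.2 (left_mem_Icc.2 zero_le_one) (right_mem_Icc.2 zero_le_one)
      (show 0 ≤ 1 - x by linarith) hx0.le (by ring)
    simp only [smul_eq_mul, h.map_zero, h.map_one, mul_zero, zero_add, mul_one] at h3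
    nlinarith
  obtain ⟨c, hc, hc2⟩ := hc
  refine ⟨c, hc, strictMonoOn_of_deriv_pos (convex_Ioo c 1)
    (h.continuousOn_deriv.mono (Ioo_subset_Ioo_left hc.1.le)) fun y hy => ?_⟩
  rw [interior_Ioo] at hy
  have hy' : y ∈ Ioo (0:ℝ) 1 := ⟨hc.1.trans hy.1, hy.2⟩
  rw [(h.hasDerivAt₂ y hy').deriv]
  exact hc2.trans (h.strictMono₂ hc hy' hy.1)

/-- The tangent inequality of a convex function. It tames a possibly infinite slope at `1`: `v'(p)(1
- p)` tends to `0` there. -/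
theorem exists_deriv_mul_le (h : IsLossWeight v v₁ v₂) :
    ∃ c ∈ Ioo (0 : ℝ) 1, ∀ p ∈ Ioo c 1, v₁ p * (1 - p) ≤ 1 - v p := by
  obtain ⟨c, hc, hm⟩ := h.exists_convex_near_one
  refine ⟨c, hc, fun p hp => ?_⟩
  obtain ⟨ξ, hξ, hξ'⟩ := exists_hasDerivAt_eq_slope v v₁ hp.2 h.cont.continuousOn
    (fun y hy => h.hasDerivAt y ⟨hc.1.trans (hp.1.trans hy.1), hy.2⟩)
  rw [eq_div_iff (by linarith [hp.2]), h.map_one] at hξ'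
  have := hm hp ⟨hp.1.trans hξ.1, hξ.2⟩ hξ.1
  nlinarith [hp.2]

/-- Convexity near `1` upgrades the chord bound `near_one` to a bound on the derivative. -/
theorem exists_one_lt_deriv (h : IsLossWeight v v₁ v₂) :
    ∃ d > (1 : ℝ), ∃ c ∈ Ioo (0 : ℝ) 1, ∀ p ∈ Ioo c 1, d ≤ v₁ p := by
  obtain ⟨c, hc, hm⟩ := h.exists_convex_near_one
  obtain ⟨d, hd, δ, hδ, h1⟩ := h.near_one
  set p := (max c δ + 1) / 2 with hp
  have hm1 : max c δ < 1 := max_lt hc.2 hδ.2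
  have hcp : c < p := by rw [hp]; linarith [le_max_left c δ]
  have hδp : δ < p := by rw [hp]; linarith [le_max_right c δ]
  have hp1 : p < 1 := by rw [hp]; linarith
  obtain ⟨ξ, hξ, hξ'⟩ := exists_hasDerivAt_eq_slope v v₁ hp1 h.cont.continuousOn
    (fun y hy => h.hasDerivAt y ⟨hc.1.trans (hcp.trans hy.1), hy.2⟩)
  rw [eq_div_iff (by linarith), h.map_one] at hξ'
  have h2 := h1 p ⟨hδp, hp1⟩
  have hdξ : d ≤ v₁ ξ := by
    by_contra! hlt
    nlinarith
  refine ⟨d, hd, ξ, ⟨hc.1.trans (hcp.trans hξ.1), hξ.2⟩, fun y hy => ?_⟩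
  exact hdξ.trans (hm ⟨hcp.trans hξ.1, hξ.2⟩ ⟨(hcp.trans hξ.1).trans hy.1, hy.2⟩ hy.1).le

end IsLossWeight

/-! ### Convolutions and renewal densities on the half-line. -/

section Renewal

theorem lconvolution_add_right {f g k : ℝ → ℝ≥0∞} (hf : Measurable f) (hg : Measurable g) :
    f ⋆ₗ (g + k) = f ⋆ₗ g + f ⋆ₗ k := by
  ext x
  simp only [lconvolution_def, Pi.add_apply, mul_add]
  exact lintegral_add_left (by fun_prop) _

theorem lconvolution_add_left {f g k : ℝ → ℝ≥0∞} (hf : Measurable f) (hk : Measurable k) :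
    (f + g) ⋆ₗ k = f ⋆ₗ k + g ⋆ₗ k := by
  ext x
  simp only [lconvolution_def, Pi.add_apply, add_mul]
  exact lintegral_add_left (by fun_prop) _

theorem lintegral_lconvolution {f g : ℝ → ℝ≥0∞} (hf : Measurable f) (hg : Measurable g) :
    ∫⁻ x, (f ⋆ₗ g) x = (∫⁻ x, f x) * ∫⁻ x, g x := by
  simp only [lconvolution_def]
  rw [lintegral_lintegral_swap (by fun_prop)]
  have : ∀ y, ∫⁻ x, f y * g (-y + x) = f y * ∫⁻ x, g x := fun y => by
    rw [lintegral_const_mul _ (by fun_prop), lintegral_add_left_eq_self]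
  simp only [this]
  rw [lintegral_mul_const _ hf]

theorem lconvolution_eq_zero {f g : ℝ → ℝ≥0∞} (hf : ∀ t ≤ 0, f t = 0) (hg : ∀ t ≤ 0, g t = 0)
    {t : ℝ} (ht : t ≤ 0) : (f ⋆ₗ g) t = 0 := by
  rw [lconvolution_def]
  refine lintegral_eq_zero_of_ae_eq_zero (Eventually.of_forall fun y => ?_)
  rcases le_or_gt y 0 with hy | hy
  · simp [hf y hy]
  · simp [hg (-y + t) (by linarith)]

/-- Multiplication by the variable is a derivation for convolution on the half-line. -/
theorem mul_lconvolution {f g : ℝ → ℝ≥0∞} (hf : Measurable f) (hg : Measurable g)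
    (hf0 : ∀ t ≤ 0, f t = 0) (hg0 : ∀ t ≤ 0, g t = 0) (t : ℝ) :
    ENNReal.ofReal t * (f ⋆ₗ g) t =
      ((fun s => ENNReal.ofReal s * f s) ⋆ₗ g) t + (f ⋆ₗ (fun s => ENNReal.ofReal s * g s)) t := by
  simp only [lconvolution_def]
  rw [← lintegral_add_left (by fun_prop), ← lintegral_const_mul _ (by fun_prop)]
  refine lintegral_congr fun y => ?_
  rcases le_or_gt y 0 with hy | hy
  · simp [hf0 y hy]
  rcases le_or_gt (-y + t) 0 with hy' | hy'
  · simp [hg0 _ hy']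
  · have : t = y + (-y + t) := by ring
    conv_lhs => rw [this, ENNReal.ofReal_add hy.le hy'.le]
    simp only [add_neg_cancel_left]
    ring

/-- Convolution of functions on the half-line as an interval integral. -/
theorem lconvolution_toReal {f g : ℝ → ℝ≥0∞} (hf : Measurable f) (hg : Measurable g)
    (hf0 : ∀ t ≤ 0, f t = 0) (hg0 : ∀ t ≤ 0, g t = 0) {t : ℝ} (ht : 0 ≤ t)
    (hfin : (f ⋆ₗ g) t ≠ ⊤) :
    IntervalIntegrable (fun s => (f (t - s)).toReal * (g s).toReal) volume 0 t ∧
      ∫ s in (0 : ℝ)..t, (f (t - s)).toReal * (g s).toReal = ((f ⋆ₗ g) t).toReal := by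
  have e : (f ⋆ₗ g) t = ∫⁻ s, f (t - s) * g s := by
    rw [lconvolution_comm, lconvolution_def]
    refine lintegral_congr fun s => ?_
    rw [mul_comm, neg_add_eq_sub]
  have e2 : ∫⁻ s, f (t - s) * g s = ∫⁻ s in Ioc 0 t, f (t - s) * g s := by
    rw [← lintegral_indicator measurableSet_Ioc]
    refine lintegral_congr fun s => ?_
    by_cases hs : s ∈ Ioc 0 t
    · simp [hs]
    · rw [indicator_of_notMem hs]
      rcases le_or_gt s 0 with hs0 | hs0
      · simp [hg0 s hs0]
      · have : t < s := by
          by_contra! h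
          exact hs ⟨hs0, h⟩
        simp [hf0 (t - s) (by linarith)]
  rw [e2] at e
  rw [e] at hfin ⊢
  have hm : Measurable fun s => f (t - s) * g s := by fun_prop
  have hi : IntegrableOn (fun s => (f (t - s)).toReal * (g s).toReal) (Ioc 0 t) := by
    have := integrable_toReal_of_lintegral_ne_top hm.aemeasurable.restrict hfin
    simp only [ENNReal.toReal_mul] at this
    exact this
  refine ⟨(intervalIntegrable_iff_integrableOn_Ioc_of_le ht).2 hi, ?_⟩
  rw [intervalIntegral.integral_of_le ht]
  simp only [← ENNReal.toReal_mul]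
  exact integral_toReal hm.aemeasurable.restrict (ae_lt_top' hm.aemeasurable.restrict hfin)

/-- Dominated convergence. As `h` lives on positive arguments, only values of `m` to the left of `t`
enter, so continuity of `m` on `Iic a` suffices and a jump of `m` after `a` is harmless. -/
theorem continuousOn_lconvolution {h m : ℝ → ℝ≥0∞} (hh : Measurable h) (hm : Measurable m)
    (h0 : ∀ y ≤ 0, h y = 0) (hint : ∫⁻ y, h y ≠ ⊤) {C : ℝ≥0∞} (hC : C ≠ ⊤) (hmC : ∀ t, m t ≤ C)
    {a : ℝ} (hmc : ContinuousOn m (Iic a)) : ContinuousOn (h ⋆ₗ m) (Iic a) := by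
  intro t ht
  change Tendsto (fun t => (h ⋆ₗ m) t) _ (𝓝 ((h ⋆ₗ m) t))
  simp only [lconvolution_def]
  refine tendsto_lintegral_filter_of_dominated_convergence (fun y => h y * C)
    (Eventually.of_forall fun s => by fun_prop)
    (Eventually.of_forall fun s => Eventually.of_forall fun y => mul_le_mul' le_rfl (hmC _)) ?_ ?_
  · rw [lintegral_mul_const _ hh]
    exact ENNReal.mul_ne_top hint hC
  · filter_upwards [ae_lt_top hh hint] with y hy
    rcases le_or_gt y 0 with hy0 | hy0
    · simp only [h0 y hy0, zero_mul]
      exact tendsto_const_nhds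
    · refine ENNReal.Tendsto.const_mul ?_ (Or.inr hy.ne)
      have h1 : -y + t ∈ Iic a := by
        have : t ≤ a := ht
        simp only [mem_Iic]; linarith
      refine (hmc _ h1).tendsto.comp (tendsto_nhdsWithin_iff.2 ⟨?_, ?_⟩)
      · exact ((continuous_const.add continuous_id).tendsto t).mono_left nhdsWithin_le_nhds
      · filter_upwards [self_mem_nhdsWithin] with s hs
        have : s ≤ a := hs
        simp only [mem_Iic]; linarith

/-- The convolution powers `κ, κ⋆κ, …`. -/
noncomputable def convPow (κ : ℝ → ℝ≥0∞) : ℕ → ℝ → ℝ≥0∞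
  | 0 => κ
  | n + 1 => κ ⋆ₗ convPow κ n

/-- The renewal density `κ + κ⋆κ + ⋯`. -/
noncomputable def renewal (κ : ℝ → ℝ≥0∞) (t : ℝ) : ℝ≥0∞ := ∑' n, convPow κ n t

variable {κ : ℝ → ℝ≥0∞}

theorem measurable_convPow (hκ : Measurable κ) (n : ℕ) : Measurable (convPow κ n) := by
  induction n with
  | zero => exact hκ
  | succ n ih => exact measurable_lconvolution _ hκ ih

theorem measurable_renewal (hκ : Measurable κ) : Measurable (renewal κ) :=
  Measurable.tsum fun n => measurable_convPow hκ n

theorem convPow_eq_zero (h0 : ∀ t ≤ 0, κ t = 0) (n : ℕ) {t : ℝ} (ht : t ≤ 0) :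
    convPow κ n t = 0 := by
  induction n generalizing t with
  | zero => exact h0 t ht
  | succ n ih => exact lconvolution_eq_zero h0 (fun t ht => ih ht) ht

theorem renewal_eq_zero (h0 : ∀ t ≤ 0, κ t = 0) {t : ℝ} (ht : t ≤ 0) : renewal κ t = 0 := by
  simp [renewal, convPow_eq_zero h0 _ ht]

theorem lintegral_convPow (hκ : Measurable κ) (n : ℕ) :
    ∫⁻ t, convPow κ n t = (∫⁻ t, κ t) ^ (n + 1) := by
  induction n with
  | zero => simp [convPow]
  | succ n ih =>
    rw [convPow, lintegral_lconvolution hκ (measurable_convPow hκ n), ih, pow_succ' _ (n + 1)]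

theorem lconvolution_tsum {f : ℝ → ℝ≥0∞} {g : ℕ → ℝ → ℝ≥0∞} (hf : Measurable f)
    (hg : ∀ n, Measurable (g n)) (t : ℝ) :
    (f ⋆ₗ fun s => ∑' n, g n s) t = ∑' n, (f ⋆ₗ g n) t := by
  simp only [lconvolution_def, ← ENNReal.tsum_mul_left]
  exact lintegral_tsum fun n => by have := hg n; fun_prop

theorem renewal_eq (hκ : Measurable κ) : renewal κ = κ + κ ⋆ₗ renewal κ := by
  ext t
  have : (κ ⋆ₗ renewal κ) t = ∑' n, (κ ⋆ₗ convPow κ n) t :=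
    lconvolution_tsum hκ (fun n => measurable_convPow hκ n) t
  rw [Pi.add_apply, this, renewal, tsum_eq_zero_add' ENNReal.summable]
  rfl

theorem lintegral_renewal_ne_top (hκ : Measurable κ) (hq : ∫⁻ t, κ t < 1) :
    ∫⁻ t, renewal κ t ≠ ⊤ := by
  simp only [renewal]
  rw [lintegral_tsum fun n => (measurable_convPow hκ n).aemeasurable]
  simp only [lintegral_convPow hκ, pow_succ, ENNReal.tsum_mul_right, ENNReal.tsum_geometric]
  refine ENNReal.mul_ne_top (ENNReal.inv_ne_top.2 ?_) (hq.trans ENNReal.one_lt_top).ne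
  exact (tsub_pos_of_lt hq).ne'

/-- `∑ (n + 2) κ^{⋆(n+1)}`. -/
noncomputable def weightedRenewal (κ : ℝ → ℝ≥0∞) (t : ℝ) : ℝ≥0∞ :=
  ∑' n : ℕ, ((n : ℝ≥0∞) + 2) * convPow κ n t

theorem measurable_weightedRenewal (hκ : Measurable κ) : Measurable (weightedRenewal κ) :=
  Measurable.tsum fun n => (measurable_convPow hκ n).const_mul _

theorem lintegral_weightedRenewal_ne_top (hκ : Measurable κ) (hq : ∫⁻ t, κ t < 1) :
    ∫⁻ t, weightedRenewal κ t ≠ ⊤ := by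
  simp only [weightedRenewal]
  rw [lintegral_tsum fun n => ((measurable_convPow hκ n).const_mul _).aemeasurable]
  have e : ∀ n : ℕ, ∫⁻ t, ((n : ℝ≥0∞) + 2) * convPow κ n t
      = ENNReal.ofReal ((n + 2) * (∫⁻ t, κ t).toReal ^ (n + 1)) := fun n => by
    rw [lintegral_const_mul _ (measurable_convPow hκ n), lintegral_convPow hκ,
      ENNReal.ofReal_mul (by positivity), ENNReal.ofReal_pow ENNReal.toReal_nonneg,
      ENNReal.ofReal_toReal (hq.trans ENNReal.one_lt_top).ne, ENNReal.ofReal_add (by positivity)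
      (by norm_num)]
    simp
  simp only [e]
  set r := (∫⁻ t, κ t).toReal with hr
  have hr0 : 0 ≤ r := ENNReal.toReal_nonneg
  have hr1 : ‖r‖ < 1 := by
    rw [Real.norm_of_nonneg hr0, hr]
    exact (ENNReal.toReal_lt_toReal (hq.trans ENNReal.one_lt_top).ne ENNReal.one_ne_top).2 hq
  have hs : Summable fun n : ℕ => ((n : ℝ) + 2) * r ^ (n + 1) := by
    have h1 := (summable_pow_mul_geometric_of_norm_lt_one 1 hr1).mul_right r
    have h2 := ((summable_geometric_of_norm_lt_one hr1).mul_right r).mul_left 2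
    refine (h1.add h2).congr fun n => ?_
    ring
  rw [← ENNReal.ofReal_tsum_of_nonneg (fun n => by positivity) hs]
  exact ENNReal.ofReal_ne_top

/-- The Leibniz rule for the `(n+2)`-fold power: multiplication by `t` is a derivation and
convolution is commutative. Recall that `convPow κ n` has `n + 1` factors. -/
theorem mul_convPow_succ (hκ : Measurable κ) (h0 : ∀ t ≤ 0, κ t = 0) (n : ℕ) :
    (fun t => ENNReal.ofReal t * convPow κ (n + 1) t) =
      fun t => ((n : ℝ≥0∞) + 2) * ((fun s => ENNReal.ofReal s * κ s) ⋆ₗ convPow κ n) t := by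
  have hm : Measurable fun s => ENNReal.ofReal s * κ s := by fun_prop
  induction n with
  | zero =>
    ext t
    simp only [convPow]
    rw [mul_lconvolution hκ hκ h0 h0]
    rw [lconvolution_comm (f := κ)]
    simp only [Nat.cast_zero, zero_add]
    ring
  | succ n ih =>
    ext t
    rw [convPow, mul_lconvolution hκ (measurable_convPow hκ _) h0
      (fun t ht => convPow_eq_zero h0 _ ht), ih]
    have e : (κ ⋆ₗ fun t => ((n : ℝ≥0∞) + 2) *
        ((fun s => ENNReal.ofReal s * κ s) ⋆ₗ convPow κ n) t) t =
        ((n : ℝ≥0∞) + 2) * ((fun s => ENNReal.ofReal s * κ s) ⋆ₗ convPow κ (n + 1)) t := by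
      have e1 : (fun s => ENNReal.ofReal s * κ s) ⋆ₗ convPow κ (n + 1) =
          κ ⋆ₗ ((fun s => ENNReal.ofReal s * κ s) ⋆ₗ convPow κ n) := by
        rw [convPow, lconvolution_assoc hm hκ (measurable_convPow hκ n),
          lconvolution_comm (g := κ), lconvolution_assoc hκ hm (measurable_convPow hκ n)]
      have hm2 : Measurable ((fun s => ENNReal.ofReal s * κ s) ⋆ₗ convPow κ n) :=
        measurable_lconvolution _ hm (measurable_convPow hκ n)
      rw [e1, lconvolution_def, lconvolution_def, ← lintegral_const_mul _ (by fun_prop)]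
      refine lintegral_congr fun y => ?_
      ring
    rw [e]
    push_cast
    ring

/-- The density `κ` may be unbounded at `0`, so the series for `R` need not converge uniformly.
After multiplication by `t` each term contains the factor `s κ(s)`, which is bounded and continuous
in the application, convolved with an integrable function. -/
theorem mul_renewal (hκ : Measurable κ) (h0 : ∀ t ≤ 0, κ t = 0) (t : ℝ) :
    ENNReal.ofReal t * renewal κ t = ENNReal.ofReal t * κ t +
      ((fun s => ENNReal.ofReal s * κ s) ⋆ₗ weightedRenewal κ) t := by
  have hm : Measurable fun s => ENNReal.ofReal s * κ s := by fun_prop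
  have e1 : ((fun s => ENNReal.ofReal s * κ s) ⋆ₗ weightedRenewal κ) t =
      ∑' n : ℕ, ((fun s => ENNReal.ofReal s * κ s) ⋆ₗ fun t => ((n : ℝ≥0∞) + 2) * convPow κ n t) t :=
    lconvolution_tsum hm (fun n => (measurable_convPow hκ n).const_mul _) t
  rw [e1, renewal, ← ENNReal.tsum_mul_left, tsum_eq_zero_add' ENNReal.summable]
  congr 1
  refine tsum_congr fun n => ?_
  rw [congrFun (mul_convPow_succ hκ h0 n) t, lconvolution_def, lconvolution_def]
  have := measurable_convPow hκ n
  rw [← lintegral_const_mul _ (by fun_prop)]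
  refine lintegral_congr fun y => ?_
  ring

/-- If `s ↦ s κ(s)` is bounded and continuous, the renewal density is finite and continuous. -/
theorem continuousOn_renewal (hκ : Measurable κ) (h0 : ∀ t ≤ 0, κ t = 0) (hq : ∫⁻ t, κ t < 1)
    {C : ℝ≥0∞} (hC : C ≠ ⊤) (hmC : ∀ t, ENNReal.ofReal t * κ t ≤ C) {a : ℝ}
    (hmc : ContinuousOn (fun t => ENNReal.ofReal t * κ t) (Iic a)) :
    (∀ t, renewal κ t ≠ ⊤) ∧ ContinuousOn (renewal κ) (Ioc 0 a) := by
  have hm : Measurable fun s => ENNReal.ofReal s * κ s := by fun_prop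
  have hW := measurable_weightedRenewal hκ
  have hW0 : ∀ t ≤ 0, weightedRenewal κ t = 0 := fun t ht => by
    simp [weightedRenewal, convPow_eq_zero h0 _ ht]
  have hWi := lintegral_weightedRenewal_ne_top hκ hq
  have hfin : ∀ t, renewal κ t ≠ ⊤ := by
    intro t
    rcases le_or_gt t 0 with ht | ht
    · simp [renewal_eq_zero h0 ht]
    have h1 : ENNReal.ofReal t * renewal κ t ≠ ⊤ := by
      rw [mul_renewal hκ h0]
      refine ENNReal.add_ne_top.2 ⟨ne_top_of_le_ne_top hC (hmC t), ?_⟩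
      refine ne_top_of_le_ne_top (ENNReal.mul_ne_top hC hWi) ?_
      rw [lconvolution_comm, lconvolution_def, mul_comm, ← lintegral_mul_const _ hW]
      exact lintegral_mono fun y => mul_le_mul' le_rfl (hmC _)
    intro h
    rw [h, ENNReal.mul_top (by simpa using ht)] at h1
    exact h1 rfl
  refine ⟨hfin, ?_⟩
  have hc : ContinuousOn (fun t => (ENNReal.ofReal t)⁻¹ * (ENNReal.ofReal t * κ t +
      (weightedRenewal κ ⋆ₗ fun s => ENNReal.ofReal s * κ s) t)) (Ioc 0 a) := by
    have h2 := continuousOn_lconvolution hW hm hW0 hWi hC hmC hmc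
    have h3 : ContinuousOn (fun t => ENNReal.ofReal t * κ t +
      (weightedRenewal κ ⋆ₗ fun s => ENNReal.ofReal s * κ s) t) (Ioc 0 a) :=
      (hmc.add h2).mono fun t ht => ht.2
    intro t ht
    refine ENNReal.Tendsto.mul ((ENNReal.continuous_ofReal.tendsto t).inv.mono_left
      nhdsWithin_le_nhds) (Or.inr ?_) (h3 t ht) (Or.inr ?_)
    · have := mul_renewal hκ h0 t
      rw [lconvolution_comm] at this
      rw [← this]
      exact ENNReal.mul_ne_top ENNReal.ofReal_ne_top (hfin t)
    · simpa using ht.1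
  refine hc.congr fun t ht => ?_
  have ht0 : ENNReal.ofReal t ≠ 0 := by simpa using ht.1
  have := mul_renewal hκ h0 t
  rw [lconvolution_comm] at this
  simp only [← this]
  rw [← mul_assoc, ENNReal.inv_mul_cancel ht0 ENNReal.ofReal_ne_top, one_mul]

/-- If `K` is the tail of `κ`, then `K + K⋆R = 1` on the half-line. -/
theorem tail_add_lconvolution_renewal {K o : ℝ → ℝ≥0∞} (hκ : Measurable κ) (hK : Measurable K)
    (ho : Measurable o) (ho1 : ∀ t, o t ≤ 1) (hKo : K + κ ⋆ₗ o = o) (hq : ∫⁻ t, κ t < 1) :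
    K + K ⋆ₗ renewal κ = o := by
  have hR := measurable_renewal hκ
  have hκo : Measurable (κ ⋆ₗ o) := measurable_lconvolution _ hκ ho
  -- Both sides equal `o⋆R`: on the left through `K + κ⋆o = o`, on the right through `R = κ + κ⋆R`.
  -- The common term is finite, so it cancels in `ℝ≥0∞`.
  have h1 : K ⋆ₗ renewal κ + (κ ⋆ₗ o) ⋆ₗ renewal κ = κ ⋆ₗ o + (κ ⋆ₗ o) ⋆ₗ renewal κ := by
    rw [← lconvolution_add_left hK hR, hKo]
    conv_lhs => rw [renewal_eq hκ, lconvolution_add_right ho hκ, lconvolution_assoc ho hκ hR,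
      lconvolution_comm (f := o)]
  have h2 : K ⋆ₗ renewal κ = κ ⋆ₗ o := by
    ext t
    have h3 := congrFun h1 t
    simp only [Pi.add_apply] at h3
    refine (ENNReal.add_left_inj ?_).1 h3
    have hle : ∀ s, (κ ⋆ₗ o) s ≤ ∫⁻ t, κ t := fun s => by
      rw [lconvolution_def]
      exact lintegral_mono fun y => mul_le_of_le_one_right' (ho1 _)
    have : ((κ ⋆ₗ o) ⋆ₗ renewal κ) t ≤ (∫⁻ t, renewal κ t) * ∫⁻ t, κ t := by
      rw [lconvolution_comm, lconvolution_def, ← lintegral_mul_const _ hR]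
      exact lintegral_mono fun y => mul_le_mul' le_rfl (hle _)
    exact ne_top_of_le_ne_top (ENNReal.mul_ne_top (lintegral_renewal_ne_top hκ hq)
      (hq.trans ENNReal.one_lt_top).ne) this
  rw [h2, hKo]

end Renewal

/-! ### The renewal density of `-log V` and the multiplier. -/

theorem lconvolution_toReal_of_eqOn {f g : ℝ → ℝ≥0∞} {φ ψ : ℝ → ℝ} (hf : Measurable f)
    (hg : Measurable g) (hf0 : ∀ t ≤ 0, f t = 0) (hg0 : ∀ t ≤ 0, g t = 0) {a t : ℝ}
    (hφ : ∀ s ∈ Ioo 0 a, (f s).toReal = φ s) (hψ : ∀ s ∈ Ioo 0 a, (g s).toReal = ψ s)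
    (ht : t ∈ Icc 0 a) (hfin : (f ⋆ₗ g) t ≠ ⊤) :
    IntervalIntegrable (fun s => φ (t - s) * ψ s) volume 0 t ∧
      ∫ s in (0 : ℝ)..t, φ (t - s) * ψ s = ((f ⋆ₗ g) t).toReal := by
  obtain ⟨h1, h2⟩ := lconvolution_toReal hf hg hf0 hg0 ht.1 hfin
  have e : EqOn (fun s => (f (t - s)).toReal * (g s).toReal) (fun s => φ (t - s) * ψ s)
      (Ioo 0 t) := fun s hs => by
    simp only
    rw [hφ _ ⟨by linarith [hs.2], by linarith [hs.1, ht.2]⟩, hψ _ ⟨hs.1, by linarith [hs.2, ht.2]⟩]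
  refine ⟨?_, ?_⟩
  · rw [intervalIntegrable_iff_integrableOn_Ioo_of_le ht.1] at h1 ⊢
    exact h1.congr_fun e measurableSet_Ioo
  · rw [← h2, intervalIntegral.integral_of_le ht.1, intervalIntegral.integral_of_le ht.1,
      integral_Ioc_eq_integral_Ioo, integral_Ioc_eq_integral_Ioo]
    exact (setIntegral_congr_fun measurableSet_Ioo e).symm

/-- The density of `-log V`, where `V` has distribution function `v`, cut off at `a`. -/
noncomputable def logDensity (v₁ : ℝ → ℝ) (a : ℝ) : ℝ → ℝ≥0∞ :=
  (Ioc 0 a).indicator fun t => ENNReal.ofReal (v₁ (Real.exp (-t)) * Real.exp (-t))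

/-- The survival function of `-log V` on `(0,a]`, constant after `a`. -/
noncomputable def logTail (v : ℝ → ℝ) (a : ℝ) : ℝ → ℝ≥0∞ :=
  (Ioi 0).indicator fun t => ENNReal.ofReal (v (Real.exp (-(min t a))))

noncomputable def expDecay : ℝ → ℝ≥0∞ := (Ioi 0).indicator fun t => ENNReal.ofReal (Real.exp (-t))

noncomputable def unitStep : ℝ → ℝ≥0∞ := (Ioi 0).indicator 1

theorem measurable_expDecay : Measurable expDecay :=
  Measurable.indicator (by fun_prop) measurableSet_Ioi

theorem measurable_unitStep : Measurable unitStep := measurable_one.indicator measurableSet_Ioi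

theorem unitStep_zero : ∀ t ≤ 0, unitStep t = 0 :=
  fun _ ht => indicator_of_notMem (fun h => absurd h (not_lt.2 ht)) _

theorem exp_neg_mem {t : ℝ} (ht : 0 < t) : Real.exp (-t) ∈ Ioo (0 : ℝ) 1 :=
  ⟨Real.exp_pos _, by rw [← Real.exp_zero]; exact Real.exp_lt_exp.2 (by linarith)⟩

/-- The renewal density. -/
noncomputable def renewalDensity (v₁ : ℝ → ℝ) (a t : ℝ) : ℝ := (renewal (logDensity v₁ a) t).toReal

/-- The solution `E` of `E = e + κ⋆E` with `e` the exponential. The signed multiplier is the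
difference `R - E` of two nonnegative functions, so that all convolution algebra can be done in
`ℝ≥0∞`. -/
noncomputable def multiplierLoss (v₁ : ℝ → ℝ) (a : ℝ) : ℝ → ℝ≥0∞ :=
  expDecay + renewal (logDensity v₁ a) ⋆ₗ expDecay

/-- The multiplier of the participation constraints. -/
noncomputable def multiplier (v₁ : ℝ → ℝ) (a t : ℝ) : ℝ :=
  renewalDensity v₁ a t - (multiplierLoss v₁ a t).toReal

namespace IsLossWeight

variable {v v₁ v₂ : ℝ → ℝ} {a : ℝ}

theorem hasDerivAt_log (h : IsLossWeight v v₁ v₂) {t : ℝ} (ht : 0 < t) :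
    HasDerivAt (fun t => 1 - v (Real.exp (-t))) (v₁ (Real.exp (-t)) * Real.exp (-t)) t := by
  have h1 : HasDerivAt (fun t => Real.exp (-t)) (-Real.exp (-t)) t := by
    have := (Real.hasDerivAt_exp (-t)).comp t (hasDerivAt_neg t)
    convert! this using 1
    ring
  have := ((h.hasDerivAt _ (exp_neg_mem ht)).comp t h1).const_sub 1
  convert! this using 1
  ring

/-- The derivative may blow up at `0`; its sign makes it integrable, and then the fundamental
theorem of calculus applies. -/
theorem lintegral_log (h : IsLossWeight v v₁ v₂) {u : ℝ} (hu : 0 ≤ u) :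
    ∫⁻ s in Ioc 0 u, ENNReal.ofReal (v₁ (Real.exp (-s)) * Real.exp (-s)) =
      ENNReal.ofReal (1 - v (Real.exp (-u))) := by
  have hc : Continuous fun t => 1 - v (Real.exp (-t)) := by
    have := h.cont
    fun_prop
  have hnn : ∀ x ∈ Ioo 0 u, 0 ≤ v₁ (Real.exp (-x)) * Real.exp (-x) := fun x hx =>
    mul_nonneg (h.deriv_nonneg (exp_neg_mem hx.1)) (Real.exp_pos _).le
  have hi := intervalIntegral.integrableOn_deriv_of_nonneg hc.continuousOn
    (fun x hx => h.hasDerivAt_log (t := x) hx.1) hnn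
  rw [← ofReal_integral_eq_lintegral_ofReal hi]
  · rw [← intervalIntegral.integral_of_le hu, intervalIntegral.integral_eq_sub_of_hasDerivAt_of_le hu
      hc.continuousOn (fun x hx => h.hasDerivAt_log hx.1)
      ((intervalIntegrable_iff_integrableOn_Ioc_of_le hu).2 hi)]
    simp [h.map_one]
  · rw [EventuallyLE, ← restrict_Ioo_eq_restrict_Ioc, ae_restrict_iff' measurableSet_Ioo]
    exact Eventually.of_forall hnn

theorem continuousOn_log (h : IsLossWeight v v₁ v₂) :
    ContinuousOn (fun t => v₁ (Real.exp (-t)) * Real.exp (-t)) (Ioi 0) := by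
  refine ContinuousOn.mul ?_ (by fun_prop)
  exact h.continuousOn_deriv.comp (by fun_prop) fun t ht => exp_neg_mem ht

theorem measurable_logDensity (h : IsLossWeight v v₁ v₂) (a : ℝ) :
    Measurable (logDensity v₁ a) := by
  rw [logDensity]
  have hc := h.continuousOn_log.mono (show Ioc 0 a ⊆ Ioi 0 from fun _ hx => hx.1)
  have := (ENNReal.continuous_ofReal.comp_continuousOn hc).measurable_piecewise
    (continuousOn_const (c := (0 : ℝ≥0∞))) measurableSet_Ioc
  rwa [← piecewise_eq_indicator]

theorem logDensity_eq_zero (v₁ : ℝ → ℝ) (a : ℝ) {t : ℝ} (ht : t ≤ 0) : logDensity v₁ a t = 0 :=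
  indicator_of_notMem (fun h => absurd h.1 (not_lt.2 ht)) _

theorem logDensity_toReal (h : IsLossWeight v v₁ v₂) {t : ℝ} (ht : t ∈ Ioc 0 a) :
    (logDensity v₁ a t).toReal = v₁ (Real.exp (-t)) * Real.exp (-t) := by
  rw [logDensity, indicator_of_mem ht, ENNReal.toReal_ofReal]
  exact mul_nonneg (h.deriv_nonneg (exp_neg_mem ht.1)) (Real.exp_pos _).le

/-- Cutting off at `a` leaves total mass strictly below one, so the renewal series converges
geometrically. -/
theorem lintegral_logDensity (h : IsLossWeight v v₁ v₂) (ha : 0 < a) :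
    ∫⁻ t, logDensity v₁ a t < 1 := by
  rw [logDensity, lintegral_indicator measurableSet_Ioc, h.lintegral_log ha.le,
    ENNReal.ofReal_lt_one]
  linarith [h.pos (Real.exp_pos (-a)) (exp_neg_mem ha).2.le]

theorem logDensity_lconvolution_unitStep (h : IsLossWeight v v₁ v₂) (ha : 0 < a) {t : ℝ}
    (ht : 0 < t) :
    (logDensity v₁ a ⋆ₗ unitStep) t = ENNReal.ofReal (1 - v (Real.exp (-(min t a)))) := by
  rw [← h.lintegral_log (le_min ht.le ha.le), lconvolution_def,
    ← lintegral_indicator measurableSet_Ioc]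
  refine lintegral_congr_ae ?_
  filter_upwards [show ∀ᵐ y : ℝ, y ≠ t by simp [ae_iff, measure_singleton]] with y hy
  by_cases h1 : y ∈ Ioc 0 a
  · by_cases h2 : y < t
    · rw [logDensity, unitStep, indicator_of_mem h1, indicator_of_mem (show y ∈ Ioc 0 (min t a) from
        ⟨h1.1, le_min h2.le h1.2⟩), indicator_of_mem (show -y + t ∈ Ioi 0 by simpa using h2)]
      simp
    · rw [unitStep, indicator_of_notMem (show -y + t ∉ Ioi 0 by simpa using h2),
        indicator_of_notMem (s := Ioc 0 (min t a)), mul_zero]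
      exact fun h3 => h2 (lt_of_le_of_ne (h3.2.trans (min_le_left _ _)) hy)
  · rw [logDensity, indicator_of_notMem h1, indicator_of_notMem, zero_mul]
    exact fun h3 => h1 ⟨h3.1, h3.2.trans (min_le_right _ _)⟩

theorem measurable_logTail (h : IsLossWeight v v₁ v₂) (a : ℝ) : Measurable (logTail v a) := by
  have := h.cont.measurable
  exact Measurable.indicator (by fun_prop) measurableSet_Ioi

theorem logTail_toReal (h : IsLossWeight v v₁ v₂) {t : ℝ} (ht : t ∈ Ioc 0 a) :
    (logTail v a t).toReal = v (Real.exp (-t)) := by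
  rw [logTail, indicator_of_mem (show t ∈ Ioi 0 from ht.1), min_eq_left ht.2, ENNReal.toReal_ofReal]
  exact h.nonneg (Real.exp_pos _).le

/-- Tail plus distribution function is one. Beyond `a` the cut-off density contributes nothing,
which is why `logTail` is frozen there: the identity then holds on the whole line. -/
theorem logTail_add (h : IsLossWeight v v₁ v₂) (ha : 0 < a) :
    logTail v a + logDensity v₁ a ⋆ₗ unitStep = unitStep := by
  ext t
  rw [Pi.add_apply]
  rcases le_or_gt t 0 with ht | ht
  · rw [lconvolution_eq_zero (fun t ht => logDensity_eq_zero v₁ a ht) unitStep_zero ht]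
    simp [logTail, unitStep, ht]
  · rw [h.logDensity_lconvolution_unitStep ha ht, logTail, unitStep, indicator_of_mem
      (show t ∈ Ioi 0 from ht), indicator_of_mem (show t ∈ Ioi 0 from ht), ← ENNReal.ofReal_add
      (h.nonneg (Real.exp_pos _).le)]
    · simp
    · have : v (Real.exp (-min t a)) ≤ 1 :=
        h.le_one (Real.exp_le_one_iff.2 (by simp [ht.le, ha.le]))
      linarith

theorem logTail_add_renewal (h : IsLossWeight v v₁ v₂) (ha : 0 < a) :
    logTail v a + logTail v a ⋆ₗ renewal (logDensity v₁ a) = unitStep :=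
  tail_add_lconvolution_renewal (h.measurable_logDensity a) (h.measurable_logTail a)
    measurable_unitStep (fun t => indicator_le_self' (f := 1) (by simp) t)
    (h.logTail_add ha) (h.lintegral_logDensity ha)

/-- The only delicate point is `0`, where `v'(e^{-t})` may tend to infinity: there `t e^{-t} ≤ 1 -
e^{-t}`, and `exists_deriv_mul_le` bounds the product by `1 - v(e^{-t})`, which tends to `0`. -/
theorem continuousOn_mul_logDensity (h : IsLossWeight v v₁ v₂) (a : ℝ) :
    ∃ C : ℝ, (∀ t, ENNReal.ofReal t * logDensity v₁ a t ≤ ENNReal.ofReal C) ∧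
      ContinuousOn (fun t => ENNReal.ofReal t * logDensity v₁ a t) (Iic a) := by
  set m : ℝ → ℝ := fun t => if 0 < t then t * (v₁ (Real.exp (-t)) * Real.exp (-t)) else 0 with hm
  have hnn : ∀ t, 0 < t → 0 ≤ v₁ (Real.exp (-t)) * Real.exp (-t) := fun t ht =>
    mul_nonneg (h.deriv_nonneg (exp_neg_mem ht)) (Real.exp_pos _).le
  have hEq : ∀ t ≤ a, ENNReal.ofReal t * logDensity v₁ a t = ENNReal.ofReal (m t) := by
    intro t hta
    rcases le_or_gt t 0 with ht | ht
    · simp [hm, not_lt.2 ht, ENNReal.ofReal_of_nonpos ht]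
    · simp only [hm, ht, if_true]
      rw [logDensity, indicator_of_mem (show t ∈ Ioc 0 a from ⟨ht, hta⟩), ENNReal.ofReal_mul ht.le]
  have hcont : Continuous m := by
    rw [continuous_iff_continuousAt]
    intro t
    rcases lt_trichotomy t 0 with ht | ht | ht
    · refine ContinuousAt.congr (f := fun _ => (0:ℝ)) continuousAt_const ?_
      filter_upwards [Iio_mem_nhds ht] with s hs
      have : s < 0 := hs
      simp [hm, not_lt.2 this.le]
    · obtain ⟨c, hc, hcb⟩ := h.exists_deriv_mul_le
      have hm0 : m t = 0 := by simp [hm, ht]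
      rw [ContinuousAt, hm0, ht]
      have hlim : Tendsto (fun t : ℝ => 1 - v (Real.exp (-|t|))) (𝓝 0) (𝓝 0) := by
        have hcc : Continuous (fun t : ℝ => 1 - v (Real.exp (-|t|))) := by
          have := h.cont
          fun_prop
        have := hcc.tendsto 0
        simpa [h.map_one] using this
      refine squeeze_zero' (Eventually.of_forall fun s => ?_) ?_ hlim
      · simp only [hm]
        split_ifs with hs
        · exact mul_nonneg hs.le (hnn s hs)
        · exact le_rfl
      · have hev : ∀ᶠ s : ℝ in 𝓝 0, c < Real.exp (-s) := by
          have : Tendsto (fun s : ℝ => Real.exp (-s)) (𝓝 0) (𝓝 1) := by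
            have := (show Continuous fun s : ℝ => Real.exp (-s) by fun_prop).tendsto 0
            simpa using this
          exact this.eventually (lt_mem_nhds hc.2)
        filter_upwards [hev] with s hs
        simp only [hm]
        split_ifs with hs0
        · rw [abs_of_pos hs0]
          refine le_trans ?_ (hcb _ ⟨hs, (exp_neg_mem hs0).2⟩)
          have h1 : s * Real.exp (-s) ≤ 1 - Real.exp (-s) := by
            have h2 := Real.add_one_le_exp s
            have h3 : Real.exp s * Real.exp (-s) = 1 := by rw [← Real.exp_add]; simp
            nlinarith [Real.exp_pos (-s)]
          have h4 := h.deriv_nonneg (exp_neg_mem hs0)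
          nlinarith
        · have := h.le_one (Real.exp_le_one_iff.2 (neg_nonpos.2 (abs_nonneg s)))
          linarith
    · have hc : ContinuousAt (fun t => t * (v₁ (Real.exp (-t)) * Real.exp (-t))) t :=
        continuousAt_id.mul (h.continuousOn_log.continuousAt (Ioi_mem_nhds ht))
      refine hc.congr ?_
      filter_upwards [Ioi_mem_nhds ht] with s hs
      have : 0 < s := hs
      simp [hm, this]
  obtain ⟨C, hC⟩ := isCompact_Icc.exists_bound_of_continuousOn (hcont.continuousOn (s := Icc 0 a))
  refine ⟨C, fun t => ?_, ?_⟩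
  · rcases le_or_gt t 0 with ht | ht
    · simp [ENNReal.ofReal_of_nonpos ht]
    rcases le_or_gt t a with hta | hta
    · rw [hEq t hta]
      exact ENNReal.ofReal_le_ofReal ((le_abs_self _).trans (hC t ⟨ht.le, hta⟩))
    · rw [logDensity, indicator_of_notMem (fun h => absurd h.2 (not_le.2 hta)), mul_zero]
      exact zero_le
  · exact (ENNReal.continuous_ofReal.comp hcont).continuousOn.congr fun t ht => hEq t ht

theorem renewal_props (h : IsLossWeight v v₁ v₂) (ha : 0 < a) :
    (∀ t, renewal (logDensity v₁ a) t ≠ ⊤) ∧ ContinuousOn (renewal (logDensity v₁ a)) (Ioc 0 a) := by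
  obtain ⟨C, hC, hc⟩ := h.continuousOn_mul_logDensity a
  exact continuousOn_renewal (h.measurable_logDensity a) (fun t ht => logDensity_eq_zero v₁ a ht)
    (h.lintegral_logDensity ha) ENNReal.ofReal_ne_top hC hc

theorem renewalDensity_nonneg (v₁ : ℝ → ℝ) (a t : ℝ) : 0 ≤ renewalDensity v₁ a t :=
  ENNReal.toReal_nonneg

theorem renewal_zero (v₁ : ℝ → ℝ) (a : ℝ) : ∀ t ≤ 0, renewal (logDensity v₁ a) t = 0 :=
  fun _ ht => renewal_eq_zero (fun _ ht => logDensity_eq_zero v₁ a ht) ht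

theorem integrable_renewalDensity (h : IsLossWeight v v₁ v₂) (ha : 0 < a) :
    Integrable (renewalDensity v₁ a) :=
  integrable_toReal_of_lintegral_ne_top (measurable_renewal (h.measurable_logDensity a)).aemeasurable
    (lintegral_renewal_ne_top (h.measurable_logDensity a) (h.lintegral_logDensity ha))

theorem measurable_renewalDensity (h : IsLossWeight v v₁ v₂) (a : ℝ) :
    Measurable (renewalDensity v₁ a) :=
  (measurable_renewal (h.measurable_logDensity a)).ennreal_toReal

theorem continuousOn_renewalDensity (h : IsLossWeight v v₁ v₂) (ha : 0 < a) :
    ContinuousOn (renewalDensity v₁ a) (Ioc 0 a) := fun t ht =>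
  (ENNReal.tendsto_toReal ((h.renewal_props ha).1 t)).comp ((h.renewal_props ha).2 t ht)

theorem le_renewalDensity (h : IsLossWeight v v₁ v₂) (ha : 0 < a) {t : ℝ} (ht : t ∈ Ioc 0 a) :
    v₁ (Real.exp (-t)) * Real.exp (-t) ≤ renewalDensity v₁ a t := by
  rw [← h.logDensity_toReal ht]
  refine ENNReal.toReal_mono ((h.renewal_props ha).1 t) ?_
  rw [congrFun (renewal_eq (h.measurable_logDensity a)) t]
  exact le_self_add

theorem unitStep_ne_top (t : ℝ) : unitStep t ≠ ⊤ := by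
  rw [unitStep]
  by_cases ht : t ∈ Ioi 0 <;> simp [ht]

theorem logTail_zero (v : ℝ → ℝ) (a : ℝ) : ∀ t ≤ 0, logTail v a t = 0 :=
  fun _ ht => indicator_of_notMem (fun h => absurd h (not_lt.2 ht)) _

theorem expDecay_zero : ∀ t ≤ 0, expDecay t = 0 :=
  fun _ ht => indicator_of_notMem (fun h => absurd h (not_lt.2 ht)) _

/-- The renewal identity. -/
theorem flow_identity (h : IsLossWeight v v₁ v₂) (ha : 0 < a) {t : ℝ} (ht : t ∈ Icc 0 a) :
    IntervalIntegrable (fun s => v (Real.exp (-(t - s))) * renewalDensity v₁ a s) volume 0 t ∧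
      v (Real.exp (-t)) + ∫ s in (0 : ℝ)..t, v (Real.exp (-(t - s))) * renewalDensity v₁ a s = 1 := by
  have key := congrFun (h.logTail_add_renewal ha) t
  rw [Pi.add_apply] at key
  have hfin : (logTail v a ⋆ₗ renewal (logDensity v₁ a)) t ≠ ⊤ := by
    refine ne_top_of_le_ne_top (unitStep_ne_top t) ?_
    rw [← key]; exact le_add_self
  obtain ⟨h1, h2⟩ := lconvolution_toReal_of_eqOn (h.measurable_logTail a)
    (measurable_renewal (h.measurable_logDensity a)) (logTail_zero v a) (renewal_zero v₁ a)
    (φ := fun s => v (Real.exp (-s))) (ψ := renewalDensity v₁ a)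
    (fun s hs => h.logTail_toReal ⟨hs.1, hs.2.le⟩) (fun s hs => rfl) ht hfin
  refine ⟨h1, ?_⟩
  rcases eq_or_lt_of_le ht.1 with ht0 | ht0
  · rw [← ht0]; simp [h.map_one]
  · rw [h2, ← h.logTail_toReal ⟨ht0, ht.2⟩, ← ENNReal.toReal_add _ hfin, key, unitStep,
      indicator_of_mem (show t ∈ Ioi 0 from ht0)]
    · simp
    · refine ne_top_of_le_ne_top (unitStep_ne_top t) ?_
      rw [← key]; exact le_self_add

theorem measurable_multiplierLoss (h : IsLossWeight v v₁ v₂) (a : ℝ) :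
    Measurable (multiplierLoss v₁ a) :=
  measurable_expDecay.add (measurable_lconvolution _
    (measurable_renewal (h.measurable_logDensity a)) measurable_expDecay)

theorem multiplierLoss_zero (v₁ : ℝ → ℝ) (a : ℝ) : ∀ t ≤ 0, multiplierLoss v₁ a t = 0 := by
  intro t ht
  rw [multiplierLoss, Pi.add_apply, expDecay_zero t ht,
    lconvolution_eq_zero (renewal_zero v₁ a) expDecay_zero ht, add_zero]

theorem expDecay_le_one (t : ℝ) : expDecay t ≤ 1 := by
  rcases le_or_gt t 0 with ht | ht
  · rw [expDecay_zero t ht]; exact zero_le_one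
  · rw [expDecay, indicator_of_mem (show t ∈ Ioi 0 from ht), ENNReal.ofReal_le_one]
    exact (exp_neg_mem ht).2.le

theorem expDecay_toReal {t : ℝ} (ht : 0 < t) : (expDecay t).toReal = Real.exp (-t) := by
  rw [expDecay, indicator_of_mem (show t ∈ Ioi 0 from ht), ENNReal.toReal_ofReal (Real.exp_pos _).le]

theorem renewal_lconvolution_ne_top (h : IsLossWeight v v₁ v₂) (ha : 0 < a) (t : ℝ) :
    (renewal (logDensity v₁ a) ⋆ₗ expDecay) t ≠ ⊤ := by
  refine ne_top_of_le_ne_top (lintegral_renewal_ne_top (h.measurable_logDensity a)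
    (h.lintegral_logDensity ha)) ?_
  rw [lconvolution_def]
  exact lintegral_mono fun y => mul_le_of_le_one_right' (expDecay_le_one _)

theorem multiplierLoss_ne_top (h : IsLossWeight v v₁ v₂) (ha : 0 < a) (t : ℝ) :
    multiplierLoss v₁ a t ≠ ⊤ :=
  ENNReal.add_ne_top.2 ⟨ne_top_of_le_ne_top ENNReal.one_ne_top (expDecay_le_one t),
    h.renewal_lconvolution_ne_top ha t⟩

theorem multiplierLoss_eq (h : IsLossWeight v v₁ v₂) (a : ℝ) :
    multiplierLoss v₁ a = expDecay + logDensity v₁ a ⋆ₗ multiplierLoss v₁ a := by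
  have hκ := h.measurable_logDensity a
  have hR := measurable_renewal hκ
  rw [multiplierLoss, lconvolution_add_right hκ measurable_expDecay,
    lconvolution_assoc hκ hR measurable_expDecay, ← lconvolution_add_left hκ measurable_expDecay,
    ← renewal_eq hκ]

theorem multiplierLoss_toReal (h : IsLossWeight v v₁ v₂) (ha : 0 < a) {t : ℝ} (ht : t ∈ Ioc 0 a) :
    (multiplierLoss v₁ a t).toReal = Real.exp (-t) +
      Real.exp (-t) * ∫ s in (0 : ℝ)..t, Real.exp s * renewalDensity v₁ a s := by
  rw [multiplierLoss, Pi.add_apply, ENNReal.toReal_add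
    (ne_top_of_le_ne_top ENNReal.one_ne_top (expDecay_le_one t)) (h.renewal_lconvolution_ne_top ha t),
    expDecay_toReal ht.1]
  have hfin := h.renewal_lconvolution_ne_top ha t
  rw [lconvolution_comm] at hfin
  obtain ⟨h1, h2⟩ := lconvolution_toReal_of_eqOn measurable_expDecay
    (measurable_renewal (h.measurable_logDensity a)) expDecay_zero (renewal_zero v₁ a)
    (φ := fun s => Real.exp (-s)) (ψ := renewalDensity v₁ a)
    (fun s hs => expDecay_toReal hs.1) (fun s hs => rfl) ⟨ht.1.le, ht.2⟩ hfin
  rw [lconvolution_comm, ← h2, ← intervalIntegral.integral_const_mul]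
  congr 1
  refine intervalIntegral.integral_congr fun s _ => ?_
  rw [← mul_assoc, ← Real.exp_add]
  ring_nf

theorem continuousOn_multiplierLoss (h : IsLossWeight v v₁ v₂) (ha : 0 < a) :
    ContinuousOn (fun t => (multiplierLoss v₁ a t).toReal) (Ioc 0 a) := by
  have hi : ∀ x y : ℝ, IntervalIntegrable (fun s => Real.exp s * renewalDensity v₁ a s) volume x y :=
    fun x y => ((h.integrable_renewalDensity ha).intervalIntegrable).continuousOn_mul
      Real.continuous_exp.continuousOn
  have hc : Continuous fun t => Real.exp (-t) +
      Real.exp (-t) * ∫ s in (0 : ℝ)..t, Real.exp s * renewalDensity v₁ a s := by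
    have := intervalIntegral.continuous_primitive hi 0
    fun_prop
  exact hc.continuousOn.congr fun t ht => h.multiplierLoss_toReal ha ht

theorem continuousOn_multiplier (h : IsLossWeight v v₁ v₂) (ha : 0 < a) :
    ContinuousOn (multiplier v₁ a) (Ioc 0 a) :=
  (h.continuousOn_renewalDensity ha).sub (h.continuousOn_multiplierLoss ha)

theorem integrableOn_multiplierLoss (h : IsLossWeight v v₁ v₂) (ha : 0 < a) (b : ℝ) :
    IntegrableOn (fun t => (multiplierLoss v₁ a t).toReal) (Icc 0 b) := by
  set C := (1 + ∫⁻ t, renewal (logDensity v₁ a) t) with hC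
  have hCt : C ≠ ⊤ := ENNReal.add_ne_top.2 ⟨ENNReal.one_ne_top, lintegral_renewal_ne_top
    (h.measurable_logDensity a) (h.lintegral_logDensity ha)⟩
  have hle : ∀ t, multiplierLoss v₁ a t ≤ C := fun t => by
    refine add_le_add (expDecay_le_one t) ?_
    rw [lconvolution_def]
    exact lintegral_mono fun y => mul_le_of_le_one_right' (expDecay_le_one _)
  refine Measure.integrableOn_of_bounded (M := C.toReal) (by simp)
    (h.measurable_multiplierLoss a).ennreal_toReal.aestronglyMeasurable
    (Eventually.of_forall fun t => ?_)
  rw [Real.norm_of_nonneg ENNReal.toReal_nonneg]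
  exact ENNReal.toReal_mono hCt (hle t)

theorem integrableOn_multiplier (h : IsLossWeight v v₁ v₂) (ha : 0 < a) (b : ℝ) :
    IntegrableOn (multiplier v₁ a) (Icc 0 b) :=
  (h.integrable_renewalDensity ha).integrableOn.sub (h.integrableOn_multiplierLoss ha b)

/-- Convolve with `K` and use `K + K⋆R = 1` twice: `K⋆R = 1 - K` and `K⋆(e + R⋆e) = 1⋆e = 1 -
e^{-t}`; subtract. -/
theorem multiplier_identity (h : IsLossWeight v v₁ v₂) (ha : 0 < a) {t : ℝ} (ht : t ∈ Icc 0 a) :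
    IntervalIntegrable (fun s => v (Real.exp (-(t - s))) * multiplier v₁ a s) volume 0 t ∧
      ∫ s in (0 : ℝ)..t, v (Real.exp (-(t - s))) * multiplier v₁ a s =
        Real.exp (-t) - v (Real.exp (-t)) := by
  have hK := h.measurable_logTail a
  have hR := measurable_renewal (h.measurable_logDensity a)
  have key : logTail v a ⋆ₗ multiplierLoss v₁ a = unitStep ⋆ₗ expDecay := by
    rw [multiplierLoss, lconvolution_add_right hK measurable_expDecay,
      lconvolution_assoc hK hR measurable_expDecay, ← lconvolution_add_left hK measurable_expDecay,
      h.logTail_add_renewal ha]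
  have hval : (unitStep ⋆ₗ expDecay) t = ENNReal.ofReal (1 - Real.exp (-t)) := by
    have e : (unitStep ⋆ₗ expDecay) t = ∫⁻ s in Ioc 0 t, ENNReal.ofReal (Real.exp (-s)) := by
      rw [lconvolution_comm, lconvolution_def, ← lintegral_indicator measurableSet_Ioc]
      refine lintegral_congr_ae ?_
      filter_upwards [show ∀ᵐ y : ℝ, y ≠ t by simp [ae_iff, measure_singleton]] with y hy
      by_cases h1 : 0 < y
      · by_cases h2 : y < t
        · rw [expDecay, unitStep, indicator_of_mem (show y ∈ Ioi 0 from h1), indicator_of_mem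
            (show y ∈ Ioc 0 t from ⟨h1, h2.le⟩), indicator_of_mem
            (show -y + t ∈ Ioi 0 by simpa using h2)]
          simp
        · rw [unitStep, indicator_of_notMem (show -y + t ∉ Ioi 0 by simpa using h2),
            indicator_of_notMem (s := Ioc 0 t), mul_zero]
          exact fun h3 => h2 (lt_of_le_of_ne h3.2 hy)
      · rw [expDecay_zero y (not_lt.1 h1), indicator_of_notMem (fun h3 => h1 h3.1), zero_mul]
    rw [e, ← ofReal_integral_eq_lintegral_ofReal]
    · rw [← intervalIntegral.integral_of_le ht.1]
      simp
    · exact (Continuous.integrableOn_Ioc (by fun_prop))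
    · exact Eventually.of_forall fun s => (Real.exp_pos _).le
  have hfin : (logTail v a ⋆ₗ multiplierLoss v₁ a) t ≠ ⊤ := by
    rw [key, hval]; exact ENNReal.ofReal_ne_top
  obtain ⟨h1, h2⟩ := lconvolution_toReal_of_eqOn hK
    (h.measurable_multiplierLoss a) (logTail_zero v a) (multiplierLoss_zero v₁ a)
    (φ := fun s => v (Real.exp (-s))) (ψ := fun s => (multiplierLoss v₁ a s).toReal)
    (fun s hs => h.logTail_toReal ⟨hs.1, hs.2.le⟩) (fun s hs => rfl) ht hfin
  obtain ⟨h3, h4⟩ := h.flow_identity ha ht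
  have e : (fun s => v (Real.exp (-(t - s))) * multiplier v₁ a s) = fun s =>
      v (Real.exp (-(t - s))) * renewalDensity v₁ a s -
        v (Real.exp (-(t - s))) * (multiplierLoss v₁ a s).toReal := by
    ext s; rw [multiplier]; ring
  rw [e]
  refine ⟨h3.sub h1, ?_⟩
  rw [intervalIntegral.integral_sub h3 h1]
  rw [h2, key, hval, ENNReal.toReal_ofReal]
  · linarith
  · linarith [Real.exp_le_one_iff.2 (neg_nonpos.2 ht.1)]

/-- From `κ + κ⋆R = R` and `κ⋆E = E - e`. At a zero of the multiplier it says that the derivative of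
the dual bound equals one, the smooth-fit condition used in `lt_dualBound`. -/
theorem multiplier_renewal_identity (h : IsLossWeight v v₁ v₂) (ha : 0 < a) {t : ℝ}
    (ht : t ∈ Ioc 0 a) :
    IntervalIntegrable (fun s => v₁ (Real.exp (-(t - s))) * Real.exp (-(t - s)) *
      multiplier v₁ a s) volume 0 t ∧
    v₁ (Real.exp (-t)) * Real.exp (-t) +
      ∫ s in (0 : ℝ)..t, v₁ (Real.exp (-(t - s))) * Real.exp (-(t - s)) * multiplier v₁ a s =
        multiplier v₁ a t + Real.exp (-t) := by
  have hκ := h.measurable_logDensity a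
  have hR := measurable_renewal hκ
  have hRt := (h.renewal_props ha).1 t
  have hEt := h.multiplierLoss_ne_top ha t
  have k1 := congrFun (renewal_eq hκ) t
  have k2 := congrFun (h.multiplierLoss_eq a) t
  rw [Pi.add_apply] at k1 k2
  have f1 : logDensity v₁ a t ≠ ⊤ ∧ (logDensity v₁ a ⋆ₗ renewal (logDensity v₁ a)) t ≠ ⊤ := by
    rw [k1] at hRt
    exact ENNReal.add_ne_top.1 hRt
  have f2 : expDecay t ≠ ⊤ ∧ (logDensity v₁ a ⋆ₗ multiplierLoss v₁ a) t ≠ ⊤ := by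
    rw [k2] at hEt
    exact ENNReal.add_ne_top.1 hEt
  have ht' : t ∈ Icc 0 a := ⟨ht.1.le, ht.2⟩
  obtain ⟨h1, h2⟩ := lconvolution_toReal_of_eqOn hκ hR (fun t ht => logDensity_eq_zero v₁ a ht)
    (renewal_zero v₁ a) (φ := fun s => v₁ (Real.exp (-s)) * Real.exp (-s))
    (ψ := renewalDensity v₁ a) (fun s hs => h.logDensity_toReal ⟨hs.1, hs.2.le⟩)
    (fun s hs => rfl) ht' f1.2
  obtain ⟨h3, h4⟩ := lconvolution_toReal_of_eqOn hκ (h.measurable_multiplierLoss a)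
    (fun t ht => logDensity_eq_zero v₁ a ht)
    (multiplierLoss_zero v₁ a) (φ := fun s => v₁ (Real.exp (-s)) * Real.exp (-s))
    (ψ := fun s => (multiplierLoss v₁ a s).toReal) (fun s hs => h.logDensity_toReal ⟨hs.1, hs.2.le⟩)
    (fun s hs => rfl) ht' f2.2
  have e : (fun s => v₁ (Real.exp (-(t - s))) * Real.exp (-(t - s)) * multiplier v₁ a s) = fun s =>
      v₁ (Real.exp (-(t - s))) * Real.exp (-(t - s)) * renewalDensity v₁ a s -
        v₁ (Real.exp (-(t - s))) * Real.exp (-(t - s)) * (multiplierLoss v₁ a s).toReal := by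
    ext s; rw [multiplier]; ring
  rw [e]
  refine ⟨h1.sub h3, ?_⟩
  rw [intervalIntegral.integral_sub h1 h3]
  have k1' := congrArg ENNReal.toReal k1
  have k2' := congrArg ENNReal.toReal k2
  rw [ENNReal.toReal_add f1.1 f1.2, h.logDensity_toReal ht] at k1'
  rw [ENNReal.toReal_add f2.1 f2.2, expDecay_toReal ht.1] at k2'
  rw [h2, h4, multiplier, renewalDensity]
  linarith

/-- Near `0`, `R ≥ κ ≥ d e^{-t}` with `d > 1`, whereas `E` exceeds `e^{-t}` only by an integral of
an integrable function over `[0,t]`. -/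
theorem multiplier_pos_near_zero (h : IsLossWeight v v₁ v₂) (ha : 0 < a) :
    ∃ δ > 0, ∀ t ∈ Ioo 0 δ, t ≤ a → 0 < multiplier v₁ a t := by
  obtain ⟨d, hd, c, hc, hdc⟩ := h.exists_one_lt_deriv
  have hi : ∀ x y : ℝ, IntervalIntegrable (fun s => Real.exp s * renewalDensity v₁ a s) volume x y :=
    fun x y => ((h.integrable_renewalDensity ha).intervalIntegrable).continuousOn_mul
      Real.continuous_exp.continuousOn
  have hcont : Continuous fun t => (d - 1) * Real.exp (-t) -
      Real.exp (-t) * ∫ s in (0 : ℝ)..t, Real.exp s * renewalDensity v₁ a s := by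
    have := intervalIntegral.continuous_primitive hi 0
    fun_prop
  have h0 := hcont.tendsto 0
  simp only [neg_zero, Real.exp_zero, intervalIntegral.integral_same, mul_one, mul_zero,
    sub_zero] at h0
  have hev := h0.eventually (lt_mem_nhds (show (0 : ℝ) < d - 1 by linarith))
  have hev2 : ∀ᶠ s : ℝ in 𝓝 0, c < Real.exp (-s) := by
    have : Tendsto (fun s : ℝ => Real.exp (-s)) (𝓝 0) (𝓝 1) := by
      have := (show Continuous fun s : ℝ => Real.exp (-s) by fun_prop).tendsto 0
      simpa using this
    exact this.eventually (lt_mem_nhds hc.2)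
  obtain ⟨δ, hδ, hball⟩ := Metric.eventually_nhds_iff.1 (hev.and hev2)
  refine ⟨δ, hδ, fun t ht hta => ?_⟩
  obtain ⟨e1, e2⟩ := hball (y := t) (by rw [Real.dist_eq, sub_zero, abs_of_pos ht.1]; exact ht.2)
  have e3 := h.le_renewalDensity ha ⟨ht.1, hta⟩
  have e4 := hdc _ ⟨e2, (exp_neg_mem ht.1).2⟩
  rw [multiplier, h.multiplierLoss_toReal ha ⟨ht.1, hta⟩]
  have := mul_le_mul_of_nonneg_right e4 (Real.exp_pos (-t)).le
  linarith

end IsLossWeight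

/-! ### The stopping level and uniqueness for the Volterra equations. -/

/-- `t₀` is the first positive time at which the multiplier vanishes. -/
structure IsStoppingLevel (v₁ : ℝ → ℝ) (a t₀ : ℝ) : Prop where
  mem : t₀ ∈ Ioc 0 a
  pos : ∀ t ∈ Ioo 0 t₀, 0 < multiplier v₁ a t
  zero : multiplier v₁ a t₀ = 0

namespace IsLossWeight

variable {v v₁ v₂ : ℝ → ℝ} {a : ℝ}

/-- Since `1 = K + K⋆R`, the primitive `1⋆φ` equals `K⋆φ + R⋆(K⋆φ)`, and both terms vanish. -/
theorem integral_eq_zero_of_volterra (h : IsLossWeight v v₁ v₂) (ha : 0 < a) {t : ℝ}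
    (ht : t ∈ Icc 0 a) {φ : ℝ → ℝ} (hφ : IntegrableOn φ (Icc 0 t))
    (h0 : ∀ u ∈ Icc 0 t, ∫ s in (0 : ℝ)..u, v (Real.exp (-(u - s))) * φ s = 0) :
    ∫ s in (0 : ℝ)..t, φ s = 0 := by
  set r := renewalDensity v₁ a with hr
  have hφ' : IntegrableOn φ (Ioc 0 t) := hφ.mono_set Ioc_subset_Icc_self
  have hv := h.cont
  have hvm := h.cont.measurable
  -- The kernel of the double convolution, cut off to the triangle `s + u ≤ t`; it is bounded by
  -- one, so Fubini applies on the square.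
  set B : ℝ × ℝ → ℝ := fun x => if x.1 + x.2 ≤ t then v (Real.exp (-(t - x.1 - x.2))) else 0 with hB
  have hBm : Measurable B :=
    Measurable.ite (measurableSet_le (by fun_prop) (by fun_prop)) (by fun_prop) measurable_const
  have hB1 : ∀ x, ‖B x‖ ≤ 1 := fun x => by
    simp only [hB]
    split_ifs with hx
    · rw [Real.norm_of_nonneg (h.nonneg (Real.exp_pos _).le)]
      exact h.le_one (Real.exp_le_one_iff.2 (by linarith))
    · simp
  have hprod : Integrable (fun x : ℝ × ℝ => B x * (φ x.1 * r x.2))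
      ((volume.restrict (Ioc 0 t)).prod (volume.restrict (Ioc 0 t))) :=
    (hφ'.mul_prod (h.integrable_renewalDensity ha).integrableOn).bdd_mul (c := 1)
      hBm.aestronglyMeasurable (Eventually.of_forall hB1)
  have hinner : ∀ s ∈ Ioc 0 t, v (Real.exp (-(t - s))) * φ s + ∫ u in Ioc 0 t, B (s, u) * (φ s * r u)
      = φ s := by
    intro s hs
    have hf := (h.flow_identity ha (t := t - s) ⟨by linarith [hs.2], by linarith [hs.1, ht.2]⟩).2
    have e : ∫ u in Ioc 0 t, B (s, u) * (φ s * r u) =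
        φ s * ∫ u in (0 : ℝ)..(t - s), v (Real.exp (-(t - s - u))) * r u := by
      rw [intervalIntegral.integral_of_le (by linarith [hs.2]), ← integral_const_mul,
        ← integral_indicator measurableSet_Ioc, ← integral_indicator measurableSet_Ioc]
      congr 1
      ext u
      by_cases hu : u ∈ Ioc 0 (t - s)
      · rw [indicator_of_mem hu, indicator_of_mem (show u ∈ Ioc 0 t from
          ⟨hu.1, by linarith [hu.2, hs.1]⟩)]
        simp only [hB]
        rw [if_pos (by linarith [hu.2])]
        ring
      · rw [indicator_of_notMem hu]
        by_cases hu2 : u ∈ Ioc 0 t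
        · rw [indicator_of_mem hu2]
          simp only [hB]
          rw [if_neg, zero_mul]
          exact fun h3 => hu ⟨hu2.1, by linarith⟩
        · rw [indicator_of_notMem hu2]
    rw [e, mul_comm (v _), ← mul_add, hf, mul_one]
  have hi1 : IntegrableOn (fun s => v (Real.exp (-(t - s))) * φ s) (Ioc 0 t) := by
    refine hφ'.bdd_mul (c := 1) (by fun_prop) ?_
    rw [ae_restrict_iff' measurableSet_Ioc]
    refine Eventually.of_forall fun s hs => ?_
    rw [Real.norm_of_nonneg (h.nonneg (Real.exp_pos _).le)]
    exact h.le_one (Real.exp_le_one_iff.2 (by linarith [hs.2]))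
  have hi2 : IntegrableOn (fun s => ∫ u in Ioc 0 t, B (s, u) * (φ s * r u)) (Ioc 0 t) :=
    hprod.integral_prod_left
  rw [intervalIntegral.integral_of_le ht.1, ← setIntegral_congr_fun measurableSet_Ioc hinner,
    integral_add hi1 hi2, ← intervalIntegral.integral_of_le ht.1, h0 t ⟨ht.1, le_rfl⟩, zero_add,
    integral_integral_swap hprod]
  refine setIntegral_eq_zero_of_forall_eq_zero fun u hu => ?_
  have e : ∫ s in Ioc 0 t, B (s, u) * (φ s * r u) =
      (∫ s in (0 : ℝ)..(t - u), v (Real.exp (-(t - u - s))) * φ s) * r u := by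
    rw [intervalIntegral.integral_of_le (by linarith [hu.2]), ← integral_mul_const,
      ← integral_indicator measurableSet_Ioc, ← integral_indicator measurableSet_Ioc]
    congr 1
    ext s
    by_cases hs : s ∈ Ioc 0 (t - u)
    · rw [indicator_of_mem hs, indicator_of_mem (show s ∈ Ioc 0 t from
        ⟨hs.1, by linarith [hs.2, hu.1]⟩)]
      simp only [hB]
      rw [if_pos (by linarith [hs.2]), show t - s - u = t - u - s by ring]
      ring
    · rw [indicator_of_notMem hs]
      by_cases hs2 : s ∈ Ioc 0 t
      · rw [indicator_of_mem hs2]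
        simp only [hB]
        rw [if_neg, zero_mul]
        exact fun h3 => hs ⟨hs2.1, by linarith⟩
      · rw [indicator_of_notMem hs2]
  rw [e, h0 (t - u) ⟨by linarith [hu.2], by linarith [hu.1]⟩, zero_mul]

/-- Uniqueness for the Volterra equation of the first kind with kernel `v(e^{-(t-s)})`. -/
theorem ae_eq_zero_of_volterra (h : IsLossWeight v v₁ v₂) (ha : 0 < a) {b : ℝ}
    (hb : b ∈ Icc 0 a) {φ : ℝ → ℝ} (hφ : IntegrableOn φ (Icc 0 b))
    (h0 : ∀ u ∈ Icc 0 b, ∫ s in (0 : ℝ)..u, v (Real.exp (-(u - s))) * φ s = 0) :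
    φ =ᵐ[volume.restrict (Icc 0 b)] 0 := by
  have hz : ∀ t ∈ Icc 0 b, ∫ s in (0 : ℝ)..t, φ s = 0 := fun t ht =>
    h.integral_eq_zero_of_volterra ha ⟨ht.1, ht.2.trans hb.2⟩
      (hφ.mono_set (Icc_subset_Icc_right ht.2)) fun u hu => h0 u ⟨hu.1, hu.2.trans ht.2⟩
  have hi : IntervalIntegrable φ volume 0 b :=
    (intervalIntegrable_iff_integrableOn_Icc_of_le hb.1).2 hφ
  rw [← restrict_Ioo_eq_restrict_Icc, EventuallyEq, ae_restrict_iff' measurableSet_Ioo]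
  filter_upwards [hi.ae_hasDerivAt_integral] with x hx hxb
  have hx' := hx (by rw [uIcc_of_le hb.1]; exact ⟨hxb.1.le, hxb.2.le⟩) 0
    (by rw [uIcc_of_le hb.1]; exact ⟨le_rfl, hb.1⟩)
  have h2 : HasDerivAt (fun x => ∫ t in (0 : ℝ)..x, φ t) 0 x := by
    refine (hasDerivAt_const x (0 : ℝ)).congr_of_eventuallyEq ?_
    filter_upwards [Ioo_mem_nhds hxb.1 hxb.2] with y hy
    exact hz y ⟨hy.1.le, hy.2.le⟩
  exact hx'.unique h2

/-- If the multiplier were positive on all of `(0, -log p]`, the multiplier equation at the right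
endpoint would have a positive integral, but there it equals `p - v(p) = 0`. Positivity near `0`
keeps the nonpositivity set away from `0`, hence compact. -/
theorem exists_stoppingLevel (h : IsLossWeight v v₁ v₂) {p : ℝ} (hp : p ∈ Ioo (0 : ℝ) 1)
    (hvp : v p = p) :
    ∃ t₀, IsLeast {t : ℝ | t ∈ Ioc 0 (-Real.log p) ∧ multiplier v₁ (-Real.log p) t ≤ 0} t₀ ∧
      IsStoppingLevel v₁ (-Real.log p) t₀ := by
  have ha : 0 < -Real.log p := by linarith [Real.log_neg hp.1 hp.2]
  set a := -Real.log p with hadef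
  have hep : Real.exp (-a) = p := by rw [hadef, neg_neg, Real.exp_log hp.1]
  obtain ⟨δ, hδ, hpos⟩ := h.multiplier_pos_near_zero ha
  have hc := h.continuousOn_multiplier ha
  have hne : ∃ t ∈ Ioc 0 a, multiplier v₁ a t ≤ 0 := by
    by_contra! hcon
    obtain ⟨h1, h2⟩ := h.multiplier_identity ha (t := a) ⟨ha.le, le_rfl⟩
    rw [hep, hvp, sub_self] at h2
    have := intervalIntegral.intervalIntegral_pos_of_pos_on h1 (fun s hs => mul_pos
      (h.pos (Real.exp_pos _) (Real.exp_le_one_iff.2 (by linarith [hs.2]))) (hcon s ⟨hs.1, hs.2.le⟩)) ha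
    linarith
  set ε := min (δ / 2) a with hε
  have hε0 : 0 < ε := lt_min (by linarith) ha
  set S : Set ℝ := {t : ℝ | t ∈ Ioc 0 a ∧ multiplier v₁ a t ≤ 0} with hS
  have hlow : ∀ t ∈ S, ε ≤ t := by
    intro t ht
    by_contra! hlt
    have hlt2 : t < δ := by
      have : ε ≤ δ / 2 := min_le_left _ _
      linarith
    exact absurd (hpos t ⟨ht.1.1, hlt2⟩ ht.1.2) (not_lt.2 ht.2)
  have hSeq : S = Icc ε a ∩ multiplier v₁ a ⁻¹' Iic 0 := by
    ext t
    constructor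
    · intro ht
      exact ⟨⟨hlow t ht, ht.1.2⟩, ht.2⟩
    · rintro ⟨ht, ht2⟩
      exact ⟨⟨hε0.trans_le ht.1, ht.2⟩, ht2⟩
  have hclosed : IsClosed S := by
    rw [hSeq]
    exact (hc.mono fun t ht => ⟨hε0.trans_le ht.1, ht.2⟩).preimage_isClosed_of_isClosed isClosed_Icc
      isClosed_Iic
  have hcomp : IsCompact S := isCompact_Icc.of_isClosed_subset hclosed
    (by rw [hSeq]; exact inter_subset_left)
  obtain ⟨t, ht⟩ := hne
  obtain ⟨t₀, ht₀⟩ := hcomp.exists_isLeast ⟨t, ht⟩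
  have hpos' : ∀ t ∈ Ioo 0 t₀, 0 < multiplier v₁ a t := by
    intro t ht
    by_contra! hle
    exact absurd (ht₀.2 (show t ∈ S from ⟨⟨ht.1, ht.2.le.trans ht₀.1.1.2⟩, hle⟩)) (not_le.2 ht.2)
  refine ⟨t₀, ht₀, ht₀.1.1, hpos', le_antisymm ht₀.1.2 ?_⟩
  have hct : ContinuousWithinAt (multiplier v₁ a) (Ioo 0 t₀) t₀ :=
    (hc t₀ ht₀.1.1).mono fun t ht => ⟨ht.1, ht.2.le.trans ht₀.1.1.2⟩
  have hne2 : (𝓝[Ioo 0 t₀] t₀).NeBot := by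
    rw [← mem_closure_iff_nhdsWithin_neBot, closure_Ioo ht₀.1.1.1.ne]
    exact ⟨ht₀.1.1.1.le, le_rfl⟩
  refine ge_of_tendsto hct.tendsto ?_
  filter_upwards [self_mem_nhdsWithin] with s hs
  exact (hpos' s hs).le

end IsLossWeight

/-! ### Duality for the relaxed problem. -/

/-- The dual bound for the contribution of the payment level with tail probability `z`. -/
noncomputable def dualBound (v v₁ : ℝ → ℝ) (a t₀ z : ℝ) : ℝ≥0∞ :=
  ENNReal.ofReal (v z) + ∫⁻ t in Ioo 0 t₀,
    (if z ≤ Real.exp (-t) then ENNReal.ofReal (v (z * Real.exp t)) else 0) *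
      ENNReal.ofReal (multiplier v₁ a t)

namespace IsStoppingLevel

variable {v v₁ v₂ : ℝ → ℝ} {a t₀ : ℝ}

theorem lintegral_eq (hs : IsStoppingLevel v₁ a t₀) (h : IsLossWeight v v₁ v₂) {s : ℝ}
    (hst : s ∈ Icc 0 t₀) :
    ∫⁻ t in Ioo 0 s, ENNReal.ofReal (v (Real.exp (-(s - t)))) * ENNReal.ofReal (multiplier v₁ a t) =
      ENNReal.ofReal (Real.exp (-s) - v (Real.exp (-s))) := by
  have ha : 0 < a := hs.mem.1.trans_le hs.mem.2
  obtain ⟨h1, h2⟩ := h.multiplier_identity ha ⟨hst.1, hst.2.trans hs.mem.2⟩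
  rw [← h2, intervalIntegral.integral_of_le hst.1, integral_Ioc_eq_integral_Ioo,
    ofReal_integral_eq_lintegral_ofReal]
  · refine lintegral_congr fun t => ?_
    rw [ENNReal.ofReal_mul (h.nonneg (Real.exp_pos _).le)]
  · exact (intervalIntegrable_iff_integrableOn_Ioo_of_le hst.1).1 h1
  · rw [EventuallyLE, ae_restrict_iff' measurableSet_Ioo]
    exact Eventually.of_forall fun t ht =>
      mul_nonneg (h.nonneg (Real.exp_pos _).le) (hs.pos t ⟨ht.1, ht.2.trans_le hst.2⟩).le

theorem weight_le (hs : IsStoppingLevel v₁ a t₀) (h : IsLossWeight v v₁ v₂) {s : ℝ}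
    (hst : s ∈ Icc 0 t₀) : v (Real.exp (-s)) ≤ Real.exp (-s) := by
  have ha : 0 < a := hs.mem.1.trans_le hs.mem.2
  obtain ⟨h1, h2⟩ := h.multiplier_identity ha ⟨hst.1, hst.2.trans hs.mem.2⟩
  have : 0 ≤ ∫ u in (0 : ℝ)..s, v (Real.exp (-(s - u))) * multiplier v₁ a u := by
    rw [intervalIntegral.integral_of_le hst.1, integral_Ioc_eq_integral_Ioo]
    exact setIntegral_nonneg measurableSet_Ioo fun t ht =>
      mul_nonneg (h.nonneg (Real.exp_pos _).le) (hs.pos t ⟨ht.1, ht.2.trans_le hst.2⟩).le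
  linarith

/-- With `z = e^{-s}` the cutoff restricts the integral to `t ≤ s`, and the claim is the multiplier
equation at time `s`. -/
theorem dualBound_eq (hs : IsStoppingLevel v₁ a t₀) (h : IsLossWeight v v₁ v₂) {z : ℝ}
    (hz : z ∈ Icc (Real.exp (-t₀)) 1) : dualBound v v₁ a t₀ z = ENNReal.ofReal z := by
  have hz0 : 0 < z := (Real.exp_pos _).trans_le hz.1
  set s := -Real.log z with hsd
  have hzs : z = Real.exp (-s) := by rw [hsd, neg_neg, Real.exp_log hz0]
  have hst : s ∈ Icc 0 t₀ := by
    constructor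
    · have := Real.log_nonpos hz0.le hz.2
      linarith
    · have := (Real.le_log_iff_exp_le hz0).2 hz.1
      linarith
  have e : ∫⁻ t in Ioo 0 t₀, (if z ≤ Real.exp (-t) then ENNReal.ofReal (v (z * Real.exp t)) else 0) *
      ENNReal.ofReal (multiplier v₁ a t) =
      ∫⁻ t in Ioo 0 s, ENNReal.ofReal (v (Real.exp (-(s - t)))) *
        ENNReal.ofReal (multiplier v₁ a t) := by
    rw [← lintegral_indicator measurableSet_Ioo, ← lintegral_indicator measurableSet_Ioo]
    refine lintegral_congr_ae ?_
    filter_upwards [show ∀ᵐ y : ℝ, y ≠ s by simp [ae_iff, measure_singleton]] with t hts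
    have hiff : z ≤ Real.exp (-t) ↔ t ≤ s := by
      rw [hzs, Real.exp_le_exp]; constructor <;> intro <;> linarith
    by_cases ht : t ∈ Ioo 0 s
    · rw [indicator_of_mem ht, indicator_of_mem (show t ∈ Ioo 0 t₀ from ⟨ht.1, ht.2.trans_le hst.2⟩),
        if_pos (hiff.2 ht.2.le), hzs, ← Real.exp_add]
      congr 4
      ring_nf
    · rw [indicator_of_notMem ht]
      by_cases ht2 : t ∈ Ioo 0 t₀
      · rw [indicator_of_mem ht2, if_neg, zero_mul]
        intro h3
        exact ht ⟨ht2.1, lt_of_le_of_ne (hiff.1 h3) hts⟩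
      · rw [indicator_of_notMem ht2]
  rw [dualBound, e, hs.lintegral_eq h hst, ← hzs, ← ENNReal.ofReal_add (h.nonneg hz0.le)]
  · congr 1; ring
  · have := hs.weight_le h hst
    rw [← hzs] at this
    linarith

/-- Put `p₀ = e^{-t₀}` and `ζ = z/p₀`, and apply `hermite` at `q = p₀ e^t` and `x = qζ` for each
`t`. Integration against unit mass at `0` plus the multiplier gives a lower bound `(2A - B)ζ + (B -
A)ζ²`, where `A` integrates `v(q)` and `B` integrates `q v'(q)`. `A = p₀` is the multiplier
equation, `B = p₀` is `multiplier_renewal_identity` at the zero `t₀`, so the bound is `p₀ζ = z`. The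
unit mass makes it strict. -/
theorem lt_dualBound (hs : IsStoppingLevel v₁ a t₀) (h : IsLossWeight v v₁ v₂) {z : ℝ}
    (hz : z ∈ Ioo 0 (Real.exp (-t₀))) : ENNReal.ofReal z < dualBound v v₁ a t₀ z := by
  have ha : 0 < a := hs.mem.1.trans_le hs.mem.2
  have ht0 : 0 < t₀ := hs.mem.1
  set p₀ := Real.exp (-t₀) with hp₀
  have hp0 : 0 < p₀ := Real.exp_pos _
  set ζ := z / p₀ with hζ
  have hζ0 : 0 < ζ := div_pos hz.1 hp0
  have hζ1 : ζ < 1 := (div_lt_one hp0).2 hz.2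
  have hzζ : z = p₀ * ζ := by rw [hζ]; field_simp
  have key : ∀ q ∈ Ioo (0 : ℝ) 1,
      (2 * v q - q * v₁ q) * ζ + (q * v₁ q - v q) * ζ ^ 2 < v (q * ζ) := by
    intro q hq
    have := h.hermite hq (x := q * ζ) ⟨mul_pos hq.1 hζ0, by nlinarith [hq.1]⟩
    have hq0 := hq.1.ne'
    have e : (2 * v q / q - v₁ q) * (q * ζ) + (q * v₁ q - v q) * (q * ζ / q) ^ 2 =
        (2 * v q - q * v₁ q) * ζ + (q * v₁ q - v q) * ζ ^ 2 := by field_simp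
    rwa [e] at this
  have hv := h.cont
  have hgi : IntegrableOn (multiplier v₁ a) (Ioo 0 t₀) :=
    (h.integrableOn_multiplier ha t₀).mono_set Ioo_subset_Icc_self
  have hint : IntegrableOn (fun t => v (z * Real.exp t) * multiplier v₁ a t) (Ioo 0 t₀) := by
    refine hgi.bdd_mul (c := 1) (by fun_prop) ?_
    rw [ae_restrict_iff' measurableSet_Ioo]
    refine Eventually.of_forall fun t ht => ?_
    rw [Real.norm_of_nonneg (h.nonneg (mul_pos hz.1 (Real.exp_pos _)).le)]
    refine h.le_one ?_
    have h1 : z * Real.exp t ≤ p₀ * Real.exp t :=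
      mul_le_mul_of_nonneg_right hz.2.le (Real.exp_pos _).le
    have h2 : p₀ * Real.exp t ≤ 1 := by
      rw [hp₀, ← Real.exp_add]
      exact Real.exp_le_one_iff.2 (by linarith [ht.2])
    linarith
  have hnn : ∀ t ∈ Ioo 0 t₀, 0 ≤ v (z * Real.exp t) * multiplier v₁ a t := fun t ht =>
    mul_nonneg (h.nonneg (mul_pos hz.1 (Real.exp_pos _)).le) (hs.pos t ht).le
  have e1 : dualBound v v₁ a t₀ z =
      ENNReal.ofReal (v z + ∫ t in Ioo 0 t₀, v (z * Real.exp t) * multiplier v₁ a t) := by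
    rw [ENNReal.ofReal_add (h.nonneg hz.1.le) (setIntegral_nonneg measurableSet_Ioo hnn),
      ofReal_integral_eq_lintegral_ofReal hint
        ((ae_restrict_iff' measurableSet_Ioo).2 (Eventually.of_forall hnn)), dualBound]
    congr 1
    refine setLIntegral_congr_fun measurableSet_Ioo fun t ht => ?_
    rw [if_pos, ENNReal.ofReal_mul (h.nonneg (mul_pos hz.1 (Real.exp_pos _)).le)]
    exact hz.2.le.trans (Real.exp_le_exp.2 (by linarith [ht.2]))
  rw [e1, ENNReal.ofReal_lt_ofReal_iff_of_nonneg hz.1.le]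
  obtain ⟨i1, j1⟩ := h.multiplier_identity ha ⟨ht0.le, hs.mem.2⟩
  obtain ⟨i2, j2⟩ := h.multiplier_renewal_identity ha hs.mem
  rw [intervalIntegrable_iff_integrableOn_Ioo_of_le ht0.le] at i1 i2
  rw [intervalIntegral.integral_of_le ht0.le, integral_Ioc_eq_integral_Ioo] at j1 j2
  rw [hs.zero, zero_add, ← hp₀] at j2
  rw [← hp₀] at j1
  have hle : ∫ t in Ioo 0 t₀, ((2 * ζ - ζ ^ 2) * (v (Real.exp (-(t₀ - t))) * multiplier v₁ a t) +
      (ζ ^ 2 - ζ) * (v₁ (Real.exp (-(t₀ - t))) * Real.exp (-(t₀ - t)) * multiplier v₁ a t)) ≤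
      ∫ t in Ioo 0 t₀, v (z * Real.exp t) * multiplier v₁ a t := by
    refine setIntegral_mono_on ((i1.const_mul _).add (i2.const_mul _)) hint measurableSet_Ioo
      fun t ht => ?_
    have hq := exp_neg_mem (t := t₀ - t) (by linarith [ht.2])
    have hk := (key _ hq).le
    have e2 : z * Real.exp t = Real.exp (-(t₀ - t)) * ζ := by
      rw [hzζ, hp₀, show -(t₀ - t) = -t₀ + t by ring, Real.exp_add]; ring
    rw [e2]
    have := mul_le_mul_of_nonneg_right hk (hs.pos t ht).le
    refine le_trans (le_of_eq ?_) this
    ring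
  rw [integral_add (i1.const_mul _) (i2.const_mul _), integral_const_mul, integral_const_mul, j1] at hle
  have hk := key p₀ (exp_neg_mem ht0)
  rw [← hzζ] at hk
  have j3 : ∫ t in Ioo 0 t₀, v₁ (Real.exp (-(t₀ - t))) * Real.exp (-(t₀ - t)) * multiplier v₁ a t =
      p₀ - v₁ p₀ * p₀ := by linarith
  rw [j3] at hle
  rw [hzζ]
  rw [hzζ] at hk hle
  nlinarith

theorem le_dualBound (hs : IsStoppingLevel v₁ a t₀) (h : IsLossWeight v v₁ v₂) {z : ℝ}
    (hz : z ∈ Icc (0 : ℝ) 1) : ENNReal.ofReal z ≤ dualBound v v₁ a t₀ z := by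
  rcases eq_or_lt_of_le hz.1 with h0 | h0
  · simp [← h0]
  rcases lt_or_ge z (Real.exp (-t₀)) with h1 | h1
  · exact (hs.lt_dualBound h ⟨h0, h1⟩).le
  · exact (hs.dualBound_eq h ⟨h1, hz.2⟩).ge

end IsStoppingLevel

/-- The left-hand side of the participation constraint at survival probability `e^{-t}`, for a
payment with tail probabilities `G`. -/
noncomputable def tailConstraint (v G : ℝ → ℝ) (t : ℝ) : ℝ≥0∞ :=
  ∫⁻ y in Ioi 0, if G y ≤ Real.exp (-t) then ENNReal.ofReal (v (G y * Real.exp t)) else 0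

/-- The value of the relaxed problem. -/
noncomputable def relaxedValue (v₁ : ℝ → ℝ) (a t₀ θ : ℝ) : ℝ≥0∞ :=
  ENNReal.ofReal θ * (1 + ∫⁻ t in Ioo 0 t₀, ENNReal.ofReal (multiplier v₁ a t))

/-- The feasible tail probability functions of the relaxed problem. -/
structure IsRelaxedFeasible (v : ℝ → ℝ) (θ : ℝ) (G : ℝ → ℝ) : Prop where
  measurable : Measurable G
  mem : ∀ y, G y ∈ Icc (0 : ℝ) 1
  le : ∀ t, 0 ≤ t → tailConstraint v G t ≤ ENNReal.ofReal θ

theorem tailConstraint_zero {v G : ℝ → ℝ} (hG : ∀ y, G y ∈ Icc (0 : ℝ) 1) :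
    tailConstraint v G 0 = ∫⁻ y in Ioi 0, ENNReal.ofReal (v (G y)) := by
  simp [tailConstraint, (hG _).2]

theorem measurable_tailKernel {v G : ℝ → ℝ} (hv : Measurable v) (hG : Measurable G) :
    Measurable fun x : ℝ × ℝ => if G x.1 ≤ Real.exp (-x.2) then
      ENNReal.ofReal (v (G x.1 * Real.exp x.2)) else 0 :=
  Measurable.ite (measurableSet_le (by fun_prop) (by fun_prop)) (by fun_prop) measurable_const

theorem measurable_tailConstraint {v G : ℝ → ℝ} (hv : Measurable v) (hG : Measurable G) :
    Measurable (tailConstraint v G) :=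
  Measurable.lintegral_prod_left' (μ := volume.restrict (Ioi 0)) (measurable_tailKernel hv hG)

namespace IsStoppingLevel

variable {v v₁ v₂ G : ℝ → ℝ} {a t₀ θ : ℝ}

theorem relaxedValue_ne_top (h : IsLossWeight v v₁ v₂) (ha : 0 < a) :
    relaxedValue v₁ a t₀ θ ≠ ⊤ := by
  refine ENNReal.mul_ne_top ENNReal.ofReal_ne_top (ENNReal.add_ne_top.2 ⟨ENNReal.one_ne_top, ?_⟩)
  exact (((h.integrableOn_multiplier ha t₀).mono_set Ioo_subset_Icc_self).lintegral_lt_top).ne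

theorem measurable_multiplier (h : IsLossWeight v v₁ v₂) (a : ℝ) : Measurable (multiplier v₁ a) :=
  (h.measurable_renewalDensity a).sub (h.measurable_multiplierLoss a).ennreal_toReal

theorem measurable_dualBound (h : IsLossWeight v v₁ v₂) (hG : Measurable G) :
    Measurable fun y => dualBound v v₁ a t₀ (G y) := by
  have hv := h.cont.measurable
  have hg := measurable_multiplier h a
  have h1 : Measurable fun y => ENNReal.ofReal (v (G y)) := by fun_prop
  refine h1.add ?_
  refine Measurable.lintegral_prod_right' (ν := volume.restrict (Ioo 0 t₀))
    (f := fun x : ℝ × ℝ => (if G x.1 ≤ Real.exp (-x.2) then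
      ENNReal.ofReal (v (G x.1 * Real.exp x.2)) else 0) * ENNReal.ofReal (multiplier v₁ a x.2)) ?_
  exact (measurable_tailKernel hv hG).mul (by fun_prop)

theorem lintegral_dualBound (h : IsLossWeight v v₁ v₂) (hG : Measurable G) :
    ∫⁻ y in Ioi 0, dualBound v v₁ a t₀ (G y) =
      (∫⁻ y in Ioi 0, ENNReal.ofReal (v (G y))) +
        ∫⁻ t in Ioo 0 t₀, tailConstraint v G t * ENNReal.ofReal (multiplier v₁ a t) := by
  have hv := h.cont.measurable
  have hg := measurable_multiplier h a
  have hk : Measurable fun x : ℝ × ℝ => (if G x.1 ≤ Real.exp (-x.2) then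
      ENNReal.ofReal (v (G x.1 * Real.exp x.2)) else 0) * ENNReal.ofReal (multiplier v₁ a x.2) :=
    (measurable_tailKernel hv hG).mul (by fun_prop)
  simp only [dualBound]
  rw [lintegral_add_left (by fun_prop), lintegral_lintegral_swap hk.aemeasurable]
  congr 1
  refine lintegral_congr fun t => ?_
  rw [tailConstraint, ← lintegral_mul_const]
  exact (measurable_tailKernel hv hG).comp (measurable_id.prodMk measurable_const)

theorem lintegral_dualBound_le (h : IsLossWeight v v₁ v₂) (hF : IsRelaxedFeasible v θ G) :
    ∫⁻ y in Ioi 0, dualBound v v₁ a t₀ (G y) ≤ relaxedValue v₁ a t₀ θ := by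
  have hg := measurable_multiplier h a
  rw [lintegral_dualBound h hF.measurable, relaxedValue, mul_add, mul_one,
    ← lintegral_const_mul _ (by fun_prop)]
  refine add_le_add ?_ (setLIntegral_mono (by fun_prop) fun t ht => ?_)
  · rw [← tailConstraint_zero hF.mem]
    exact hF.le 0 le_rfl
  · exact mul_le_mul_left (hF.le t ht.1.le) _

theorem revenue_le (hs : IsStoppingLevel v₁ a t₀) (h : IsLossWeight v v₁ v₂)
    (hF : IsRelaxedFeasible v θ G) :
    ∫⁻ y in Ioi 0, ENNReal.ofReal (G y) ≤ relaxedValue v₁ a t₀ θ :=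
  (lintegral_mono fun y => hs.le_dualBound h (hF.mem y)).trans (lintegral_dualBound_le h hF)

/-- Tightness characterizes the solutions of the relaxed problem. -/
theorem revenue_eq_of_tight (hs : IsStoppingLevel v₁ a t₀) (h : IsLossWeight v v₁ v₂)
    (hG : Measurable G) (hG1 : ∀ y, G y ∈ Icc (0 : ℝ) 1)
    (hval : ∀ y, 0 < y → G y = 0 ∨ Real.exp (-t₀) ≤ G y)
    (htight : ∀ t ∈ Icc 0 t₀, tailConstraint v G t = ENNReal.ofReal θ) :
    ∫⁻ y in Ioi 0, ENNReal.ofReal (G y) = relaxedValue v₁ a t₀ θ := by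
  have hg := measurable_multiplier h a
  have e1 : ∫⁻ y in Ioi 0, ENNReal.ofReal (G y) = ∫⁻ y in Ioi 0, dualBound v v₁ a t₀ (G y) := by
    refine setLIntegral_congr_fun measurableSet_Ioi fun y hy => ?_
    rcases hval y hy with h0 | h1
    · have : ∀ t : ℝ, (0 : ℝ) ≤ Real.exp (-t) := fun t => (Real.exp_pos _).le
      simp [h0, dualBound, h.map_zero]
    · exact (hs.dualBound_eq h ⟨h1, (hG1 y).2⟩).symm
  rw [e1, lintegral_dualBound h hG, relaxedValue, mul_add, mul_one,
    ← lintegral_const_mul _ (by fun_prop), ← tailConstraint_zero hG1,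
    htight 0 ⟨le_rfl, hs.mem.1.le⟩]
  congr 1
  refine setLIntegral_congr_fun measurableSet_Ioo fun t ht => ?_
  rw [htight t ⟨ht.1.le, ht.2.le⟩]

/-- Complementary slackness. All quantities in `∫ G ≤ ∫ dualBound ≤ relaxedValue` are finite, so
both inequalities are equalities. The first excludes values in `(0, e^{-t₀})` by `lt_dualBound`. The
second makes the constraint bind at `0`, which carries unit mass, and almost everywhere on `(0,t₀)`,
where the multiplier is positive. -/
theorem tight_of_revenue_eq (hs : IsStoppingLevel v₁ a t₀) (h : IsLossWeight v v₁ v₂)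
    (hF : IsRelaxedFeasible v θ G)
    (hrev : ∫⁻ y in Ioi 0, ENNReal.ofReal (G y) = relaxedValue v₁ a t₀ θ) :
    (∀ᵐ y ∂volume.restrict (Ioi 0), G y = 0 ∨ Real.exp (-t₀) ≤ G y) ∧
      tailConstraint v G 0 = ENNReal.ofReal θ ∧
      ∀ᵐ t ∂volume.restrict (Ioo 0 t₀), tailConstraint v G t = ENNReal.ofReal θ := by
  have ha : 0 < a := hs.mem.1.trans_le hs.mem.2
  have hg := measurable_multiplier h a
  have hC := measurable_tailConstraint h.cont.measurable hF.measurable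
  have hVt : relaxedValue v₁ a t₀ θ ≠ ⊤ := relaxedValue_ne_top h ha
  have hle := lintegral_dualBound_le (a := a) (t₀ := t₀) h hF
  refine ⟨?_, ?_⟩
  · have := ae_eq_of_ae_le_of_lintegral_le (μ := volume.restrict (Ioi 0))
      (Eventually.of_forall fun y => hs.le_dualBound h (hF.mem y)) (by rw [hrev]; exact hVt)
      (measurable_dualBound h hF.measurable).aemeasurable (by rw [hrev]; exact hle)
    filter_upwards [this] with y hy
    by_contra! hcon
    have h0 : 0 < G y := lt_of_le_of_ne (hF.mem y).1 (Ne.symm hcon.1)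
    exact absurd hy (hs.lt_dualBound h ⟨h0, hcon.2⟩).ne
  · have hge : relaxedValue v₁ a t₀ θ ≤ tailConstraint v G 0 +
        ∫⁻ t in Ioo 0 t₀, tailConstraint v G t * ENNReal.ofReal (multiplier v₁ a t) := by
      rw [tailConstraint_zero hF.mem, ← lintegral_dualBound h hF.measurable, ← hrev]
      exact lintegral_mono fun y => hs.le_dualBound h (hF.mem y)
    have hle2 : ∫⁻ t in Ioo 0 t₀, tailConstraint v G t * ENNReal.ofReal (multiplier v₁ a t) ≤
        ∫⁻ t in Ioo 0 t₀, ENNReal.ofReal θ * ENNReal.ofReal (multiplier v₁ a t) :=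
      setLIntegral_mono (by fun_prop) fun t ht => mul_le_mul_left (hF.le t ht.1.le) _
    have hV : relaxedValue v₁ a t₀ θ = ENNReal.ofReal θ +
        ∫⁻ t in Ioo 0 t₀, ENNReal.ofReal θ * ENNReal.ofReal (multiplier v₁ a t) := by
      rw [relaxedValue, mul_add, mul_one, ← lintegral_const_mul _ (by fun_prop)]
    have hVi : ∫⁻ t in Ioo 0 t₀, ENNReal.ofReal θ * ENNReal.ofReal (multiplier v₁ a t) ≠ ⊤ := by
      rw [hV] at hVt
      exact (ENNReal.add_ne_top.1 hVt).2
    rw [hV] at hge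
    refine ⟨le_antisymm (hF.le 0 le_rfl) ?_, ?_⟩
    · have := hge.trans (add_le_add le_rfl hle2)
      exact (ENNReal.add_le_add_iff_right hVi).1 this
    · have h3 : ∫⁻ t in Ioo 0 t₀, ENNReal.ofReal θ * ENNReal.ofReal (multiplier v₁ a t) ≤
          ∫⁻ t in Ioo 0 t₀, tailConstraint v G t * ENNReal.ofReal (multiplier v₁ a t) := by
        have := hge.trans (add_le_add (hF.le 0 le_rfl) le_rfl)
        exact (ENNReal.add_le_add_iff_left ENNReal.ofReal_ne_top).1 this
      have h4 := ae_eq_of_ae_le_of_lintegral_le (μ := volume.restrict (Ioo 0 t₀))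
        (f := fun t => tailConstraint v G t * ENNReal.ofReal (multiplier v₁ a t))
        (g := fun t => ENNReal.ofReal θ * ENNReal.ofReal (multiplier v₁ a t))
        ((ae_restrict_iff' measurableSet_Ioo).2 (Eventually.of_forall fun t ht =>
          mul_le_mul_left (hF.le t ht.1.le) _)) (ne_top_of_le_ne_top hVi hle2) (by fun_prop) h3
      rw [EventuallyEq, ae_restrict_iff' measurableSet_Ioo] at h4
      rw [ae_restrict_iff' measurableSet_Ioo]
      filter_upwards [h4] with t ht htm
      have hpos : ENNReal.ofReal (multiplier v₁ a t) ≠ 0 := by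
        simpa using hs.pos t htm
      exact (ENNReal.mul_left_inj hpos ENNReal.ofReal_ne_top).1 (ht htm)

/-- With `z = e^{-s}` this is `K + K⋆R = 1` at time `s - c`. It inverts the constraints: integrated
over levels it turns them into the length of a level set. -/
theorem indicator_eq_renewal (hs : IsStoppingLevel v₁ a t₀) (h : IsLossWeight v v₁ v₂) {c z : ℝ}
    (hc : c ∈ Icc 0 t₀) (hz : z = 0 ∨ z ∈ Icc (Real.exp (-t₀)) 1) :
    (if 0 < z ∧ z ≤ Real.exp (-c) then (1 : ℝ≥0∞) else 0) =
      (if z ≤ Real.exp (-c) then ENNReal.ofReal (v (z * Real.exp c)) else 0) +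
      ∫⁻ u in Ioo 0 (t₀ - c), (if z ≤ Real.exp (-(c + u)) then
        ENNReal.ofReal (v (z * Real.exp (c + u))) else 0) *
          ENNReal.ofReal (renewalDensity v₁ a u) := by
  have ha : 0 < a := hs.mem.1.trans_le hs.mem.2
  rcases hz with hz | hz
  · simp [hz, h.map_zero]
  have hz0 : 0 < z := (Real.exp_pos _).trans_le hz.1
  obtain ⟨s, hzs⟩ : ∃ s, z = Real.exp (-s) := ⟨-Real.log z, by rw [neg_neg, Real.exp_log hz0]⟩
  have hst : s ≤ t₀ := by
    have := hz.1
    rw [hzs, Real.exp_le_exp] at this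
    linarith
  have hiff : ∀ t : ℝ, z ≤ Real.exp (-t) ↔ t ≤ s := fun t => by
    rw [hzs, Real.exp_le_exp]; constructor <;> intro <;> linarith
  have hexp : ∀ t : ℝ, z * Real.exp t = Real.exp (-(s - t)) := fun t => by
    rw [hzs, ← Real.exp_add]; ring_nf
  simp only [hiff, hexp, hz0, true_and]
  by_cases hcs : c ≤ s
  · have hsc : s - c ∈ Icc 0 a := ⟨by linarith, by linarith [hs.mem.2, hc.1]⟩
    obtain ⟨h1, h2⟩ := h.flow_identity ha hsc
    have hnn : ∀ u, 0 ≤ v (Real.exp (-(s - c - u))) * renewalDensity v₁ a u := fun u =>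
      mul_nonneg (h.nonneg (Real.exp_pos _).le) (IsLossWeight.renewalDensity_nonneg _ _ _)
    have e : ∫⁻ u in Ioo 0 (t₀ - c), (if c + u ≤ s then
        ENNReal.ofReal (v (Real.exp (-(s - (c + u))))) else 0) *
          ENNReal.ofReal (renewalDensity v₁ a u) =
        ENNReal.ofReal (∫ u in (0 : ℝ)..(s - c), v (Real.exp (-(s - c - u))) *
          renewalDensity v₁ a u) := by
      rw [intervalIntegral.integral_of_le hsc.1, integral_Ioc_eq_integral_Ioo,
        ofReal_integral_eq_lintegral_ofReal
          ((intervalIntegrable_iff_integrableOn_Ioo_of_le hsc.1).1 h1)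
          (Eventually.of_forall hnn), ← lintegral_indicator measurableSet_Ioo,
        ← lintegral_indicator measurableSet_Ioo]
      refine lintegral_congr_ae ?_
      filter_upwards [show ∀ᵐ y : ℝ, y ≠ s - c by simp [ae_iff, measure_singleton]] with u hus
      by_cases hu : u ∈ Ioo 0 (s - c)
      · rw [indicator_of_mem hu, indicator_of_mem (show u ∈ Ioo 0 (t₀ - c) from
          ⟨hu.1, by linarith [hu.2]⟩), if_pos (by linarith [hu.2]), ← ENNReal.ofReal_mul
          (h.nonneg (Real.exp_pos _).le)]
        ring_nf
      · rw [indicator_of_notMem hu]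
        by_cases hu2 : u ∈ Ioo 0 (t₀ - c)
        · rw [indicator_of_mem hu2, if_neg, zero_mul]
          exact fun h3 => hu ⟨hu2.1, lt_of_le_of_ne (by linarith) hus⟩
        · rw [indicator_of_notMem hu2]
    rw [e, if_pos hcs, if_pos hcs, ← ENNReal.ofReal_add (h.nonneg (Real.exp_pos _).le), h2,
      ENNReal.ofReal_one]
    exact intervalIntegral.integral_nonneg hsc.1 fun u _ => hnn u
  · rw [if_neg hcs, if_neg hcs, zero_add]
    symm
    refine (setLIntegral_congr_fun measurableSet_Ioo fun u hu => ?_).trans lintegral_zero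
    rw [if_neg, zero_mul]
    intro h3
    exact hcs (by linarith [hu.1])

/-- The measure of the levels at which `0 < G ≤ e^{-c}`, for tight `G`. -/
theorem volume_level (hs : IsStoppingLevel v₁ a t₀) (h : IsLossWeight v v₁ v₂)
    (hG : Measurable G) (hG1 : ∀ y, G y ∈ Icc (0 : ℝ) 1)
    (hval : ∀ᵐ y ∂volume.restrict (Ioi 0), G y = 0 ∨ Real.exp (-t₀) ≤ G y)
    (htight : ∀ᵐ t ∂volume.restrict (Ioo 0 t₀), tailConstraint v G t = ENNReal.ofReal θ)
    {c : ℝ} (hc : c ∈ Icc 0 t₀) (hcθ : tailConstraint v G c = ENNReal.ofReal θ) :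
    volume (Ioi 0 ∩ {y | 0 < G y ∧ G y ≤ Real.exp (-c)}) =
      ENNReal.ofReal θ + ∫⁻ u in Ioo 0 (t₀ - c), ENNReal.ofReal θ *
        ENNReal.ofReal (renewalDensity v₁ a u) := by
  have hv := h.cont.measurable
  have hr := h.measurable_renewalDensity a
  have hS : MeasurableSet {y | 0 < G y ∧ G y ≤ Real.exp (-c)} :=
    (measurableSet_lt measurable_const hG).inter (measurableSet_le hG measurable_const)
  have e1 : volume (Ioi 0 ∩ {y | 0 < G y ∧ G y ≤ Real.exp (-c)}) =
      ∫⁻ y in Ioi 0, if 0 < G y ∧ G y ≤ Real.exp (-c) then (1 : ℝ≥0∞) else 0 := by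
    rw [inter_comm, ← Measure.restrict_apply hS, ← lintegral_indicator_one hS]
    refine lintegral_congr fun y => ?_
    simp [indicator_apply]
  have hk : Measurable fun x : ℝ × ℝ => (if G x.1 ≤ Real.exp (-(c + x.2)) then
      ENNReal.ofReal (v (G x.1 * Real.exp (c + x.2))) else 0) *
        ENNReal.ofReal (renewalDensity v₁ a x.2) :=
    ((measurable_tailKernel hv hG).comp
      (measurable_fst.prodMk (measurable_const.add measurable_snd))).mul (by fun_prop)
  have hk1 : Measurable fun y => if G y ≤ Real.exp (-c) then
      ENNReal.ofReal (v (G y * Real.exp c)) else 0 :=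
    (measurable_tailKernel hv hG).comp (measurable_id.prodMk measurable_const)
  have e2 : ∫⁻ y in Ioi 0, (if 0 < G y ∧ G y ≤ Real.exp (-c) then (1 : ℝ≥0∞) else 0) =
      tailConstraint v G c + ∫⁻ u in Ioo 0 (t₀ - c), tailConstraint v G (c + u) *
        ENNReal.ofReal (renewalDensity v₁ a u) := by
    have e3 : ∀ u, tailConstraint v G (c + u) * ENNReal.ofReal (renewalDensity v₁ a u) =
        ∫⁻ y in Ioi 0, (if G y ≤ Real.exp (-(c + u)) then
          ENNReal.ofReal (v (G y * Real.exp (c + u))) else 0) *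
            ENNReal.ofReal (renewalDensity v₁ a u) := fun u => by
      rw [tailConstraint, lintegral_mul_const]
      exact (measurable_tailKernel hv hG).comp (measurable_id.prodMk measurable_const)
    simp only [e3]
    rw [tailConstraint, ← lintegral_lintegral_swap hk.aemeasurable, ← lintegral_add_left hk1]
    refine lintegral_congr_ae ?_
    filter_upwards [hval] with y hy
    exact hs.indicator_eq_renewal h hc (hy.imp id fun h1 => ⟨h1, (hG1 y).2⟩)
  rw [e1, e2, hcθ]
  congr 1
  refine lintegral_congr_ae ?_
  rw [EventuallyEq, ae_restrict_iff' measurableSet_Ioo]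
  rw [ae_restrict_iff' measurableSet_Ioo] at htight
  have := (measurePreserving_add_left (volume : Measure ℝ) c).quasiMeasurePreserving.ae htight
  filter_upwards [this] with u hu hum
  rw [hu ⟨by linarith [hum.1, hc.1], by linarith [hum.2]⟩]

end IsStoppingLevel

/-! ### Uniqueness in the relaxed problem. -/

/-- A monotone right continuous tail probability function on `[0,∞)`. -/
structure IsTail (G : ℝ → ℝ) : Prop where
  antitone : AntitoneOn G (Ici 0)
  right : ∀ y, 0 ≤ y → ∀ q < G y, ∃ ε > 0, q < G (y + ε)

/-- By monotonicity `{u > 0 : q < G u}` is an interval starting at `0`, and by right continuity it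
omits its right end. So `G` is recovered from the lengths of its upper level sets. -/
theorem IsTail.lt_iff {G : ℝ → ℝ} (hG : IsTail G) {y q : ℝ} (hy : 0 ≤ y) :
    q < G y ↔ ENNReal.ofReal y < volume (Ioi 0 ∩ {u | q < G u}) := by
  constructor
  · intro hq
    obtain ⟨ε, hε, hqε⟩ := hG.right y hy q hq
    have hsub : Ioc 0 (y + ε) ⊆ Ioi 0 ∩ {u | q < G u} := fun u hu =>
      ⟨hu.1, hqε.trans_le (hG.antitone hu.1.le (show (0 : ℝ) ≤ y + ε by linarith) hu.2)⟩
    refine lt_of_lt_of_le ?_ (measure_mono hsub)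
    rw [Real.volume_Ioc, sub_zero]
    exact ENNReal.ofReal_lt_ofReal_iff_of_nonneg hy |>.2 (by linarith)
  · intro hlt
    by_contra! hq
    refine absurd hlt (not_lt.2 ?_)
    have hsub : Ioi 0 ∩ {u | q < G u} ⊆ Ioc 0 y := fun u hu => by
      refine ⟨hu.1, ?_⟩
      by_contra! hyu
      exact absurd hu.2 (not_lt.2 ((hG.antitone (show y ∈ Ici 0 from hy) (show (0 : ℝ) < u from hu.1).le hyu.le).trans hq))
    refine (measure_mono hsub).trans ?_
    rw [Real.volume_Ioc, sub_zero]

/-- The right-hand sides do not involve `G`. Below `e^{-t₀}` the length is that of `{G > 0}`, as `G`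
takes almost no values in between; above, the set `{0 < G ≤ e^{-c}}` of finite length is removed. -/
theorem IsStoppingLevel.volume_lt_level {v v₁ v₂ : ℝ → ℝ} {a t₀ θ : ℝ}
    (hs : IsStoppingLevel v₁ a t₀) (h : IsLossWeight v v₁ v₂) {G : ℝ → ℝ}
    (hF : IsRelaxedFeasible v θ G)
    (hrev : ∫⁻ y in Ioi 0, ENNReal.ofReal (G y) = relaxedValue v₁ a t₀ θ) :
    (∀ q ∈ Ico 0 (Real.exp (-t₀)), volume (Ioi 0 ∩ {y | q < G y}) = ENNReal.ofReal θ +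
      ∫⁻ u in Ioo 0 (t₀ - 0), ENNReal.ofReal θ * ENNReal.ofReal (renewalDensity v₁ a u)) ∧
    ∀ c ∈ Ioo 0 t₀, tailConstraint v G c = ENNReal.ofReal θ →
      volume (Ioi 0 ∩ {y | Real.exp (-c) < G y}) = (ENNReal.ofReal θ +
      ∫⁻ u in Ioo 0 (t₀ - 0), ENNReal.ofReal θ * ENNReal.ofReal (renewalDensity v₁ a u)) -
      (ENNReal.ofReal θ + ∫⁻ u in Ioo 0 (t₀ - c), ENNReal.ofReal θ *
        ENNReal.ofReal (renewalDensity v₁ a u)) := by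
  have ha : 0 < a := hs.mem.1.trans_le hs.mem.2
  obtain ⟨hval, hz, htight⟩ := hs.tight_of_revenue_eq h hF hrev
  have h0 := hs.volume_level h hF.measurable hF.mem hval htight ⟨le_rfl, hs.mem.1.le⟩ hz
  have hae := (ae_restrict_iff' measurableSet_Ioi).1 hval
  constructor
  · intro q hq
    rw [← h0]
    refine measure_congr ?_
    filter_upwards [hae] with y hy
    refine propext ⟨fun hyq => ⟨hyq.1, lt_of_le_of_lt hq.1 hyq.2, ?_⟩, fun hyq => ⟨hyq.1, ?_⟩⟩
    · simpa using (hF.mem y).2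
    · rcases hy hyq.1 with h1 | h1
      · exact absurd hyq.2.1 (by simp [h1])
      · exact hq.2.trans_le h1
  · intro c hc hcθ
    have h1 := hs.volume_level h hF.measurable hF.mem hval htight ⟨hc.1.le, hc.2.le⟩ hcθ
    rw [← h0, ← h1, ← measure_sdiff]
    · congr 1
      ext y
      simp only [mem_inter_iff, mem_ofPred_eq, Set.mem_sdiff]
      constructor
      · rintro ⟨hy, hyc⟩
        refine ⟨⟨hy, (Real.exp_pos _).trans hyc, by simpa using (hF.mem y).2⟩, ?_⟩
        rintro ⟨-, -, h3⟩
        linarith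
      · rintro ⟨⟨hy, hy0, -⟩, h3⟩
        refine ⟨hy, ?_⟩
        by_contra! h4
        exact h3 ⟨hy, hy0, h4⟩
    · rintro y ⟨hy, hy0, -⟩
      exact ⟨hy, hy0, by simpa using (hF.mem y).2⟩
    · exact (measurableSet_Ioi.inter ((measurableSet_lt measurable_const hF.measurable).inter
        (measurableSet_le hF.measurable measurable_const))).nullMeasurableSet
    · rw [h1]
      refine ENNReal.add_ne_top.2 ⟨ENNReal.ofReal_ne_top, ?_⟩
      have hr := h.measurable_renewalDensity a
      rw [lintegral_const_mul _ (by fun_prop)]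
      exact ENNReal.mul_ne_top ENNReal.ofReal_ne_top
        (h.integrable_renewalDensity ha).integrableOn.lintegral_lt_top.ne

/-- The solution of the relaxed problem is unique. -/
theorem IsStoppingLevel.unique {v v₁ v₂ : ℝ → ℝ} {a t₀ θ : ℝ}
    (hs : IsStoppingLevel v₁ a t₀) (h : IsLossWeight v v₁ v₂) {G₁ G₂ : ℝ → ℝ}
    (hF₁ : IsRelaxedFeasible v θ G₁) (hF₂ : IsRelaxedFeasible v θ G₂) (hT₁ : IsTail G₁)
    (hT₂ : IsTail G₂)
    (hrev₁ : ∫⁻ y in Ioi 0, ENNReal.ofReal (G₁ y) = relaxedValue v₁ a t₀ θ)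
    (hrev₂ : ∫⁻ y in Ioi 0, ENNReal.ofReal (G₂ y) = relaxedValue v₁ a t₀ θ) {y : ℝ} (hy : 0 ≤ y) :
    G₁ y = G₂ y := by
  have key : ∀ G₁ G₂ : ℝ → ℝ, IsRelaxedFeasible v θ G₁ → IsRelaxedFeasible v θ G₂ → IsTail G₁ →
      IsTail G₂ → ∫⁻ y in Ioi 0, ENNReal.ofReal (G₁ y) = relaxedValue v₁ a t₀ θ →
      ∫⁻ y in Ioi 0, ENNReal.ofReal (G₂ y) = relaxedValue v₁ a t₀ θ → G₂ y ≤ G₁ y := by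
    intro G₁ G₂ hF₁ hF₂ hT₁ hT₂ hrev₁ hrev₂
    by_contra! hlt
    -- Below `e^{-t₀}` every `q` between the two values works. Above it the lengths are known only
    -- for almost every level, so `q = e^{-c}` with `c` taken from an interval of positive length at
    -- which both constraints bind.
    have hq : ∃ q, G₁ y < q ∧ q < G₂ y ∧
        volume (Ioi 0 ∩ {y | q < G₁ y}) = volume (Ioi 0 ∩ {y | q < G₂ y}) := by
      obtain ⟨a1, b1⟩ := hs.volume_lt_level h hF₁ hrev₁
      obtain ⟨a2, b2⟩ := hs.volume_lt_level h hF₂ hrev₂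
      rcases lt_or_ge (G₁ y) (Real.exp (-t₀)) with hlt2 | hge
      · obtain ⟨q, hq1, hq2⟩ := exists_between (lt_min hlt hlt2)
        have hq3 : q ∈ Ico 0 (Real.exp (-t₀)) :=
          ⟨(hF₁.mem y).1.trans hq1.le, hq2.trans_le (min_le_right _ _)⟩
        exact ⟨q, hq1, hq2.trans_le (min_le_left _ _), by rw [a1 q hq3, a2 q hq3]⟩
      · have hg1 : 0 < G₁ y := (Real.exp_pos _).trans_le hge
        have hg2 : 0 < G₂ y := hg1.trans hlt
        have t1 := ((ae_restrict_iff' measurableSet_Ioo).1 (hs.tight_of_revenue_eq h hF₁ hrev₁).2.2)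
        have t2 := ((ae_restrict_iff' measurableSet_Ioo).1 (hs.tight_of_revenue_eq h hF₂ hrev₂).2.2)
        obtain ⟨c, hc, hc1, hc2⟩ : ∃ c ∈ Ioo (-Real.log (G₂ y)) (-Real.log (G₁ y)),
            (c ∈ Ioo 0 t₀ → tailConstraint v G₁ c = ENNReal.ofReal θ) ∧
            (c ∈ Ioo 0 t₀ → tailConstraint v G₂ c = ENNReal.ofReal θ) := by
          have hne : volume (Ioo (-Real.log (G₂ y)) (-Real.log (G₁ y))) ≠ 0 := by
            rw [Real.volume_Ioo]
            have := Real.log_lt_log hg1 hlt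
            simpa using this
          obtain ⟨c, hc, hcc⟩ := nonempty_of_measure_ne_zero
            (s := Ioo (-Real.log (G₂ y)) (-Real.log (G₁ y)) ∩
              {c | (c ∈ Ioo 0 t₀ → tailConstraint v G₁ c = ENNReal.ofReal θ) ∧
            (c ∈ Ioo 0 t₀ → tailConstraint v G₂ c = ENNReal.ofReal θ)}) (μ := volume) (by
              rwa [measure_inter_conull]
              exact t1.and t2)
          exact ⟨c, hc, hcc⟩
        have hlog2 := Real.log_nonpos hg2.le (hF₂.mem y).2
        have hlog1 := (Real.le_log_iff_exp_le hg1).2 hge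
        have hcm : c ∈ Ioo 0 t₀ := ⟨by linarith [hc.1], by linarith [hc.2]⟩
        refine ⟨Real.exp (-c), ?_, ?_, by rw [b1 c hcm (hc1 hcm), b2 c hcm (hc2 hcm)]⟩
        · rw [← Real.log_lt_iff_lt_exp hg1]; linarith [hc.2]
        · rw [← Real.lt_log_iff_exp_lt hg2]; linarith [hc.1]
    obtain ⟨q, hq1, hq2, hq3⟩ := hq
    have := (hT₂.lt_iff hy).1 hq2
    rw [← hq3, ← hT₁.lt_iff hy] at this
    exact lt_asymm this hq1
  exact le_antisymm (key G₂ G₁ hF₂ hF₁ hT₂ hT₁ hrev₂ hrev₁) (key G₁ G₂ hF₁ hF₂ hT₁ hT₂ hrev₁ hrev₂)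

/-! ### Rank-dependent utility in terms of losses. -/

theorem EReal.zero_le_coe_sub_iff {θ : ℝ} (hθ : 0 ≤ θ) {I : ℝ≥0∞} :
    (0 : EReal) ≤ (θ : EReal) - (I : EReal) ↔ I ≤ ENNReal.ofReal θ := by
  induction I with
  | top => simp
  | coe x =>
    rw [show (θ : EReal) - ((x : ℝ≥0∞) : EReal) = ((θ - x : ℝ) : EReal) from rfl, EReal.coe_nonneg,
      ENNReal.ofReal, ENNReal.coe_le_coe, Real.le_toNNReal_iff_coe_le hθ]
    exact _root_.sub_nonneg

theorem EReal.coe_lt_sub_iff {θ y : ℝ} {L : ℝ≥0∞} :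
    (y : EReal) < (θ : EReal) - (L : EReal) ↔ L < ENNReal.ofReal (θ - y) := by
  induction L with
  | top => simp
  | coe x =>
    rw [show (θ : EReal) - ((x : ℝ≥0∞) : EReal) = ((θ - x : ℝ) : EReal) from rfl,
      EReal.coe_lt_coe_iff, ENNReal.ofReal, ENNReal.coe_lt_coe, Real.lt_toNNReal_iff_coe_lt]
    constructor <;> intro <;> linarith

/-- Rank-dependent utility of `θ - L` for a random loss `L ∈ [0,∞]`. -/
theorem rdeu_eq {w : ℝ → ℝ} (hw : IsWeightingFunction w) {Ω : Type*} [MeasurableSpace Ω]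
    (Q : Measure Ω) [IsProbabilityMeasure Q] {Y : Ω → EReal} {L : Ω → ℝ≥0∞} (hL : Measurable L)
    {θ : ℝ} (hθ : 0 ≤ θ) (hY : ∀ᵐ ω ∂Q, Y ω = (θ : EReal) - (L ω : EReal)) :
    rdeu w Q Y = (θ : EReal) - ((∫⁻ u in Ioi (0 : ℝ),
      ENNReal.ofReal (clampDual w (Q.real {ω | ENNReal.ofReal u < L ω})) : ℝ≥0∞) : EReal) := by
  have hv := hw.isLossWeight
  -- The complement of `{y < Y}` is `{L ≥ θ - y}`, so the weak inequality appears naturally; it is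
  -- traded for the strict one below.
  set J : ℝ → ℝ := fun u => clampDual w (Q.real {ω | ENNReal.ofReal u ≤ L ω}) with hJ
  have hJ0 : ∀ u, 0 ≤ J u := fun u => hv.nonneg measureReal_nonneg
  have hJ1 : ∀ u, J u ≤ 1 := fun u => hv.le_one measureReal_le_one
  have hJanti : Antitone J := fun u u' huu' => hv.mono (measureReal_mono fun ω hω =>
    (ENNReal.ofReal_le_ofReal huu').trans hω)
  have hJm : Measurable J := hJanti.measurable
  have hφ : ∀ y : ℝ, w (Q.real {ω | (y : EReal) < Y ω}) = 1 - J (θ - y) := by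
    intro y
    have e : {ω | (y : EReal) < Y ω} =ᵐ[Q] ({ω | ENNReal.ofReal (θ - y) ≤ L ω}ᶜ : Set Ω) := by
      filter_upwards [hY] with ω hω
      refine propext ?_
      change (y : EReal) < Y ω ↔ ¬ (ENNReal.ofReal (θ - y) ≤ L ω)
      rw [hω, EReal.coe_lt_sub_iff, not_le]
    rw [measureReal_congr e, probReal_compl_eq_one_sub (measurableSet_le measurable_const hL)]
    simp only [hJ]
    rw [clampDual_eq w ⟨measureReal_nonneg, measureReal_le_one⟩, dualWeight]
    ring
  have hJneg : ∀ u ≤ 0, J u = 1 := by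
    intro u hu
    simp only [hJ, ENNReal.ofReal_of_nonpos hu, zero_le, ofPred_true, probReal_univ, hv.map_one]
  have e1 : ∫⁻ y in Ioi (0 : ℝ), ENNReal.ofReal (w (Q.real {ω | (y : EReal) < Y ω})) =
      ∫⁻ u in Ioc 0 θ, ENNReal.ofReal (1 - J u) := by
    simp only [hφ]
    rw [← lintegral_indicator measurableSet_Ioi, ← lintegral_indicator measurableSet_Ioc,
      ← lintegral_sub_left_eq_self _ θ]
    refine lintegral_congr_ae ?_
    filter_upwards [show ∀ᵐ y : ℝ, y ≠ θ by simp [ae_iff, measure_singleton]] with u hu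
    simp only [indicator_apply, mem_Ioi, mem_Ioc, sub_sub_cancel]
    rcases lt_or_gt_of_ne hu with h1 | h1
    · rcases le_or_gt u 0 with h2 | h2
      · simp [hJneg u h2]
      · simp [h1, h1.le, h2]
    · rw [if_neg (by linarith), if_neg (by simp [h1])]
  have e2 : ∫⁻ y in Iio (0 : ℝ), ENNReal.ofReal (1 - w (Q.real {ω | (y : EReal) < Y ω})) =
      ∫⁻ u in Ioi θ, ENNReal.ofReal (J u) := by
    simp only [hφ, sub_sub_cancel]
    rw [← lintegral_indicator measurableSet_Iio, ← lintegral_indicator measurableSet_Ioi,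
      ← lintegral_sub_left_eq_self _ θ]
    refine lintegral_congr fun u => ?_
    simp only [indicator_apply, mem_Ioi, mem_Iio, sub_sub_cancel, sub_neg]
  have e3 : ∫⁻ u in Ioi (0 : ℝ),
      ENNReal.ofReal (clampDual w (Q.real {ω | ENNReal.ofReal u < L ω})) =
      (∫⁻ u in Ioc 0 θ, ENNReal.ofReal (J u)) + ∫⁻ u in Ioi θ, ENNReal.ofReal (J u) := by
    rw [← lintegral_union measurableSet_Ioi (Ioc_disjoint_Ioi le_rfl), Ioc_union_Ioi_eq_Ioi hθ]
    refine lintegral_congr_ae ?_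
    rw [EventuallyEq, ae_restrict_iff' measurableSet_Ioi]
    -- The weak and strict tails of `L` differ only at atoms, of which there are countably many.
    have hcount := Measure.countable_meas_level_set_pos (μ := Q) hL.ennreal_toReal
    filter_upwards [hcount.ae_notMem volume] with u hu hu0
    have hu0 : 0 < u := hu0
    have hz : Q {ω | (L ω).toReal = u} = 0 := by
      by_contra hne
      exact hu (pos_iff_ne_zero.2 hne)
    simp only [hJ]
    congr 2
    refine measureReal_congr ?_
    have hz' : ∀ᵐ ω ∂Q, (L ω).toReal ≠ u := by rw [ae_iff]; simpa using hz
    filter_upwards [hz'] with ω hω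
    refine propext ⟨fun h => le_of_lt h, fun h => lt_of_le_of_ne h fun he => hω ?_⟩
    rw [← he, ENNReal.toReal_ofReal hu0.le]
  have e4 : (∫⁻ u in Ioc 0 θ, ENNReal.ofReal (1 - J u)) + ∫⁻ u in Ioc 0 θ, ENNReal.ofReal (J u) =
      ENNReal.ofReal θ := by
    rw [← lintegral_add_left (by fun_prop)]
    have : ∀ u, ENNReal.ofReal (1 - J u) + ENNReal.ofReal (J u) = 1 := fun u => by
      rw [← ENNReal.ofReal_add (by linarith [hJ1 u]) (hJ0 u)]
      simp
    simp [this]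
  rw [rdeu, e1, e2, e3]
  generalize (∫⁻ u in Ioc 0 θ, ENNReal.ofReal (1 - J u)) = A at *
  generalize (∫⁻ u in Ioc 0 θ, ENNReal.ofReal (J u)) = c at *
  generalize (∫⁻ u in Ioi θ, ENNReal.ofReal (J u)) = b at *
  have hfin := ENNReal.add_ne_top.1 (e4 ▸ ENNReal.ofReal_ne_top)
  lift A to NNReal using hfin.1
  lift c to NNReal using hfin.2
  have e5 : (A : ℝ) + c = θ := by
    have := congrArg ENNReal.toReal e4
    rw [ENNReal.toReal_ofReal hθ, ← ENNReal.coe_add, ENNReal.coe_toReal, NNReal.coe_add] at this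
    exact this
  induction b with
  | top => simp
  | coe b =>
    have hc : ∀ x : NNReal, ((x : ℝ≥0∞) : EReal) = ((x : ℝ) : EReal) := fun _ => rfl
    rw [← ENNReal.coe_add, hc, hc, hc, ← EReal.coe_sub, ← EReal.coe_sub, ← e5]
    congr 1
    push_cast
    ring

theorem zero_le_rdeu_iff {w : ℝ → ℝ} (hw : IsWeightingFunction w) {Ω : Type*} [MeasurableSpace Ω]
    (Q : Measure Ω) [IsProbabilityMeasure Q] {Y : Ω → EReal} {L : Ω → ℝ≥0∞} (hL : Measurable L)
    {θ : ℝ} (hθ : 0 ≤ θ) (hY : ∀ᵐ ω ∂Q, Y ω = (θ : EReal) - (L ω : EReal)) :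
    0 ≤ rdeu w Q Y ↔ ∫⁻ u in Ioi (0 : ℝ),
      ENNReal.ofReal (clampDual w (Q.real {ω | ENNReal.ofReal u < L ω})) ≤ ENNReal.ofReal θ := by
  rw [rdeu_eq hw Q hL hθ hY, EReal.zero_le_coe_sub_iff hθ]

theorem EReal.coe_sub_ofReal (a : ℝ) {b : ℝ} (hb : 0 ≤ b) :
    (a : EReal) - ((ENNReal.ofReal b : ℝ≥0∞) : EReal) = ((a - b : ℝ) : EReal) := by
  rw [EReal.coe_ennreal_ofReal, max_eq_left hb, ← EReal.coe_sub]

/-- Under sure delivery the two payoff functionals agree. -/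
theorem rdeuMenu_eq_cptMenu {w wplus : ℝ → ℝ} (hw : IsWeightingFunction w)
    (hwp : IsWeightingFunction wplus) {θ : ℝ} (hθ : 0 ≤ θ) {Ω : Type*} [MeasurableSpace Ω]
    (P : Measure Ω) [IsProbabilityMeasure P] {X T : Ω → ℝ} (hX : ∀ᵐ ω ∂P, X ω = 1)
    (hT : Measurable T) (hT0 : ∀ ω, 0 ≤ T ω) :
    rdeuMenu w θ P X T = cptMenu wplus (dualWeight w) 1 θ P X T := by
  have hX1 : P.real {ω | X ω = 1} = 1 := by
    have : {ω | X ω = 1} =ᵐ[P] univ := by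
      filter_upwards [hX] with ω hω
      exact propext ⟨fun _ => trivial, fun _ => hω⟩
    rw [measureReal_congr this, probReal_univ]
  rw [rdeuMenu, rdeu_eq hw P (L := fun ω => ENNReal.ofReal (T ω)) (θ := θ) (by fun_prop) hθ,
    cptMenu, hX1, hwp.map_one, mul_one, EReal.coe_one, one_mul]
  · congr 2
    refine setLIntegral_congr_fun measurableSet_Ioi fun u hu => ?_
    have hu : 0 < u := hu
    have : {ω | ENNReal.ofReal u < ENNReal.ofReal (T ω)} = {ω | u < T ω} := by
      ext ω
      exact ENNReal.ofReal_lt_ofReal_iff_of_nonneg hu.le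
    rw [this, clampDual_eq w ⟨measureReal_nonneg, measureReal_le_one⟩]
  · filter_upwards [hX] with ω hω
    rw [EReal.coe_sub_ofReal _ (hT0 ω), hω, mul_one]

theorem isTail_measureReal {Ω : Type*} [MeasurableSpace Ω] (P : Measure Ω) [IsProbabilityMeasure P]
    (Z : Ω → ℝ≥0∞) : IsTail fun y => P.real {ω | ENNReal.ofReal y < Z ω} where
  antitone := fun y _ y' _ hyy' => measureReal_mono fun ω hω =>
    lt_of_le_of_lt (ENNReal.ofReal_le_ofReal hyy') hω
  right := by
    intro y hy q hq
    have hU : {ω | ENNReal.ofReal y < Z ω} =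
        ⋃ n : ℕ, {ω | ENNReal.ofReal (y + 1 / ((n : ℝ) + 1)) < Z ω} := by
      ext ω
      simp only [mem_ofPred_eq, mem_iUnion]
      constructor
      · intro h
        have hlim : Tendsto (fun n : ℕ => ENNReal.ofReal (y + 1 / ((n : ℝ) + 1))) atTop
            (𝓝 (ENNReal.ofReal y)) := by
          have := (tendsto_one_div_add_atTop_nhds_zero_nat (𝕜 := ℝ)).const_add y
          rw [add_zero] at this
          exact ENNReal.tendsto_ofReal this
        exact (hlim.eventually (gt_mem_nhds h)).exists
      · rintro ⟨n, hn⟩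
        exact lt_of_le_of_lt (ENNReal.ofReal_le_ofReal (by
          have : (0 : ℝ) < 1 / ((n : ℝ) + 1) := by positivity
          linarith)) hn
    have hmono : Monotone fun n : ℕ => {ω | ENNReal.ofReal (y + 1 / ((n : ℝ) + 1)) < Z ω} := by
      intro n n' hnn ω hω
      refine lt_of_le_of_lt (ENNReal.ofReal_le_ofReal ?_) hω
      have : (1 : ℝ) / ((n' : ℝ) + 1) ≤ 1 / ((n : ℝ) + 1) :=
        one_div_le_one_div_of_le (by positivity) (by exact_mod_cast Nat.succ_le_succ hnn)
      linarith
    have ht := tendsto_measure_iUnion_atTop (μ := P) hmono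
    rw [← hU] at ht
    have ht2 := (ENNReal.tendsto_toReal (measure_ne_top P _)).comp ht
    obtain ⟨n, hn⟩ := (ht2.eventually (lt_mem_nhds hq)).exists
    exact ⟨1 / ((n : ℝ) + 1), by positivity, hn⟩

/-! ### The static problem. -/

namespace StaticMechanism

/-- The loss `θ (1 - X) + T` relative to receiving the good for free. -/
noncomputable def loss (θ : ℝ) (m : StaticMechanism) (ω : m.Ω) : ℝ≥0∞ :=
  ENNReal.ofReal (θ * (1 - m.X ω) + m.T ω)

theorem measurable_loss (θ : ℝ) (m : StaticMechanism) : Measurable (m.loss θ) := by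
  have h1 := m.measurable_X
  have h2 := m.measurable_T
  unfold loss
  fun_prop

theorem loss_arg_nonneg {θ : ℝ} (hθ : 0 ≤ θ) (m : StaticMechanism) (ω : m.Ω) :
    0 ≤ θ * (1 - m.X ω) := by
  rcases m.X_mem ω with h | h <;> simp [h, hθ]

theorem feasible_iff {w : ℝ → ℝ} (hw : IsWeightingFunction w) {θ : ℝ} (hθ : 0 ≤ θ)
    (m : StaticMechanism) : m.Feasible w θ ↔ ∫⁻ u in Ioi (0 : ℝ),
      ENNReal.ofReal (clampDual w (m.P.real {ω | ENNReal.ofReal u < m.loss θ ω})) ≤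
        ENNReal.ofReal θ := by
  rw [Feasible, rdeuMenu]
  refine zero_le_rdeu_iff hw m.P (m.measurable_loss θ) hθ (Eventually.of_forall fun ω => ?_)
  rw [loss, EReal.coe_sub_ofReal _ (add_nonneg (m.loss_arg_nonneg hθ ω) (m.T_nonneg ω))]
  congr 1
  ring

theorem ofReal_lt_loss {θ : ℝ} (hθ : 0 ≤ θ) (m : StaticMechanism) {u : ℝ} (hu : 0 < u) (ω : m.Ω)
    (h : u < m.T ω) : ENNReal.ofReal u < m.loss θ ω := by
  rw [loss, ENNReal.ofReal_lt_ofReal_iff_of_nonneg hu.le]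
  linarith [m.loss_arg_nonneg hθ ω]

theorem revenue_eq_lintegral (m : StaticMechanism) :
    m.revenue = ∫⁻ ω, ENNReal.ofReal (m.T ω) ∂m.P := by
  rw [revenue, lintegral_eq_lintegral_meas_lt m.P (Eventually.of_forall m.T_nonneg)
    m.measurable_T.aemeasurable]

theorem lintegral_loss {θ : ℝ} (hθ : 0 ≤ θ) (m : StaticMechanism) :
    ∫⁻ ω, m.loss θ ω ∂m.P = ∫⁻ u in Ioi (0 : ℝ), m.P {ω | ENNReal.ofReal u < m.loss θ ω} := by
  have h1 := m.measurable_X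
  have h2 := m.measurable_T
  have := lintegral_eq_lintegral_meas_lt m.P (f := fun ω => θ * (1 - m.X ω) + m.T ω)
    (Eventually.of_forall fun ω => add_nonneg (m.loss_arg_nonneg hθ ω) (m.T_nonneg ω))
    (by fun_prop)
  rw [show (∫⁻ ω, m.loss θ ω ∂m.P) = ∫⁻ ω, ENNReal.ofReal (θ * (1 - m.X ω) + m.T ω) ∂m.P from rfl,
    this]
  refine setLIntegral_congr_fun measurableSet_Ioi fun u hu => ?_
  have hu : 0 < u := hu
  congr 1
  ext ω
  exact (ENNReal.ofReal_lt_ofReal_iff_of_nonneg hu.le).symm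

variable {w : ℝ → ℝ} {θ μ p : ℝ}

/-- The expected loss is the integral of its tail, and `q ≤ μ v(q)` holds level by level. The bound
is on the whole loss, of which revenue is only a part. -/
theorem lintegral_loss_le (hw : IsWeightingFunction w) (hθ : 0 ≤ θ) (hμ : 0 ≤ μ)
    (hμv : ∀ q ∈ Icc (0 : ℝ) 1, q ≤ μ * clampDual w q) (m : StaticMechanism)
    (hm : m.Feasible w θ) : ∫⁻ ω, m.loss θ ω ∂m.P ≤ ENNReal.ofReal (μ * θ) := by
  rw [m.feasible_iff hw hθ] at hm
  rw [m.lintegral_loss hθ, ENNReal.ofReal_mul hμ]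
  refine le_trans ?_ (mul_le_mul_right hm _)
  rw [← lintegral_const_mul' _ _ ENNReal.ofReal_ne_top]
  refine lintegral_mono fun u => ?_
  rw [← ofReal_measureReal, ← ENNReal.ofReal_mul hμ]
  exact ENNReal.ofReal_le_ofReal (hμv _ ⟨measureReal_nonneg, measureReal_le_one⟩)

theorem lintegral_T_le_loss (hθ : 0 ≤ θ) (m : StaticMechanism) (ω : m.Ω) :
    ENNReal.ofReal (m.T ω) ≤ m.loss θ ω :=
  ENNReal.ofReal_le_ofReal (by linarith [m.loss_arg_nonneg hθ ω])

theorem revenue_le (hw : IsWeightingFunction w) (hθ : 0 ≤ θ) (hμ : 0 ≤ μ)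
    (hμv : ∀ q ∈ Icc (0 : ℝ) 1, q ≤ μ * clampDual w q) (m : StaticMechanism)
    (hm : m.Feasible w θ) : m.revenue ≤ ENNReal.ofReal (μ * θ) := by
  rw [revenue_eq_lintegral]
  exact (lintegral_mono (m.lintegral_T_le_loss hθ)).trans (m.lintegral_loss_le hw hθ hμ hμv hm)

/-- A sure sale with the optimal two-point price distribution is feasible and earns `μ θ`. -/
theorem feasible_of_tail (hw : IsWeightingFunction w) (hθ : 0 < θ) (hμ : 0 < μ)
    (hp : p ∈ Ioo (0 : ℝ) 1) (hμp : μ * clampDual w p = p) (m : StaticMechanism)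
    (hX : ∀ᵐ ω ∂m.P, m.X ω = 1)
    (hT : ∀ y : ℝ, 0 ≤ y → m.P.real {ω | y < m.T ω} = if y < μ * θ / p then p else 0) :
    m.Feasible w θ ∧ m.revenue = ENNReal.ofReal (μ * θ) := by
  have hv := hw.isLossWeight
  have hc : 0 < μ * θ / p := div_pos (mul_pos hμ hθ) hp.1
  constructor
  · rw [m.feasible_iff hw hθ.le]
    have e : ∫⁻ u in Ioi (0 : ℝ), ENNReal.ofReal (clampDual w (m.P.real
        {ω | ENNReal.ofReal u < m.loss θ ω})) =
        ∫⁻ u in Ioo 0 (μ * θ / p), ENNReal.ofReal (clampDual w p) := by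
      rw [← lintegral_indicator measurableSet_Ioi, ← lintegral_indicator measurableSet_Ioo]
      refine lintegral_congr fun u => ?_
      by_cases hu : 0 < u
      · rw [indicator_of_mem (show u ∈ Ioi 0 from hu)]
        have h1 : m.P.real {ω | ENNReal.ofReal u < m.loss θ ω} = m.P.real {ω | u < m.T ω} := by
          refine measureReal_congr ?_
          filter_upwards [hX] with ω hω
          refine propext ?_
          change ENNReal.ofReal u < m.loss θ ω ↔ u < m.T ω
          rw [loss, ENNReal.ofReal_lt_ofReal_iff_of_nonneg hu.le, hω]
          simp
        rw [h1, hT u hu.le]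
        by_cases hu2 : u < μ * θ / p
        · rw [if_pos hu2, indicator_of_mem (show u ∈ Ioo 0 (μ * θ / p) from ⟨hu, hu2⟩)]
        · rw [if_neg hu2, indicator_of_notMem (fun h => hu2 h.2), hv.map_zero, ENNReal.ofReal_zero]
      · rw [indicator_of_notMem (show u ∉ Ioi 0 from hu), indicator_of_notMem (fun h => hu h.1)]
    rw [e, setLIntegral_const, Real.volume_Ioo, sub_zero, ← ENNReal.ofReal_mul
      (hv.nonneg hp.1.le)]
    refine ENNReal.ofReal_le_ofReal (le_of_eq ?_)
    have hp0 := hp.1.ne'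
    rw [mul_div_assoc', div_eq_iff hp0]
    linear_combination θ * hμp
  · have e : m.revenue = ∫⁻ u in Ioo 0 (μ * θ / p), ENNReal.ofReal p := by
      rw [revenue, ← lintegral_indicator measurableSet_Ioi, ← lintegral_indicator measurableSet_Ioo]
      refine lintegral_congr fun u => ?_
      by_cases hu : 0 < u
      · rw [indicator_of_mem (show u ∈ Ioi 0 from hu), ← ofReal_measureReal, hT u hu.le]
        by_cases hu2 : u < μ * θ / p
        · rw [if_pos hu2, indicator_of_mem (show u ∈ Ioo 0 (μ * θ / p) from ⟨hu, hu2⟩)]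
        · rw [if_neg hu2, indicator_of_notMem (fun h => hu2 h.2), ENNReal.ofReal_zero]
      · rw [indicator_of_notMem (show u ∉ Ioi 0 from hu), indicator_of_notMem (fun h => hu h.1)]
    rw [e, setLIntegral_const, Real.volume_Ioo, sub_zero, ← ENNReal.ofReal_mul hp.1.le,
      mul_div_cancel₀ _ hp.1.ne']

theorem exists_tail (hp : p ∈ Ioo (0 : ℝ) 1) {c : ℝ} (hc : 0 < c) :
    ∃ m : StaticMechanism, (∀ᵐ ω ∂m.P, m.X ω = 1) ∧
      ∀ y : ℝ, 0 ≤ y → m.P.real {ω | y < m.T ω} = if y < c then p else 0 := by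
  set P : Measure Bool := ENNReal.ofReal p • Measure.dirac true +
    ENNReal.ofReal (1 - p) • Measure.dirac false with hP
  have hprob : IsProbabilityMeasure P := by
    constructor
    simp only [hP, Measure.coe_add, Measure.coe_smul, Pi.add_apply, Pi.smul_apply, measure_univ,
      smul_eq_mul, mul_one]
    rw [← ENNReal.ofReal_add hp.1.le (by linarith [hp.2])]
    simp
  refine ⟨{ Ω := Bool, P := P, X := fun _ => 1, measurable_X := measurable_const,
            X_mem := fun _ => Or.inr rfl, T := fun b => if b then c else 0,
            measurable_T := measurable_of_countable _,
            T_nonneg := fun b => by split_ifs <;> linarith }, by simp, fun y hy => ?_⟩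
  simp only [Measure.real, hP]
  split_ifs with hyc
  · have : {ω : Bool | y < if ω = true then c else 0} = {true} := by
      ext b
      cases b <;> simp [hyc, hy]
    rw [this]
    simp [hp.1.le]
  · have : {ω : Bool | y < if ω = true then c else 0} = ∅ := by
      ext b
      cases b <;> simp [hy, not_lt.1 hyc]
    rw [this]
    simp

/-- Feasible mechanisms with revenue `μ θ` sell for sure at the optimal price distribution. -/
theorem tail_of_revenue_eq (hw : IsWeightingFunction w) (hθ : 0 < θ) (hμ : 1 < μ)
    (hp : p ∈ Ioo (0 : ℝ) 1) (hμv : ∀ q ∈ Icc (0 : ℝ) 1, q ≤ μ * clampDual w q)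
    (huniq : ∀ q ∈ Ioo (0 : ℝ) 1, μ * clampDual w q = q → q = p) (m : StaticMechanism)
    (hm : m.Feasible w θ) (hrev : m.revenue = ENNReal.ofReal (μ * θ)) :
    (∀ᵐ ω ∂m.P, m.X ω = 1) ∧
      ∀ y : ℝ, 0 ≤ y → m.P.real {ω | y < m.T ω} = if y < μ * θ / p then p else 0 := by
  have hv := hw.isLossWeight
  have hμ0 : 0 < μ := by linarith
  have hTm := m.measurable_T
  -- The bound `μθ` applies to the expectation of `θ(1 - X) + T`; if `T` alone attains it, the first
  -- summand vanishes almost surely.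
  have hX : ∀ᵐ ω ∂m.P, m.X ω = 1 := by
    have hle := m.lintegral_loss_le hw hθ.le hμ0.le hμv hm
    rw [← hrev, revenue_eq_lintegral] at hle
    have hfin : ∫⁻ ω, ENNReal.ofReal (m.T ω) ∂m.P ≠ ⊤ := by
      rw [← revenue_eq_lintegral, hrev]; exact ENNReal.ofReal_ne_top
    have := ae_eq_of_ae_le_of_lintegral_le (Eventually.of_forall (m.lintegral_T_le_loss hθ.le)) hfin
      (m.measurable_loss θ).aemeasurable hle
    filter_upwards [this] with ω hω
    rw [loss, ENNReal.ofReal_eq_ofReal_iff (m.T_nonneg ω)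
      (add_nonneg (m.loss_arg_nonneg hθ.le ω) (m.T_nonneg ω))] at hω
    have : θ * (1 - m.X ω) = 0 := by linarith
    rcases mul_eq_zero.1 this with h | h
    · exact absurd h hθ.ne'
    · linarith
  refine ⟨hX, ?_⟩
  set G : ℝ → ℝ := fun y => m.P.real {ω | y < m.T ω} with hG
  have hGanti : Antitone G := fun y y' hyy' => measureReal_mono fun ω hω => lt_of_le_of_lt hyy' hω
  have hGm : Measurable G := hGanti.measurable
  have hG1 : ∀ y, G y ∈ Icc (0 : ℝ) 1 := fun y => ⟨measureReal_nonneg, measureReal_le_one⟩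
  have hGtail : IsTail G := by
    have := isTail_measureReal m.P (fun ω => ENNReal.ofReal (m.T ω))
    have e : ∀ y, 0 ≤ y → m.P.real {ω | ENNReal.ofReal y < ENNReal.ofReal (m.T ω)} = G y := by
      intro y hy
      simp only [hG]
      congr 1
      ext ω
      exact ENNReal.ofReal_lt_ofReal_iff_of_nonneg hy
    refine ⟨hGanti.antitoneOn _, fun y hy q hq => ?_⟩
    obtain ⟨ε, hε, h⟩ := this.right y hy q (by rw [e y hy]; exact hq)
    exact ⟨ε, hε, by rwa [e _ (by linarith)] at h⟩
  have hrevG : ∫⁻ y in Ioi 0, ENNReal.ofReal (G y) = ENNReal.ofReal (μ * θ) := by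
    rw [← hrev, revenue]
    exact lintegral_congr fun y => ofReal_measureReal
  have hcon : ∫⁻ y in Ioi 0, ENNReal.ofReal (μ * clampDual w (G y)) ≤ ENNReal.ofReal (μ * θ) := by
    rw [m.feasible_iff hw hθ.le] at hm
    rw [ENNReal.ofReal_mul hμ0.le]
    refine le_trans ?_ (mul_le_mul_right hm _)
    rw [← lintegral_const_mul' _ _ ENNReal.ofReal_ne_top]
    refine setLIntegral_mono' measurableSet_Ioi fun u hu => ?_
    rw [← ENNReal.ofReal_mul hμ0.le]
    refine ENNReal.ofReal_le_ofReal (mul_le_mul_of_nonneg_left (hv.mono ?_) hμ0.le)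
    exact measureReal_mono fun ω hω => m.ofReal_lt_loss hθ.le hu ω hω
  have hvm := hv.cont.measurable
  have hae := ae_eq_of_ae_le_of_lintegral_le (μ := volume.restrict (Ioi (0 : ℝ)))
    (f := fun y => ENNReal.ofReal (G y)) (g := fun y => ENNReal.ofReal (μ * clampDual w (G y)))
    (Eventually.of_forall fun y => ENNReal.ofReal_le_ofReal (hμv _ (hG1 y)))
    (by rw [hrevG]; exact ENNReal.ofReal_ne_top) (by fun_prop) (by rw [hrevG]; exact hcon)
  have hval : ∀ᵐ y, y ∈ Ioi (0 : ℝ) → G y = 0 ∨ G y = p := by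
    rw [EventuallyEq, ae_restrict_iff' measurableSet_Ioi] at hae
    filter_upwards [hae] with y hy hy0
    have h1 := hy hy0
    rw [ENNReal.ofReal_eq_ofReal_iff (hG1 y).1 (mul_nonneg hμ0.le (hv.nonneg (hG1 y).1))] at h1
    rcases eq_or_lt_of_le (hG1 y).1 with h0 | h0
    · exact Or.inl h0.symm
    rcases eq_or_lt_of_le (hG1 y).2 with h2 | h2
    -- The value `1` is excluded because contact there would mean `μ = 1`.
    · rw [h2, hv.map_one] at h1
      linarith
    · exact Or.inr (huniq _ ⟨h0, h2⟩ h1.symm)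
  have hS : MeasurableSet (Ioi 0 ∩ {y | 0 < G y}) :=
    measurableSet_Ioi.inter (measurableSet_lt measurable_const hGm)
  -- The tail takes almost only the values `0` and `p`, so revenue is `p` times the length of its
  -- support. Together with `IsTail.lt_iff` this locates the jump.
  have hvol0 : volume (Ioi 0 ∩ {y | 0 < G y}) = ENNReal.ofReal (μ * θ / p) := by
    have e : ∫⁻ y in Ioi 0, ENNReal.ofReal (G y) =
        ENNReal.ofReal p * volume (Ioi 0 ∩ {y | 0 < G y}) := by
      rw [← setLIntegral_const, ← lintegral_indicator measurableSet_Ioi, ← lintegral_indicator hS]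
      refine lintegral_congr_ae ?_
      filter_upwards [hval] with y hy
      by_cases hy0 : y ∈ Ioi 0
      · rcases hy hy0 with h | h
        · rw [indicator_of_mem hy0, h, indicator_of_notMem (fun h' => by
            have : 0 < G y := h'.2
            linarith), ENNReal.ofReal_zero]
        · rw [indicator_of_mem hy0, h, indicator_of_mem
            (show y ∈ Ioi 0 ∩ {y | 0 < G y} from ⟨hy0, by rw [mem_ofPred_eq, h]; exact hp.1⟩)]
      · rw [indicator_of_notMem hy0, indicator_of_notMem (fun h' => hy0 h'.1)]
    rw [hrevG] at e
    rw [ENNReal.ofReal_div_of_pos hp.1, e, mul_comm, ENNReal.mul_div_cancel_right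
      (by simpa using hp.1) ENNReal.ofReal_ne_top]
  have hvolq : ∀ q ∈ Ico 0 p, volume (Ioi 0 ∩ {y | q < G y}) = ENNReal.ofReal (μ * θ / p) := by
    intro q hq
    rw [← hvol0]
    refine measure_congr ?_
    filter_upwards [hval] with y hy
    refine propext ⟨fun h => ⟨h.1, lt_of_le_of_lt hq.1 h.2⟩, fun h => ⟨h.1, ?_⟩⟩
    rcases hy h.1 with h1 | h1
    · have : 0 < G y := h.2
      linarith
    · rw [mem_ofPred_eq, h1]; exact hq.2
  have hvolp : volume (Ioi 0 ∩ {y | p < G y}) = 0 := by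
    rw [← measure_empty (μ := (volume : Measure ℝ))]
    refine measure_congr ?_
    filter_upwards [hval] with y hy
    refine propext ⟨fun h => ?_, fun h => h.elim⟩
    have h2 : p < G y := h.2
    rcases hy h.1 with h1 | h1
    · linarith [hp.1]
    · linarith
  intro y hy
  split_ifs with hyc
  · refine le_antisymm ?_ (le_of_forall_lt fun q hq => ?_)
    · by_contra! hlt
      have := (hGtail.lt_iff hy).1 hlt
      rw [hvolp] at this
      exact not_lt_zero this
    · rcases lt_or_ge q 0 with hq0 | hq0
      · exact hq0.trans_le (hG1 y).1
      · refine (hGtail.lt_iff hy).2 ?_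
        rw [hvolq q ⟨hq0, hq⟩]
        exact (ENNReal.ofReal_lt_ofReal_iff_of_nonneg hy).2 hyc
  · refine le_antisymm ?_ (hG1 y).1
    by_contra! hlt
    have := (hGtail.lt_iff hy).1 hlt
    rw [hvol0, ENNReal.ofReal_lt_ofReal_iff_of_nonneg hy] at this
    exact hyc this

end StaticMechanism

/-- The static problem. -/
theorem static_problem {w : ℝ → ℝ} (hw : IsWeightingFunction w) {θ : ℝ} (hθ : 0 < θ) :
    ∃ μ p : ℝ,
      IsGreatest ((fun q : ℝ => q / dualWeight w q) '' Ioc 0 1) μ ∧ 1 < μ ∧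
      p ∈ Ioo (0 : ℝ) 1 ∧ μ * dualWeight w p = p ∧
      (∀ q ∈ Ioo (0 : ℝ) 1, μ * dualWeight w q = q → q = p) ∧
      IsGreatest (StaticMechanism.revenue '' {m | m.Feasible w θ}) (ENNReal.ofReal (μ * θ)) ∧
      ∀ m : StaticMechanism, m.IsOptimal w θ ↔
        m.P {ω | m.X ω = 1} = 1 ∧
        ∀ y : ℝ, 0 ≤ y →
          m.P.real {ω | y < m.T ω} = if y < μ * θ / p then p else 0 := by
  have hv := hw.isLossWeight
  obtain ⟨μ, p, hμ, hp, hμp, hμv, huniq⟩ := hv.exists_max_ratio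
  have hμ0 : 0 < μ := by linarith
  have hIoo : ∀ q ∈ Ioo (0 : ℝ) 1, clampDual w q = dualWeight w q := fun q hq =>
    clampDual_eq w ⟨hq.1.le, hq.2.le⟩
  obtain ⟨m₁, hX₁, hT₁⟩ := StaticMechanism.exists_tail hp (div_pos (mul_pos hμ0 hθ) hp.1)
  obtain ⟨hf₁, hr₁⟩ := m₁.feasible_of_tail hw hθ hμ0 hp hμp hX₁ hT₁
  refine ⟨μ, p, ⟨⟨p, ⟨hp.1, hp.2.le⟩, ?_⟩, ?_⟩, hμ, hp, by rw [← hIoo p hp, hμp],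
    fun q hq hq' => huniq q hq (by rw [hIoo q hq, hq']), ⟨⟨m₁, hf₁, hr₁⟩, ?_⟩, fun m => ?_⟩
  · simp only
    rw [← hIoo p hp, div_eq_iff (hv.pos hp.1 hp.2.le).ne', hμp]
  · rintro _ ⟨q, hq, rfl⟩
    simp only
    rw [← clampDual_eq w ⟨hq.1.le, hq.2⟩, div_le_iff₀ (hv.pos hq.1 hq.2)]
    exact hμv q ⟨hq.1.le, hq.2⟩
  · rintro _ ⟨m, hm, rfl⟩
    exact m.revenue_le hw hθ.le hμ0.le hμv hm
  · constructor
    · rintro ⟨hm, hopt⟩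
      have hrev : m.revenue = ENNReal.ofReal (μ * θ) :=
        le_antisymm (m.revenue_le hw hθ.le hμ0.le hμv hm) (hr₁ ▸ hopt m₁ hf₁)
      obtain ⟨hX, hT⟩ := m.tail_of_revenue_eq hw hθ hμ hp hμv huniq hm hrev
      refine ⟨?_, hT⟩
      rw [← mem_ae_iff_prob_eq_one (measurableSet_eq_fun m.measurable_X measurable_const)]
      exact hX
    · rintro ⟨hX, hT⟩
      have hX' : ∀ᵐ ω ∂m.P, m.X ω = 1 :=
        (mem_ae_iff_prob_eq_one (measurableSet_eq_fun m.measurable_X measurable_const)).2 hX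
      obtain ⟨hf, hr⟩ := m.feasible_of_tail hw hθ hμ0 hp hμp hX' hT
      exact ⟨hf, fun m' hm' => hr ▸ m'.revenue_le hw hθ.le hμ0.le hμv hm'⟩

/-! ### Cumulative payment functions. -/

section RegularPayment

variable {T : ℝ → ℝ}

theorem IsRegularPayment.map_zero (hT : IsRegularPayment T) : T 0 = 0 := by
  obtain ⟨f, times, jumps, hf, ht, hj, hi, hs⟩ := hT
  have h := hs 0 le_rfl
  have e : (fun i => if times i < 0 then jumps i else 0) = fun _ => (0 : ℝ) := by
    ext i
    rw [if_neg (not_lt.2 (ht i))]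
  rw [e, intervalIntegral.integral_same, sub_zero] at h
  exact h.unique hasSum_zero

theorem IsRegularPayment.monotoneOn (hT : IsRegularPayment T) : MonotoneOn T (Ici 0) := by
  obtain ⟨f, times, jumps, hf, ht, hj, hi, hs⟩ := hT
  intro s hs0 t ht0 hst
  have hs0 : 0 ≤ s := hs0
  have ht0 : 0 ≤ t := ht0
  have h1 := hasSum_le (fun i => ?_) (hs s hs0) (hs t ht0)
  · have h2 : ∫ r in (0 : ℝ)..s, f r ≤ ∫ r in (0 : ℝ)..t, f r :=
      intervalIntegral.integral_mono_interval le_rfl hs0 hst (Eventually.of_forall hf) (hi t ht0)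
    linarith
  · split_ifs with h1 h2
    · exact le_rfl
    · exact absurd (h1.trans_le hst) h2
    · exact hj i
    · exact le_rfl

theorem IsRegularPayment.nonneg (hT : IsRegularPayment T) {t : ℝ} (ht : 0 ≤ t) : 0 ≤ T t := by
  rw [← hT.map_zero]
  exact hT.monotoneOn (show (0 : ℝ) ∈ Ici 0 from self_mem_Ici) ht ht

/-- Left continuity: a lump sum at time `t` is paid only after `t`. -/
theorem IsRegularPayment.exists_lt (hT : IsRegularPayment T) {t y : ℝ} (ht : 0 ≤ t) (hy : 0 ≤ y)
    (hyt : y < T t) : ∃ s, 0 ≤ s ∧ s < t ∧ y < T s := by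
  have ht' : 0 < t := lt_of_le_of_ne ht (by rintro rfl; rw [hT.map_zero] at hyt; linarith)
  obtain ⟨f, times, jumps, hf, htm, hj, hi, hs⟩ := hT
  set ε := T t - y with hε
  have hε0 : 0 < ε := by linarith
  have hnn : ∀ (s : ℝ) i, 0 ≤ if times i < s then jumps i else 0 := fun s i => by
    split_ifs
    · exact hj i
    · exact le_rfl
  have hsum := (hs t ht)
  -- Finitely many jumps account for all but `ε/2` of the jump part before `t`, and all of them lie
  -- before any `s` close enough to `t`; the flow loses at most another `ε/2`.
  obtain ⟨F, hF⟩ := (hsum.eventually (lt_mem_nhds (show (T t - ∫ r in (0 : ℝ)..t, f r) - ε / 2 <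
    T t - ∫ r in (0 : ℝ)..t, f r by linarith))).exists
  have hev1 : ∀ᶠ s in 𝓝[<] t, ∀ i ∈ F, times i < t → times i < s := by
    rw [Filter.eventually_all_finset]
    intro i _
    by_cases h : times i < t
    · filter_upwards [mem_nhdsWithin_of_mem_nhds (Ioi_mem_nhds h)] with s hs _
      exact hs
    · exact Eventually.of_forall fun s h' => absurd h' h
  have hcont : ContinuousOn (fun s => ∫ r in (0 : ℝ)..s, f r) (uIcc 0 t) :=
    intervalIntegral.continuousOn_primitive_interval' (hi t ht) left_mem_uIcc
  have htend : Tendsto (fun s => ∫ r in (0 : ℝ)..s, f r) (𝓝[Ico 0 t] t)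
      (𝓝 (∫ r in (0 : ℝ)..t, f r)) := by
    rw [uIcc_of_le ht] at hcont
    exact (hcont t ⟨ht, le_rfl⟩).mono_left (nhdsWithin_mono _ Ico_subset_Icc_self)
  rw [nhdsWithin_Ico_eq_nhdsLT ht'] at htend
  have hev2 := htend.eventually (lt_mem_nhds (show (∫ r in (0 : ℝ)..t, f r) - ε / 2 <
    ∫ r in (0 : ℝ)..t, f r by linarith))
  have hev3 : ∀ᶠ s in 𝓝[<] t, 0 ≤ s ∧ s < t := by
    have : Ico 0 t ∈ 𝓝[<] t := Ico_mem_nhdsLT ht'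
    exact this
  obtain ⟨s, h1, h2, h3⟩ := (hev1.and (hev2.and hev3)).exists
  refine ⟨s, h3.1, h3.2, ?_⟩
  have h4 := sum_le_hasSum F (fun i _ => hnn s i) (hs s h3.1)
  have h5 : ∑ i ∈ F, (if times i < t then jumps i else 0) ≤
      ∑ i ∈ F, if times i < s then jumps i else 0 := by
    refine Finset.sum_le_sum fun i hiF => ?_
    by_cases h : times i < t
    · rw [if_pos h, if_pos (h1 i hiF h)]
    · rw [if_neg h]; exact hnn s i
  linarith

end RegularPayment

theorem setLIntegral_Ioi_add (F : ℝ → ℝ≥0∞) (x : ℝ) :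
    ∫⁻ u in Ioi 0, F (x + u) = ∫⁻ y in Ioi x, F y := by
  rw [← lintegral_indicator measurableSet_Ioi, ← lintegral_indicator measurableSet_Ioi,
    ← lintegral_add_left_eq_self ((Ioi x).indicator F) x]
  refine lintegral_congr fun u => ?_
  simp [indicator_apply]

/-! ### From dynamic individual rationality to the relaxed constraints and back. -/

namespace DynamicProcess

/-- The payment as a function of the delivery time in `[0,∞]`. -/
noncomputable def payExt (T : ℝ → ℝ) (x : ℝ≥0∞) : ℝ≥0∞ :=
  if x = ⊤ then ⨆ (t : ℝ) (_ : 0 ≤ t), ENNReal.ofReal (T t) else ENNReal.ofReal (T x.toReal)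

theorem payExt_ofReal (T : ℝ → ℝ) {t : ℝ} (ht : 0 ≤ t) :
    payExt T (ENNReal.ofReal t) = ENNReal.ofReal (T t) := by
  simp [payExt, ht]

theorem monotone_payExt {T : ℝ → ℝ} (hT : MonotoneOn T (Ici 0)) : Monotone (payExt T) := by
  intro x y hxy
  by_cases hy : y = ⊤
  · by_cases hx : x = ⊤
    · rw [hx, hy]
    · simp only [payExt, hx, hy, if_true, if_false]
      exact le_iSup₂_of_le x.toReal ENNReal.toReal_nonneg le_rfl
  · have hx : x ≠ ⊤ := ne_top_of_le_ne_top hy hxy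
    simp only [payExt, hx, hy, if_false]
    exact ENNReal.ofReal_le_ofReal (hT (show (0 : ℝ) ≤ x.toReal from ENNReal.toReal_nonneg)
      (show (0 : ℝ) ≤ y.toReal from ENNReal.toReal_nonneg) (ENNReal.toReal_mono hy hxy))

theorem payment_eq (m : DynamicProcess) (ω : m.Ω) : m.payment ω = payExt m.T (m.τ ω) := rfl

theorem measurable_payment (m : DynamicProcess) : Measurable m.payment :=
  (monotone_payExt m.regular_T.monotoneOn).measurable.comp m.measurable_τ

theorem le_payment (m : DynamicProcess) {s : ℝ} (hs : 0 ≤ s) {ω : m.Ω}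
    (h : ENNReal.ofReal s ≤ m.τ ω) : ENNReal.ofReal (m.T s) ≤ m.payment ω := by
  rw [payment_eq, ← payExt_ofReal m.T hs]
  exact monotone_payExt m.regular_T.monotoneOn h

theorem lt_τ_of_lt_payment (m : DynamicProcess) {s y : ℝ} (hs : 0 ≤ s) (hy : m.T s ≤ y) {ω : m.Ω}
    (h : ENNReal.ofReal y < m.payment ω) : ENNReal.ofReal s < m.τ ω := by
  by_contra! hle
  refine absurd h (not_lt.2 ?_)
  have := monotone_payExt m.regular_T.monotoneOn hle
  rw [payExt_ofReal m.T hs] at this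
  exact this.trans (ENNReal.ofReal_le_ofReal hy)

/-- The loss from time `s` on relative to receiving the good for free. -/
noncomputable def loss (θ : ℝ) (m : DynamicProcess) (s : ℝ) (ω : m.Ω) : ℝ≥0∞ :=
  (if m.τ ω = ⊤ then ENNReal.ofReal θ else 0) + (m.payment ω - ENNReal.ofReal (m.T s))

theorem measurable_loss (θ : ℝ) (m : DynamicProcess) (s : ℝ) : Measurable (m.loss θ s) := by
  have h1 := m.measurable_payment
  have h2 := m.measurable_τ
  exact (Measurable.ite (h2 (measurableSet_singleton ⊤)) measurable_const measurable_const).add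
    (h1.sub measurable_const)

theorem measurableSet_lt_τ (m : DynamicProcess) (s : ℝ) :
    MeasurableSet {ω | ENNReal.ofReal s < m.τ ω} := measurableSet_lt measurable_const m.measurable_τ

theorem continuationPayoff_eq {θ : ℝ} (hθ : 0 ≤ θ) (m : DynamicProcess) {s : ℝ} (hs : 0 ≤ s)
    {ω : m.Ω} (h : ENNReal.ofReal s < m.τ ω) :
    m.continuationPayoff θ s ω = (θ : EReal) - (m.loss θ s ω : EReal) := by
  have hle := m.le_payment hs h.le
  have hTs := m.regular_T.nonneg hs
  rw [continuationPayoff, loss]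
  generalize m.payment ω = p at *
  induction p with
  | top =>
    simp only [ENNReal.top_sub ENNReal.ofReal_ne_top, add_top, EReal.coe_ennreal_top,
      EReal.top_sub_coe]
    split_ifs <;> rfl
  | coe p =>
    have hp : (p : ℝ≥0∞) - ENNReal.ofReal (m.T s) = ENNReal.ofReal (p - m.T s) := by
      rw [ENNReal.ofReal_sub _ hTs, ENNReal.ofReal_coe_nnreal]
    have hle' : m.T s ≤ p := by
      rw [← ENNReal.ofReal_coe_nnreal] at hle
      exact (ENNReal.ofReal_le_ofReal_iff p.coe_nonneg).1 hle
    have hpc : ((p : ℝ≥0∞) : EReal) = ((p : ℝ) : EReal) := rfl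
    rw [hp, hpc, ← EReal.coe_sub]
    split_ifs
    · rw [← ENNReal.ofReal_add hθ (by linarith), EReal.coe_sub_ofReal _ (by linarith),
        ← EReal.coe_zero, ← EReal.coe_sub]
      congr 1; ring
    · rw [zero_add, EReal.coe_sub_ofReal _ (by linarith), ← EReal.coe_sub]

/-- The tail probabilities of the total payment. -/
noncomputable def tail (m : DynamicProcess) (y : ℝ) : ℝ :=
  m.P.real {ω | ENNReal.ofReal y < m.payment ω}

/-- The survival function of the delivery time. -/
noncomputable def surv (m : DynamicProcess) (s : ℝ) : ℝ := m.P.real {ω | ENNReal.ofReal s < m.τ ω}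

theorem isTail_tail (m : DynamicProcess) : IsTail m.tail := isTail_measureReal m.P m.payment

theorem isTail_surv (m : DynamicProcess) : IsTail m.surv := isTail_measureReal m.P m.τ

theorem antitone_tail (m : DynamicProcess) : Antitone m.tail := fun _ _ hyy' =>
  measureReal_mono fun _ hω => lt_of_le_of_lt (ENNReal.ofReal_le_ofReal hyy') hω

theorem antitone_surv (m : DynamicProcess) : Antitone m.surv := fun _ _ hyy' =>
  measureReal_mono fun _ hω => lt_of_le_of_lt (ENNReal.ofReal_le_ofReal hyy') hω

theorem tail_mem (m : DynamicProcess) (y : ℝ) : m.tail y ∈ Icc (0 : ℝ) 1 :=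
  ⟨measureReal_nonneg, measureReal_le_one⟩

theorem revenue_eq_tail (m : DynamicProcess) :
    m.revenue = ∫⁻ y in Ioi 0, ENNReal.ofReal (m.tail y) := by
  rw [revenue]
  exact lintegral_congr fun y => by rw [tail, ofReal_measureReal]

variable {w : ℝ → ℝ} {θ : ℝ}

theorem dir_iff (hw : IsWeightingFunction w) (hθ : 0 ≤ θ) (m : DynamicProcess) :
    m.DIR w θ ↔ ∀ s : ℝ, 0 ≤ s → 0 < m.surv s → ∫⁻ u in Ioi (0 : ℝ),
      ENNReal.ofReal (clampDual w (m.P.real ({ω | ENNReal.ofReal s < m.τ ω} ∩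
        {ω | ENNReal.ofReal u < m.loss θ s ω}) / m.surv s)) ≤ ENNReal.ofReal θ := by
  refine forall_congr' fun s => forall_congr' fun hs => ?_
  have hA := m.measurableSet_lt_τ s
  have hpos : 0 < m.P {ω | ENNReal.ofReal s < m.τ ω} ↔ 0 < m.surv s := by
    rw [surv, Measure.real, ENNReal.toReal_pos_iff]
    simp [measure_lt_top]
  rw [hpos]
  refine forall_congr' fun h0 => ?_
  have hprob : IsProbabilityMeasure (ProbabilityTheory.cond m.P {ω | ENNReal.ofReal s < m.τ ω}) :=
    cond_isProbabilityMeasure (hpos.2 h0).ne'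
  rw [zero_le_rdeu_iff hw _ (m.measurable_loss θ s) hθ]
  · have e : ∀ u : ℝ, (ProbabilityTheory.cond m.P {ω | ENNReal.ofReal s < m.τ ω}).real
        {ω | ENNReal.ofReal u < m.loss θ s ω} = m.P.real ({ω | ENNReal.ofReal s < m.τ ω} ∩
        {ω | ENNReal.ofReal u < m.loss θ s ω}) / m.surv s := fun u => by
      rw [Measure.real, cond_apply hA, ENNReal.toReal_mul, ENNReal.toReal_inv, surv, div_eq_inv_mul]
      rfl
    simp only [e]
  · filter_upwards [ae_cond_mem hA] with ω hω
    exact m.continuationPayoff_eq hθ hs hω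

/-- Payments beyond `T(s)` are made only if `τ > s`, so the conditional tail is a quotient. Dropping
the risk of nondelivery only lowers the loss. -/
theorem surv_pos_bound (hw : IsWeightingFunction w) (hθ : 0 ≤ θ) (m : DynamicProcess)
    (hm : m.DIR w θ) {s : ℝ} (hs : 0 ≤ s) (hs0 : 0 < m.surv s) :
    ∫⁻ y in Ioi (m.T s), ENNReal.ofReal (clampDual w (m.tail y / m.surv s)) ≤ ENNReal.ofReal θ := by
  refine le_trans ?_ ((m.dir_iff hw hθ).1 hm s hs hs0)
  rw [← setLIntegral_Ioi_add _ (m.T s)]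
  refine setLIntegral_mono' measurableSet_Ioi fun u hu => ENNReal.ofReal_le_ofReal
    (hw.isLossWeight.mono (div_le_div_of_nonneg_right (measureReal_mono ?_) hs0.le))
  have hu : 0 < u := hu
  intro ω hω
  have hω : ENNReal.ofReal (m.T s + u) < m.payment ω := hω
  refine ⟨m.lt_τ_of_lt_payment hs (by linarith) hω, ?_⟩
  rw [ENNReal.ofReal_add (m.regular_T.nonneg hs) hu.le] at hω
  exact (lt_tsub_iff_left.2 hω).trans_le le_add_self

/-- Let `s₀` be the first time at which the survival probability is at most `q = e^{-t}`; right
continuity gives `surv s₀ ≤ q`. Left continuity of `T` shows that levels with tail at most `q` lie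
above `T(s₀)`, and dividing by `q` instead of `surv s₀` only lowers the integrand, so the DIR
condition at `s₀` suffices. If survival always exceeds `q`, a level with tail at most `q` is never
exceeded and contributes nothing. -/
theorem tailConstraint_le (hw : IsWeightingFunction w) (hθ : 0 ≤ θ) (m : DynamicProcess)
    (hm : m.DIR w θ) (t : ℝ) :
    tailConstraint (clampDual w) m.tail t ≤ ENNReal.ofReal θ := by
  have hv := hw.isLossWeight
  set q := Real.exp (-t) with hq
  have hq0 : 0 < q := Real.exp_pos _
  have hqt : Real.exp t = q⁻¹ := by rw [hq, Real.exp_neg, inv_inv]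
  by_cases hne : ∃ s, 0 ≤ s ∧ m.surv s ≤ q
  · set S : Set ℝ := {s | 0 ≤ s ∧ m.surv s ≤ q} with hS
    have hbdd : BddBelow S := ⟨0, fun s hs => hs.1⟩
    set s₀ := sInf S with hs₀
    have hs₀0 : 0 ≤ s₀ := le_csInf hne fun s hs => hs.1
    have hs₀q : m.surv s₀ ≤ q := by
      by_contra! hlt
      obtain ⟨ε, hε, hlt2⟩ := m.isTail_surv.right s₀ hs₀0 q hlt
      obtain ⟨s, hs, hs2⟩ := exists_lt_of_csInf_lt hne (show s₀ < s₀ + ε by linarith)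
      exact absurd (m.antitone_surv hs2.le) (not_le.2 (hs.2.trans_lt hlt2))
    have hyT : ∀ y, 0 < y → m.tail y ≤ q → m.T s₀ ≤ y := by
      intro y hy hyq
      by_contra! hlt
      obtain ⟨s, hs, hs2, hs3⟩ := m.regular_T.exists_lt hs₀0 hy.le hlt
      have h1 : q < m.surv s := by
        by_contra! hle
        exact absurd (csInf_le hbdd (show s ∈ S from ⟨hs, hle⟩)) (not_le.2 hs2)
      have h2 : m.surv s ≤ m.tail y := measureReal_mono fun ω hω =>
        lt_of_lt_of_le ((ENNReal.ofReal_lt_ofReal_iff_of_nonneg hy.le).2 hs3)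
          (m.le_payment hs (le_of_lt hω))
      linarith
    have hle : m.tail (m.T s₀) ≤ m.surv s₀ := measureReal_mono fun ω hω =>
      m.lt_τ_of_lt_payment hs₀0 le_rfl hω
    have hsn : 0 ≤ m.surv s₀ := measureReal_nonneg
    have key : tailConstraint (clampDual w) m.tail t ≤
        ∫⁻ y in Ioi (m.T s₀), ENNReal.ofReal (clampDual w (m.tail y / m.surv s₀)) := by
      rw [tailConstraint, ← lintegral_indicator measurableSet_Ioi,
        ← lintegral_indicator measurableSet_Ioi]
      refine lintegral_mono_ae ?_
      filter_upwards [show ∀ᵐ y : ℝ, y ≠ m.T s₀ by simp [ae_iff, measure_singleton]] with y hyne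
      by_cases hy : 0 < y
      · rw [indicator_of_mem (show y ∈ Ioi 0 from hy)]
        split_ifs with hyq
        · have hyT' := lt_of_le_of_ne (hyT y hy hyq) (Ne.symm hyne)
          rw [indicator_of_mem (show y ∈ Ioi (m.T s₀) from hyT'), hqt, ← div_eq_mul_inv]
          refine ENNReal.ofReal_le_ofReal (hv.mono ?_)
          rcases eq_or_lt_of_le hsn with h0 | h0
          · have : m.tail y = 0 :=
              le_antisymm ((m.antitone_tail hyT'.le).trans (hle.trans h0.ge)) (m.tail_mem y).1
            simp [this]
          · exact div_le_div_of_nonneg_left (m.tail_mem y).1 h0 hs₀q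
        · exact zero_le
      · rw [indicator_of_notMem (show y ∉ Ioi 0 from hy)]
        exact zero_le
    refine key.trans ?_
    rcases eq_or_lt_of_le hsn with h0 | h0
    · simp [← h0, hv.map_zero]
    · exact m.surv_pos_bound hw hθ hm hs₀0 h0
  · push Not at hne
    have : tailConstraint (clampDual w) m.tail t = 0 := by
      rw [tailConstraint]
      refine (setLIntegral_congr_fun measurableSet_Ioi fun y hy => ?_).trans lintegral_zero
      have hy : 0 < y := hy
      split_ifs with hyq
      · have hle : ∀ s, 0 ≤ s → m.T s ≤ y := by
          intro s hs
          by_contra! hlt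
          have h2 : m.surv s ≤ m.tail y := measureReal_mono fun ω hω =>
            lt_of_lt_of_le ((ENNReal.ofReal_lt_ofReal_iff_of_nonneg hy.le).2 hlt)
              (m.le_payment hs (le_of_lt hω))
          linarith [hne s hs]
        have h0 : m.tail y = 0 := by
          rw [tail]
          have : {ω | ENNReal.ofReal y < m.payment ω} = ∅ := by
            ext ω
            simp only [mem_ofPred_eq, mem_empty_iff_false, iff_false, not_lt, payment]
            split_ifs
            · exact iSup₂_le fun s hs => ENNReal.ofReal_le_ofReal (hle s hs)
            · exact ENNReal.ofReal_le_ofReal (hle _ ENNReal.toReal_nonneg)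
          rw [this, measureReal_empty]
        simp [h0, hv.map_zero]
      · rfl
    rw [this]
    exact zero_le

theorem isRelaxedFeasible (hw : IsWeightingFunction w) (hθ : 0 ≤ θ) (m : DynamicProcess)
    (hm : m.DIR w θ) : IsRelaxedFeasible (clampDual w) θ m.tail where
  measurable := m.antitone_tail.measurable
  mem := m.tail_mem
  le := fun t _ => m.tailConstraint_le hw hθ hm t

/-- For processes with sure delivery the relaxed constraints suffice. -/
theorem dir_of_relaxed (hw : IsWeightingFunction w) (hθ : 0 ≤ θ) (m : DynamicProcess)
    (hτ : ∀ᵐ ω ∂m.P, m.τ ω < ⊤)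
    (hF : ∀ t, 0 ≤ t → tailConstraint (clampDual w) m.tail t ≤ ENNReal.ofReal θ) :
    m.DIR w θ := by
  have hv := hw.isLossWeight
  rw [m.dir_iff hw hθ]
  intro s hs hs0
  have hT0 := m.regular_T.nonneg hs
  have h1 : ∫⁻ u in Ioi (0 : ℝ),
      ENNReal.ofReal (clampDual w (m.P.real ({ω | ENNReal.ofReal s < m.τ ω} ∩
        {ω | ENNReal.ofReal u < m.loss θ s ω}) / m.surv s)) ≤
      ∫⁻ y in Ioi (m.T s), ENNReal.ofReal (clampDual w (m.tail y / m.surv s)) := by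
    rw [← setLIntegral_Ioi_add _ (m.T s)]
    refine setLIntegral_mono' measurableSet_Ioi fun u hu => ENNReal.ofReal_le_ofReal
      (hv.mono (div_le_div_of_nonneg_right ?_ hs0.le))
    have hu : 0 < u := hu
    refine ENNReal.toReal_mono (measure_ne_top _ _) (measure_mono_ae ?_)
    filter_upwards [hτ] with ω hω hω2
    have hω3 : ENNReal.ofReal u < m.loss θ s ω := hω2.2
    rw [loss, if_neg hω.ne, zero_add] at hω3
    change ENNReal.ofReal (m.T s + u) < m.payment ω
    rw [ENNReal.ofReal_add hT0 hu.le]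
    exact lt_tsub_iff_left.1 hω3
  refine h1.trans ?_
  have hle : m.tail (m.T s) ≤ m.surv s := measureReal_mono fun ω hω =>
    m.lt_τ_of_lt_payment hs le_rfl hω
  rcases eq_or_lt_of_le (m.tail_mem (m.T s)).1 with h0 | h0
  · have : ∫⁻ y in Ioi (m.T s), ENNReal.ofReal (clampDual w (m.tail y / m.surv s)) = 0 := by
      refine (setLIntegral_congr_fun measurableSet_Ioi fun y hy => ?_).trans lintegral_zero
      have hy : m.T s < y := hy
      have : m.tail y = 0 := le_antisymm ((m.antitone_tail hy.le).trans h0.ge) (m.tail_mem y).1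
      simp [this, hv.map_zero]
    rw [this]
    exact zero_le
  -- The relaxed constraint is used at the probability of paying more than `T(s)`, not at the
  -- survival probability: the former is the smaller divisor, and every level above `T(s)` passes
  -- its cutoff.
  · refine le_trans ?_ (hF (-Real.log (m.tail (m.T s))) ?_)
    · rw [tailConstraint, ← lintegral_indicator measurableSet_Ioi,
        ← lintegral_indicator measurableSet_Ioi]
      refine lintegral_mono fun y => ?_
      by_cases hy : m.T s < y
      · rw [indicator_of_mem (show y ∈ Ioi (m.T s) from hy), indicator_of_mem
          (show y ∈ Ioi 0 from hT0.trans_lt hy), neg_neg, Real.exp_neg, Real.exp_log h0,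
          if_pos (m.antitone_tail hy.le), ← div_eq_mul_inv]
        exact ENNReal.ofReal_le_ofReal (hv.mono
          (div_le_div_of_nonneg_left (m.tail_mem y).1 h0 hle))
      · rw [indicator_of_notMem (show y ∉ Ioi (m.T s) from hy)]
        exact zero_le
    · have := Real.log_nonpos h0.le (m.tail_mem (m.T s)).2
      linarith

/-- If the participation constraint at time zero binds even without the risk of never receiving
the good, then delivery is certain. -/
theorem τ_lt_top_of_tight (hw : IsWeightingFunction w) (hθ : 0 < θ) (m : DynamicProcess)
    (hm : m.DIR w θ)
    (htight : ∫⁻ y in Ioi 0, ENNReal.ofReal (clampDual w (m.tail y)) = ENNReal.ofReal θ) :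
    ∀ᵐ ω ∂m.P, m.τ ω < ⊤ := by
  have hv := hw.isLossWeight
  have hvm := hv.cont.measurable
  rw [ae_iff]
  simp only [not_lt, top_le_iff]
  by_contra hne
  have hT0 := m.regular_T.map_zero
  set c := m.P.real {ω | m.τ ω = ⊤} with hc
  have hc0 : 0 < c := ENNReal.toReal_pos hne (measure_ne_top _ _)
  have hcS : c ≤ m.surv 0 := measureReal_mono fun ω hω => by
    have hω : m.τ ω = ⊤ := hω
    simp [hω]
  have hS0 : 0 < m.surv 0 := hc0.trans_le hcS
  have hS1 : m.surv 0 ≤ 1 := measureReal_le_one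
  set M : ℝ≥0∞ := ⨆ (t : ℝ) (_ : 0 ≤ t), ENNReal.ofReal (m.T t) with hM
  have hpayM : ∀ ω, m.τ ω = ⊤ → m.payment ω = M := fun ω hω => by simp [payment, hω, hM]
  -- Otherwise every level is exceeded with probability at least `c`, and the integral in the
  -- constraint diverges.
  have hMtop : M ≠ ⊤ := by
    intro hMt
    have hge : ∀ y, c ≤ m.tail y := fun y => measureReal_mono fun ω hω => by
      change ENNReal.ofReal y < m.payment ω
      rw [hpayM ω hω, hMt]
      exact ENNReal.ofReal_lt_top
    have : ∫⁻ y in Ioi (0 : ℝ), ENNReal.ofReal (clampDual w c) ≤ ENNReal.ofReal θ := by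
      rw [← htight]
      exact lintegral_mono fun y => ENNReal.ofReal_le_ofReal (hv.mono (hge y))
    rw [setLIntegral_const, Real.volume_Ioi, ENNReal.mul_top] at this
    · exact absurd this (by simp)
    · simpa using hv.pos hc0 measureReal_le_one
  set H : ℝ → ℝ := fun u => m.P.real {ω | ENNReal.ofReal u < m.loss θ 0 ω} with hH
  have hHanti : Antitone H := fun _ _ hyy' =>
    measureReal_mono fun _ hω => lt_of_le_of_lt (ENNReal.ofReal_le_ofReal hyy') hω
  have hloss : ∀ ω, m.payment ω ≤ m.loss θ 0 ω := fun ω => by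
    rw [loss, hT0, ENNReal.ofReal_zero, tsub_zero]
    exact le_add_self
  have htH : ∀ u, m.tail u ≤ H u := fun u => measureReal_mono fun ω hω =>
    lt_of_lt_of_le hω (hloss ω)
  have hHle : ∫⁻ u in Ioi 0, ENNReal.ofReal (clampDual w (H u)) ≤ ENNReal.ofReal θ := by
    refine le_trans ?_ ((m.dir_iff hw hθ.le).1 hm 0 le_rfl hS0)
    refine setLIntegral_mono' measurableSet_Ioi fun u hu => ENNReal.ofReal_le_ofReal (hv.mono ?_)
    have hu : 0 < u := hu
    -- A positive loss requires `τ > 0`, so conditioning on `τ > 0` only divides by a number at most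
    -- one.
    have hsub : {ω | ENNReal.ofReal u < m.loss θ 0 ω} ⊆ {ω | ENNReal.ofReal 0 < m.τ ω} := by
      intro ω hω
      have hω : ENNReal.ofReal u < m.loss θ 0 ω := hω
      change ENNReal.ofReal 0 < m.τ ω
      by_contra! hle
      have hτ0 : m.τ ω = 0 := by simpa using hle
      have hp0 : m.payment ω = 0 := by simp [payment, hτ0, hT0]
      rw [loss, hp0, hτ0] at hω
      simp at hω
    rw [inter_eq_right.2 hsub]
    rw [le_div_iff₀ hS0]
    exact mul_le_of_le_one_right measureReal_nonneg hS1
  have hae := ae_eq_of_ae_le_of_lintegral_le (μ := volume.restrict (Ioi (0 : ℝ)))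
    (f := fun y => ENNReal.ofReal (clampDual w (m.tail y)))
    (g := fun y => ENNReal.ofReal (clampDual w (H y)))
    (Eventually.of_forall fun y => ENNReal.ofReal_le_ofReal (hv.mono (htH y)))
    (by rw [htight]; exact ENNReal.ofReal_ne_top)
    (by have := hHanti.measurable; fun_prop) (by rw [htight]; exact hHle)
  rw [EventuallyEq, ae_restrict_iff' measurableSet_Ioi] at hae
  have hMr : 0 ≤ M.toReal := ENNReal.toReal_nonneg
  -- At levels between `M` and `M + θ` the undelivered paths have stopped paying but still count as
  -- losses. There the tail of the loss exceeds that of the payment by at least `c`, although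
  -- binding forces the two to agree almost everywhere.
  have hvol : volume (Ioo M.toReal (M.toReal + θ)) ≠ 0 := by
    rw [Real.volume_Ioo]; simpa using hθ
  obtain ⟨u, hu, hu2⟩ := nonempty_of_measure_ne_zero (μ := volume)
    (s := Ioo M.toReal (M.toReal + θ) ∩ {y | y ∈ Ioi (0 : ℝ) →
      ENNReal.ofReal (clampDual w (m.tail y)) = ENNReal.ofReal (clampDual w (H y))}) (by
        rwa [measure_inter_conull]
        exact hae)
  have hu0 : 0 < u := hMr.trans_lt hu.1
  have h1 := hu2 hu0
  rw [ENNReal.ofReal_eq_ofReal_iff (hv.nonneg (m.tail_mem u).1) (hv.nonneg measureReal_nonneg)] at h1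
  have h2 := hv.injOn (m.tail_mem u) ⟨measureReal_nonneg, measureReal_le_one⟩ h1
  have hMu : M < ENNReal.ofReal u := by
    rw [← ENNReal.ofReal_toReal hMtop, ENNReal.ofReal_lt_ofReal_iff hu0]
    exact hu.1
  have hdisj : Disjoint {ω | ENNReal.ofReal u < m.payment ω} {ω | m.τ ω = ⊤} := by
    rw [Set.disjoint_left]
    intro ω hω hω2
    have hω : ENNReal.ofReal u < m.payment ω := hω
    rw [hpayM ω hω2] at hω
    exact lt_asymm hω hMu
  have h3 : m.tail u + c ≤ H u := by
    rw [tail, hc, ← measureReal_union hdisj (m.measurable_τ (measurableSet_singleton ⊤))]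
    refine measureReal_mono (union_subset (fun ω hω => lt_of_lt_of_le hω (hloss ω)) fun ω hω => ?_)
    have hω : m.τ ω = ⊤ := hω
    change ENNReal.ofReal u < m.loss θ 0 ω
    rw [loss, hT0, ENNReal.ofReal_zero, tsub_zero, hpayM ω hω, if_pos hω]
    calc ENNReal.ofReal u < ENNReal.ofReal (M.toReal + θ) :=
          (ENNReal.ofReal_lt_ofReal_iff_of_nonneg hu0.le).2 hu.2
      _ = ENNReal.ofReal θ + M := by
          rw [ENNReal.ofReal_add hMr hθ.le, ENNReal.ofReal_toReal hMtop, add_comm]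
  linarith

end DynamicProcess

/-! ### The candidate process. -/

/-- The flow payment of the optimal process, per unit of value. -/
noncomputable def optimalFlow (v₁ : ℝ → ℝ) (a t₀ s : ℝ) : ℝ := renewalDensity v₁ a (t₀ - s)

namespace IsLossWeight

variable {v v₁ v₂ : ℝ → ℝ} {a t₀ θ : ℝ}

theorem optimalFlow_nonneg (v₁ : ℝ → ℝ) (a t₀ s : ℝ) : 0 ≤ optimalFlow v₁ a t₀ s :=
  renewalDensity_nonneg _ _ _

theorem optimalFlow_eq_zero (v₁ : ℝ → ℝ) (a : ℝ) {t₀ s : ℝ} (hs : t₀ ≤ s) :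
    optimalFlow v₁ a t₀ s = 0 := by
  rw [optimalFlow, renewalDensity, renewal_zero v₁ a _ (by linarith), ENNReal.toReal_zero]

theorem integrable_optimalFlow (h : IsLossWeight v v₁ v₂) (ha : 0 < a) (t₀ : ℝ) :
    Integrable (optimalFlow v₁ a t₀) :=
  (h.integrable_renewalDensity ha).comp_sub_left t₀

theorem intervalIntegrable_optimalFlow (h : IsLossWeight v v₁ v₂) (ha : 0 < a) (t₀ x y : ℝ) :
    IntervalIntegrable (optimalFlow v₁ a t₀) volume x y :=
  (h.integrable_optimalFlow ha t₀).intervalIntegrable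

/-- The renewal density dominates `κ`, which vanishes at most once by `deriv_zero_unique`. Hence
cumulative payments strictly increase up to `t₀`, and payment levels correspond to times. -/
theorem integral_optimalFlow_pos (h : IsLossWeight v v₁ v₂) (ht₀ : t₀ ∈ Ioc 0 a) {s t : ℝ}
    (hs : 0 ≤ s) (hst : s < t) (ht : t ≤ t₀) : 0 < ∫ r in s..t, optimalFlow v₁ a t₀ r := by
  have ha : 0 < a := ht₀.1.trans_le ht₀.2
  rw [intervalIntegral.integral_pos_iff_support_of_nonneg_ae'
    (Eventually.of_forall fun r => optimalFlow_nonneg _ _ _ _)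
    (h.intervalIntegrable_optimalFlow ha t₀ s t)]
  refine ⟨hst, ?_⟩
  set Z : Set ℝ := {r ∈ Ioo s t | v₁ (Real.exp (-(t₀ - r))) = 0} with hZ
  have hZ0 : volume Z = 0 := by
    have : Z.Subsingleton := by
      intro x hx y hy
      have := h.deriv_zero_unique (exp_neg_mem (show 0 < t₀ - x by linarith [hx.1.2]))
        (exp_neg_mem (show 0 < t₀ - y by linarith [hy.1.2])) hx.2 hy.2
      have := Real.exp_injective this
      linarith
    exact this.measure_zero _
  have hsub : Ioo s t \ Z ⊆ Function.support (optimalFlow v₁ a t₀) ∩ Ioc s t := by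
    rintro r ⟨hr, hrZ⟩
    refine ⟨?_, hr.1, hr.2.le⟩
    have hm : t₀ - r ∈ Ioc 0 a := ⟨by linarith [hr.2], by linarith [hr.1, ht₀.2]⟩
    have h1 := h.le_renewalDensity ha hm
    have h2 : 0 < v₁ (Real.exp (-(t₀ - r))) :=
      lt_of_le_of_ne (h.deriv_nonneg (exp_neg_mem hm.1)) fun he => hrZ ⟨hr, he.symm⟩
    have h3 := mul_pos h2 (Real.exp_pos (-(t₀ - r)))
    exact (h3.trans_le h1).ne'
  refine lt_of_lt_of_le ?_ (measure_mono hsub)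
  rw [measure_sdiff_null hZ0, Real.volume_Ioo]
  simpa using hst

/-- Time reversal `s ↦ t₀ - s` turns the flow equation into `K + K⋆R = 1` at `t₀ - t`. -/
theorem flow_eq (h : IsLossWeight v v₁ v₂) (ht₀ : t₀ ∈ Ioc 0 a) {t : ℝ} (ht : t ∈ Icc 0 t₀) :
    IntervalIntegrable (fun s => v (Real.exp (-s + t)) * optimalFlow v₁ a t₀ s) volume t t₀ ∧
      v (Real.exp (-t₀ + t)) + ∫ s in t..t₀, v (Real.exp (-s + t)) * optimalFlow v₁ a t₀ s = 1 := by
  have ha : 0 < a := ht₀.1.trans_le ht₀.2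
  obtain ⟨h1, h2⟩ := h.flow_identity ha (t := t₀ - t) ⟨by linarith [ht.2], by linarith [ht.1, ht₀.2]⟩
  set F : ℝ → ℝ := fun u => v (Real.exp (-(t₀ - t - u))) * renewalDensity v₁ a u with hF
  have e : ∀ s, v (Real.exp (-s + t)) * optimalFlow v₁ a t₀ s = F (t₀ - s) := fun s => by
    simp only [hF, optimalFlow]
    congr 3
    ring
  simp only [e]
  constructor
  · have := (h1.comp_sub_left t₀).symm
    simpa using this
  · rw [intervalIntegral.integral_comp_sub_left F t₀, sub_self, ← h2]
    congr 3
    ring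

theorem flow_unique (h : IsLossWeight v v₁ v₂) (ht₀ : t₀ ∈ Ioc 0 a) {φ : ℝ → ℝ}
    (hφ : SolvesFlowEq v t₀ φ) : φ =ᵐ[volume.restrict (Icc 0 t₀)] optimalFlow v₁ a t₀ := by
  have ha : 0 < a := ht₀.1.trans_le ht₀.2
  have hv := h.cont
  set D : ℝ → ℝ := fun u => φ (t₀ - u) - renewalDensity v₁ a u with hD
  have hφi : IntervalIntegrable φ volume 0 t₀ :=
    (intervalIntegrable_iff_integrableOn_Icc_of_le ht₀.1.le).2 hφ.1
  have hφi' : IntervalIntegrable (fun u => φ (t₀ - u)) volume 0 t₀ := by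
    have := (hφi.comp_sub_left t₀).symm
    simpa using this
  have hDi : IntegrableOn D (Icc 0 t₀) :=
    ((intervalIntegrable_iff_integrableOn_Icc_of_le ht₀.1.le).1 hφi').sub
      (h.integrable_renewalDensity ha).integrableOn
  have h0 := h.ae_eq_zero_of_volterra ha ⟨ht₀.1.le, ht₀.2⟩ hDi fun u hu => by
    obtain ⟨h1, h2⟩ := h.flow_identity ha (t := u) ⟨hu.1, hu.2.trans ht₀.2⟩
    have h3 := hφ.2 (t₀ - u) ⟨by linarith [hu.2], by linarith [hu.1]⟩
    have hsubset : uIcc 0 u ⊆ uIcc 0 t₀ := by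
      rw [uIcc_of_le hu.1, uIcc_of_le ht₀.1.le]; exact Icc_subset_Icc_right hu.2
    have h4 : IntervalIntegrable (fun s => v (Real.exp (-(u - s))) * φ (t₀ - s)) volume 0 u :=
      (hφi'.mono_set hsubset).continuousOn_mul (by fun_prop)
    have e : ∫ s in (t₀ - u)..t₀, v (Real.exp (-s + (t₀ - u))) * φ s =
        ∫ s in (0 : ℝ)..u, v (Real.exp (-(u - s))) * φ (t₀ - s) := by
      have := intervalIntegral.integral_comp_sub_left (a := 0) (b := u)
        (fun s => v (Real.exp (-s + (t₀ - u))) * φ s) t₀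
      rw [sub_zero] at this
      rw [← this]
      refine intervalIntegral.integral_congr fun s _ => ?_
      congr 3
      ring
    rw [e, show -t₀ + (t₀ - u) = -u by ring] at h3
    have e2 : (fun s => v (Real.exp (-(u - s))) * D s) = fun s =>
        v (Real.exp (-(u - s))) * φ (t₀ - s) - v (Real.exp (-(u - s))) * renewalDensity v₁ a s := by
      ext s; simp only [hD]; ring
    rw [e2, intervalIntegral.integral_sub h4 h1]
    linarith
  rw [EventuallyEq, ae_restrict_iff' measurableSet_Icc] at h0 ⊢
  have hmp := (Measure.measurePreserving_sub_left (volume : Measure ℝ) t₀).quasiMeasurePreserving.ae h0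
  filter_upwards [hmp] with x hx hxm
  have := hx ⟨by linarith [hxm.2], by linarith [hxm.1]⟩
  simp only [hD, sub_sub_cancel, Pi.zero_apply] at this
  rw [optimalFlow]
  linarith

theorem paymentFunction_of_le {θ t₀ : ℝ} {f : ℝ → ℝ} {t : ℝ} (ht : t ≤ t₀) :
    paymentFunction θ t₀ f t = θ * ∫ s in (0 : ℝ)..t, f s := by
  rw [paymentFunction, if_neg (not_lt.2 ht), min_eq_left ht, zero_add]

theorem paymentFunction_of_lt {θ t₀ : ℝ} {f : ℝ → ℝ} {t : ℝ} (ht : t₀ < t) :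
    paymentFunction θ t₀ f t = θ + θ * ∫ s in (0 : ℝ)..t₀, f s := by
  rw [paymentFunction, if_pos ht, min_eq_right ht.le, mul_add, mul_one]

theorem isRegularPayment_paymentFunction (h : IsLossWeight v v₁ v₂) (ha : 0 < a) (ht₀ : 0 < t₀)
    (hθ : 0 ≤ θ) : IsRegularPayment (paymentFunction θ t₀ (optimalFlow v₁ a t₀)) := by
  have hi := h.intervalIntegrable_optimalFlow ha t₀
  -- One lump sum `θ` at `t₀`; the remaining indices of the family carry zero jumps.
  refine ⟨fun s => θ * optimalFlow v₁ a t₀ s, fun _ => t₀, fun i => if i = 0 then θ else 0,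
    fun r => mul_nonneg hθ (optimalFlow_nonneg _ _ _ _), fun _ => ht₀.le,
    fun i => by dsimp only; split_ifs <;> simp [hθ], fun t _ => (hi 0 t).const_mul θ, fun t ht => ?_⟩
  rw [intervalIntegral.integral_const_mul]
  rcases le_or_gt t t₀ with htt | htt
  · rw [paymentFunction_of_le htt, sub_self]
    simp only [not_lt.2 htt, if_false]
    exact hasSum_zero
  · have hz : ∫ s in t₀..t, optimalFlow v₁ a t₀ s = 0 := by
      rw [intervalIntegral.integral_of_le htt.le]
      exact setIntegral_eq_zero_of_forall_eq_zero fun s hs => optimalFlow_eq_zero _ _ hs.1.le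
    rw [paymentFunction_of_lt htt, ← intervalIntegral.integral_add_adjacent_intervals (hi 0 t₀)
      (hi t₀ t), hz, add_zero, add_sub_cancel_right]
    simp only [htt, if_true]
    exact hasSum_ite_eq 0 θ

end IsLossWeight

theorem expMeasure_Ioi {t : ℝ} (ht : 0 ≤ t) :
    expMeasure 1 (Ioi t) = ENNReal.ofReal (Real.exp (-t)) := by
  have := isProbabilityMeasure_expMeasure one_pos
  have h1 : (expMeasure 1).real (Iic t) = 1 - Real.exp (-t) := by
    rw [← cdf_eq_real, cdf_expMeasure_eq one_pos, if_pos ht, one_mul]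
  rw [← compl_Iic, ← ofReal_measureReal, probReal_compl_eq_one_sub measurableSet_Iic, h1]
  congr 1
  ring

theorem exists_exponential_process {T : ℝ → ℝ} (hT : IsRegularPayment T) :
    ∃ m : DynamicProcess, m.HasExponentialTime ∧ m.T = T := by
  have hprob := isProbabilityMeasure_expMeasure one_pos
  have e : ∀ t : ℝ, 0 ≤ t → {ω : ℝ | ENNReal.ofReal t < ENNReal.ofReal ω} = Ioi t := fun t ht => by
    ext ω
    exact ENNReal.ofReal_lt_ofReal_iff_of_nonneg ht
  refine ⟨{ Ω := ℝ, P := expMeasure 1, τ := fun ω => ENNReal.ofReal ω,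
            measurable_τ := by fun_prop, regular_τ := ?_, T := T, regular_T := hT },
    fun t ht => ?_, rfl⟩
  · refine ⟨fun r => Real.exp (-r), fun _ => 0, fun _ => 0, fun r => (Real.exp_pos _).le,
      fun _ => le_rfl, fun _ => le_rfl, fun t _ => (by fun_prop : Continuous fun r : ℝ =>
      Real.exp (-r)).intervalIntegrable _ _, fun t ht => ?_⟩
    have h1 : {ω : ℝ | ENNReal.ofReal ω ≤ ENNReal.ofReal t} = (Ioi t)ᶜ := by
      rw [← e t ht]
      ext ω
      simp
    have h2 : (expMeasure 1).real (Ioi t) = Real.exp (-t) := by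
      rw [Measure.real, expMeasure_Ioi ht, ENNReal.toReal_ofReal (Real.exp_pos _).le]
    dsimp only
    rw [h1, probReal_compl_eq_one_sub measurableSet_Ioi, h2]
    simp
  · simp only
    rw [e t ht, expMeasure_Ioi ht]

namespace DynamicProcess

variable {v v₁ v₂ : ℝ → ℝ} {a t₀ θ : ℝ} {m : DynamicProcess}

theorem HasExponentialTime.surv_eq (hm : m.HasExponentialTime) {t : ℝ} (ht : 0 ≤ t) :
    m.surv t = Real.exp (-t) := by
  rw [surv, Measure.real, hm t ht, ENNReal.toReal_ofReal (Real.exp_pos _).le]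

theorem HasExponentialTime.τ_lt_top (hm : m.HasExponentialTime) : ∀ᵐ ω ∂m.P, m.τ ω < ⊤ := by
  rw [ae_iff]
  simp only [not_lt, top_le_iff]
  have hlim : Tendsto (fun t : ℝ => ENNReal.ofReal (Real.exp (-t))) atTop (𝓝 0) := by
    have := ENNReal.tendsto_ofReal Real.tendsto_exp_neg_atTop_nhds_zero
    simpa using this
  refine le_antisymm (ge_of_tendsto hlim ?_) zero_le
  filter_upwards [eventually_ge_atTop 0] with t ht
  rw [← hm t ht]
  refine measure_mono fun ω hω => ?_
  have hω : m.τ ω = ⊤ := hω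
  simp [hω]

theorem HasExponentialTime.tail_eq (hm : m.HasExponentialTime) {t y : ℝ} (ht : 0 ≤ t) (hy : 0 ≤ y)
    (hTy : m.T t ≤ y) (hlt : ∀ s, t < s → y < m.T s) : m.tail y = Real.exp (-t) := by
  rw [← hm.surv_eq ht, tail, surv]
  congr 1
  ext ω
  refine ⟨m.lt_τ_of_lt_payment ht hTy, fun hω => ?_⟩
  have hω : ENNReal.ofReal t < m.τ ω := hω
  obtain ⟨r, hr0, hr1, hr2⟩ := ENNReal.lt_iff_exists_real_btwn.1 hω
  have htr : t < r := (ENNReal.ofReal_lt_ofReal_iff_of_nonneg ht).1 hr1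
  exact lt_of_lt_of_le ((ENNReal.ofReal_lt_ofReal_iff_of_nonneg hy).2 (hlt r htr))
    (m.le_payment hr0 hr2.le)

end DynamicProcess

/-- An exponential delivery time together with the candidate payment function. -/
structure IsCandidate (v₁ : ℝ → ℝ) (a t₀ θ : ℝ) (m : DynamicProcess) : Prop where
  exp : m.HasExponentialTime
  pay : ∀ t, 0 ≤ t → m.T t = paymentFunction θ t₀ (optimalFlow v₁ a t₀) t

namespace IsCandidate

variable {v v₁ v₂ : ℝ → ℝ} {a t₀ θ : ℝ} {m : DynamicProcess}

theorem T_lt (hm : IsCandidate v₁ a t₀ θ m) (h : IsLossWeight v v₁ v₂) (ht₀ : t₀ ∈ Ioc 0 a)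
    (hθ : 0 < θ) {s t : ℝ} (hs : 0 ≤ s) (hst : s < t) (hst₀ : s ≤ t₀) : m.T s < m.T t := by
  have ha : 0 < a := ht₀.1.trans_le ht₀.2
  have hi := h.intervalIntegrable_optimalFlow ha t₀
  rw [hm.pay s hs, hm.pay t (hs.trans hst.le), IsLossWeight.paymentFunction_of_le hst₀]
  rcases le_or_gt t t₀ with htt | htt
  · rw [IsLossWeight.paymentFunction_of_le htt]
    have := h.integral_optimalFlow_pos ht₀ hs hst htt
    rw [← intervalIntegral.integral_add_adjacent_intervals (hi 0 s) (hi s t)]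
    nlinarith
  · rw [IsLossWeight.paymentFunction_of_lt htt]
    have := intervalIntegral.integral_nonneg hst₀ (μ := volume)
      (fun u _ => IsLossWeight.optimalFlow_nonneg v₁ a t₀ u)
    rw [← intervalIntegral.integral_add_adjacent_intervals (hi 0 s) (hi s t₀)]
    nlinarith

theorem tail_T (hm : IsCandidate v₁ a t₀ θ m) (h : IsLossWeight v v₁ v₂) (ht₀ : t₀ ∈ Ioc 0 a)
    (hθ : 0 < θ) {t : ℝ} (ht : t ∈ Icc 0 t₀) : m.tail (m.T t) = Real.exp (-t) :=
  hm.exp.tail_eq ht.1 (m.regular_T.nonneg ht.1) le_rfl fun _ hs => hm.T_lt h ht₀ hθ ht.1 hs ht.2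

theorem T_of_lt (hm : IsCandidate v₁ a t₀ θ m) (ht₀ : 0 < t₀) {t : ℝ} (ht : t₀ < t) :
    m.T t = m.T t₀ + θ := by
  rw [hm.pay t (ht₀.trans ht).le, hm.pay t₀ ht₀.le, IsLossWeight.paymentFunction_of_lt ht,
    IsLossWeight.paymentFunction_of_le le_rfl, add_comm]

theorem tail_mid (hm : IsCandidate v₁ a t₀ θ m) (ht₀ : 0 < t₀) {y : ℝ}
    (hy : y ∈ Ico (m.T t₀) (m.T t₀ + θ)) : m.tail y = Real.exp (-t₀) :=
  hm.exp.tail_eq ht₀.le ((m.regular_T.nonneg ht₀.le).trans hy.1) hy.1 fun s hs => by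
    rw [hm.T_of_lt ht₀ hs]
    exact hy.2

theorem tail_top (hm : IsCandidate v₁ a t₀ θ m) (ht₀ : 0 < t₀) {y : ℝ}
    (hy : m.T t₀ + θ ≤ y) : m.tail y = 0 := by
  have hle : ∀ s, 0 ≤ s → m.T s ≤ y := fun s hs => by
    have h1 := m.regular_T.monotoneOn (show s ∈ Ici 0 from hs)
      (show max s t₀ + 1 ∈ Ici (0 : ℝ) from by
        have := le_max_left s t₀
        simp only [mem_Ici]; linarith) (by linarith [le_max_left s t₀])
    rw [hm.T_of_lt ht₀ (t := max s t₀ + 1) (by linarith [le_max_right s t₀])] at h1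
    linarith
  rw [DynamicProcess.tail]
  have : {ω | ENNReal.ofReal y < m.payment ω} = ∅ := by
    ext ω
    simp only [mem_ofPred_eq, mem_empty_iff_false, iff_false, not_lt, DynamicProcess.payment]
    split_ifs
    · exact iSup₂_le fun s hs => ENNReal.ofReal_le_ofReal (hle s hs)
    · exact ENNReal.ofReal_le_ofReal (hle _ ENNReal.toReal_nonneg)
  rw [this, measureReal_empty]

theorem image_T (hm : IsCandidate v₁ a t₀ θ m) (h : IsLossWeight v v₁ v₂) (ht₀ : t₀ ∈ Ioc 0 a)
    (hθ : 0 < θ) : (fun t => θ * ∫ s in (0 : ℝ)..t, optimalFlow v₁ a t₀ s) '' Ioo 0 t₀ =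
      Ioo 0 (m.T t₀) := by
  have ha : 0 < a := ht₀.1.trans_le ht₀.2
  have hi := h.intervalIntegrable_optimalFlow ha t₀
  have hc : Continuous fun t => θ * ∫ s in (0 : ℝ)..t, optimalFlow v₁ a t₀ s :=
    continuous_const.mul (intervalIntegral.continuous_primitive hi 0)
  have hE : ∀ t ∈ Icc 0 t₀, θ * ∫ s in (0 : ℝ)..t, optimalFlow v₁ a t₀ s = m.T t := fun t ht => by
    rw [hm.pay t ht.1, IsLossWeight.paymentFunction_of_le ht.2]
  apply Subset.antisymm
  · rintro _ ⟨t, ht, rfl⟩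
    simp only
    rw [hE t ⟨ht.1.le, ht.2.le⟩]
    refine ⟨?_, hm.T_lt h ht₀ hθ ht.1.le ht.2 ht.2.le⟩
    rw [← m.regular_T.map_zero]
    exact hm.T_lt h ht₀ hθ le_rfl ht.1 ht₀.1.le
  · have := intermediate_value_Ioo ht₀.1.le hc.continuousOn
    simp only [intervalIntegral.integral_same, mul_zero] at this
    rwa [hE t₀ ⟨ht₀.1.le, le_rfl⟩] at this

theorem tail_values (hm : IsCandidate v₁ a t₀ θ m) (ht₀ : 0 < t₀) (hθ : 0 < θ) (y : ℝ) : m.tail y = 0 ∨ Real.exp (-t₀) ≤ m.tail y := by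
  rcases lt_or_ge y (m.T t₀ + θ) with h1 | h1
  · right
    rw [← hm.tail_mid ht₀ (y := max y (m.T t₀)) ⟨le_max_right _ _, max_lt h1 (by linarith)⟩]
    exact m.antitone_tail (le_max_left _ _)
  · exact Or.inl (hm.tail_top ht₀ h1)

/-- Levels below `T(t₀)` are parametrized by `y = T(s)`, where the tail is `e^{-s}` and `dy = θ f(s)
ds`; levels in the final jump of size `θ` have tail `e^{-t₀}`; higher levels are never reached. The
sum is `θ` times the left-hand side of the flow equation. -/
theorem tailConstraint_eq (hm : IsCandidate v₁ a t₀ θ m) (h : IsLossWeight v v₁ v₂)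
    (ht₀ : t₀ ∈ Ioc 0 a) (hθ : 0 < θ) {t : ℝ} (ht : t ∈ Icc 0 t₀) :
    tailConstraint v m.tail t = ENNReal.ofReal θ := by
  have ha : 0 < a := ht₀.1.trans_le ht₀.2
  have hi := h.intervalIntegrable_optimalFlow ha t₀
  have hA0 := m.regular_T.nonneg ht₀.1.le
  set A := m.T t₀ with hA
  set F : ℝ → ℝ≥0∞ := fun y =>
    if m.tail y ≤ Real.exp (-t) then ENNReal.ofReal (v (m.tail y * Real.exp t)) else 0 with hF
  have hsplit : tailConstraint v m.tail t =
      (∫⁻ y in Ioo 0 A, F y) + ((∫⁻ y in Ico A (A + θ), F y) + ∫⁻ y in Ici (A + θ), F y) := by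
    rw [← lintegral_union measurableSet_Ici (by
        rw [Set.disjoint_left]; intro y hy hy2; exact absurd hy.2 (not_lt.2 hy2)),
      Ico_union_Ici_eq_Ici (by linarith), ← lintegral_union measurableSet_Ici (by
        rw [Set.disjoint_left]; intro y hy hy2; exact absurd hy.2 (not_lt.2 hy2))]
    have hAe : (Ioi (0 : ℝ)) =ᵐ[volume] (Ioo 0 A ∪ Ici A : Set ℝ) := by
      filter_upwards [show ∀ᵐ y : ℝ, y ≠ 0 by simp [ae_iff, measure_singleton]] with y hy
      refine propext ⟨fun h0 => ?_, fun h0 => ?_⟩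
      · rcases lt_or_ge y A with h1 | h1
        · exact Or.inl ⟨h0, h1⟩
        · exact Or.inr h1
      · rcases h0 with h1 | h1
        · exact h1.1
        · have h1 : A ≤ y := h1
          exact lt_of_le_of_ne (hA0.trans h1) (Ne.symm hy)
    exact setLIntegral_congr hAe
  have hlast : ∫⁻ y in Ici (A + θ), F y = 0 := by
    refine (setLIntegral_congr_fun measurableSet_Ici fun y hy => ?_).trans lintegral_zero
    simp only [hF]
    rw [hm.tail_top ht₀.1 hy]
    simp [h.map_zero]
  have hmid : ∫⁻ y in Ico A (A + θ), F y = ENNReal.ofReal (θ * v (Real.exp (-t₀ + t))) := by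
    have : ∫⁻ y in Ico A (A + θ), F y =
        ∫⁻ y in Ico A (A + θ), ENNReal.ofReal (v (Real.exp (-t₀ + t))) := by
      refine setLIntegral_congr_fun measurableSet_Ico fun y hy => ?_
      simp only [hF]
      rw [hm.tail_mid ht₀.1 hy, if_pos (Real.exp_le_exp.2 (by linarith [ht.2])), ← Real.exp_add]
    rw [this, setLIntegral_const, Real.volume_Ico, add_sub_cancel_left, mul_comm,
      ENNReal.ofReal_mul hθ.le]
  have hfirst : ∫⁻ y in Ioo 0 A, F y =
      ENNReal.ofReal (θ * ∫ s in t..t₀, v (Real.exp (-s + t)) * optimalFlow v₁ a t₀ s) := by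
    have hinj : InjOn (fun t => θ * ∫ s in (0 : ℝ)..t, optimalFlow v₁ a t₀ s) (Ioo 0 t₀) := by
      have : StrictMonoOn (fun t => θ * ∫ s in (0 : ℝ)..t, optimalFlow v₁ a t₀ s) (Ioo 0 t₀) := by
        intro x hx y hy hxy
        have := hm.T_lt h ht₀ hθ hx.1.le hxy hx.2.le
        rwa [hm.pay x hx.1.le, hm.pay y hy.1.le, IsLossWeight.paymentFunction_of_le hx.2.le,
          IsLossWeight.paymentFunction_of_le hy.2.le] at this
      exact this.injOn
    have hcont : ContinuousOn (optimalFlow v₁ a t₀) (Ioo 0 t₀) := by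
      refine (h.continuousOn_renewalDensity ha).comp (by fun_prop) fun s hs => ?_
      exact ⟨by linarith [hs.2], by linarith [hs.1, ht₀.2]⟩
    have hmeas : Measurable (optimalFlow v₁ a t₀) :=
      (h.measurable_renewalDensity a).comp (measurable_const.sub measurable_id)
    have hder : ∀ x ∈ Ioo 0 t₀, HasDerivWithinAt
        (fun t => θ * ∫ s in (0 : ℝ)..t, optimalFlow v₁ a t₀ s) (θ * optimalFlow v₁ a t₀ x)
        (Ioo 0 t₀) x := fun x hx =>
      ((intervalIntegral.integral_hasDerivAt_right (hi 0 x)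
        hmeas.stronglyMeasurable.stronglyMeasurableAtFilter
        (hcont.continuousAt (Ioo_mem_nhds hx.1 hx.2))).const_mul θ).hasDerivWithinAt
    rw [← hm.image_T h ht₀ hθ, lintegral_image_eq_lintegral_abs_deriv_mul measurableSet_Ioo hder hinj]
    obtain ⟨h1, -⟩ := h.flow_eq ht₀ ht
    have h1' := (h1.const_mul θ)
    have hnn : ∀ s, 0 ≤ θ * (v (Real.exp (-s + t)) * optimalFlow v₁ a t₀ s) := fun s =>
      mul_nonneg hθ.le (mul_nonneg (h.nonneg (Real.exp_pos _).le)
        (IsLossWeight.optimalFlow_nonneg _ _ _ _))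
    rw [← intervalIntegral.integral_const_mul, intervalIntegral.integral_of_le ht.2,
      integral_Ioc_eq_integral_Ioo, ofReal_integral_eq_lintegral_ofReal
        ((intervalIntegrable_iff_integrableOn_Ioo_of_le ht.2).1 h1') (Eventually.of_forall hnn),
      ← lintegral_indicator measurableSet_Ioo, ← lintegral_indicator measurableSet_Ioo]
    refine lintegral_congr_ae ?_
    filter_upwards [show ∀ᵐ y : ℝ, y ≠ t by simp [ae_iff, measure_singleton]] with s hst
    by_cases hs : s ∈ Ioo 0 t₀
    · rw [indicator_of_mem hs]
      have e1 : θ * ∫ r in (0 : ℝ)..s, optimalFlow v₁ a t₀ r = m.T s := by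
        rw [hm.pay s hs.1.le, IsLossWeight.paymentFunction_of_le hs.2.le]
      simp only [hF]
      rw [e1, hm.tail_T h ht₀ hθ ⟨hs.1.le, hs.2.le⟩]
      by_cases hts : t < s
      · rw [if_pos (Real.exp_le_exp.2 (by linarith)), indicator_of_mem
          (show s ∈ Ioo t t₀ from ⟨hts, hs.2⟩), abs_of_nonneg (mul_nonneg hθ.le
          (IsLossWeight.optimalFlow_nonneg _ _ _ _)), ← Real.exp_add, ← ENNReal.ofReal_mul
          (mul_nonneg hθ.le (IsLossWeight.optimalFlow_nonneg _ _ _ _))]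
        congr 1
        ring
      · rw [if_neg, mul_zero, indicator_of_notMem (fun h' => hts h'.1)]
        rw [Real.exp_le_exp]
        intro h'
        exact hts (lt_of_le_of_ne (by linarith) (Ne.symm hst))
    · rw [indicator_of_notMem hs, indicator_of_notMem (fun h' => hs ⟨ht.1.trans_lt h'.1, h'.2⟩)]
  obtain ⟨-, h2⟩ := h.flow_eq ht₀ ht
  have hnn : 0 ≤ ∫ s in t..t₀, v (Real.exp (-s + t)) * optimalFlow v₁ a t₀ s :=
    intervalIntegral.integral_nonneg ht.2 fun s _ => mul_nonneg (h.nonneg (Real.exp_pos _).le)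
      (IsLossWeight.optimalFlow_nonneg _ _ _ _)
  rw [hsplit, hlast, hmid, hfirst, add_zero, ← ENNReal.ofReal_add (mul_nonneg hθ.le hnn)
    (mul_nonneg hθ.le (h.nonneg (Real.exp_pos _).le)), ← mul_add, add_comm, h2, mul_one]

/-- After `t₀` no level qualifies except those with zero tail, because positive tails are at least
`e^{-t₀}`. -/
theorem tailConstraint_le (hm : IsCandidate v₁ a t₀ θ m) (h : IsLossWeight v v₁ v₂)
    (ht₀ : t₀ ∈ Ioc 0 a) (hθ : 0 < θ) {t : ℝ} (ht : 0 ≤ t) :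
    tailConstraint v m.tail t ≤ ENNReal.ofReal θ := by
  rcases le_or_gt t t₀ with h1 | h1
  · exact (hm.tailConstraint_eq h ht₀ hθ ⟨ht, h1⟩).le
  · have : tailConstraint v m.tail t = 0 := by
      rw [tailConstraint]
      refine (setLIntegral_congr_fun measurableSet_Ioi fun y hy => ?_).trans lintegral_zero
      split_ifs with h2
      · rcases hm.tail_values ht₀.1 hθ y with h3 | h3
        · simp [h3, h.map_zero]
        · have := Real.exp_lt_exp.2 (neg_lt_neg h1)
          linarith
      · rfl
    rw [this]
    exact zero_le

end IsCandidate

/-! ### Assembling the results. -/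

theorem solvesFlowEq_congr {v v' : ℝ → ℝ} (hvv : ∀ x ∈ Icc (0 : ℝ) 1, v x = v' x) {b : ℝ}
    {f : ℝ → ℝ} (hf : SolvesFlowEq v b f) : SolvesFlowEq v' b f := by
  refine ⟨hf.1, fun t ht => ?_⟩
  rw [← hf.2 t ht]
  have hm : ∀ s, t ≤ s → Real.exp (-s + t) ∈ Icc (0 : ℝ) 1 := fun s hs =>
    ⟨(Real.exp_pos _).le, Real.exp_le_one_iff.2 (by linarith)⟩
  rw [hvv _ (hm b ht.2)]
  congr 1
  refine intervalIntegral.integral_congr fun s hs => ?_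
  rw [uIcc_of_le ht.2] at hs
  rw [hvv _ (hm s hs.1)]

theorem solvesMultiplierEq_congr {v v' : ℝ → ℝ} (hvv : ∀ x ∈ Icc (0 : ℝ) 1, v x = v' x) {a : ℝ}
    {g : ℝ → ℝ} (hg : SolvesMultiplierEq v a g) : SolvesMultiplierEq v' a g := by
  refine ⟨hg.1, fun t ht => ?_⟩
  have e : ∫ s in (0 : ℝ)..t, v (Real.exp (-t + s)) * g s =
      ∫ s in (0 : ℝ)..t, v' (Real.exp (-t + s)) * g s := by
    refine intervalIntegral.integral_congr fun s hs => ?_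
    rw [uIcc_of_le ht.1] at hs
    rw [hvv _ ⟨(Real.exp_pos _).le, Real.exp_le_one_iff.2 (by linarith [hs.2])⟩]
  rw [← hvv (Real.exp (-t)) ⟨(Real.exp_pos _).le, Real.exp_le_one_iff.2 (by linarith [ht.1])⟩, ← e]
  exact hg.2 t ht

namespace IsLossWeight

variable {v v₁ v₂ : ℝ → ℝ} {a : ℝ}

theorem solvesMultiplierEq (h : IsLossWeight v v₁ v₂) (ha : 0 < a) :
    SolvesMultiplierEq v a (multiplier v₁ a) := by
  refine ⟨h.integrableOn_multiplier ha a, fun t ht => ?_⟩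
  have h2 := (h.multiplier_identity ha ht).2
  simp only [neg_sub', sub_neg_eq_add] at h2
  rw [h2, sub_self]

theorem multiplier_unique (h : IsLossWeight v v₁ v₂) (ha : 0 < a) {g : ℝ → ℝ}
    (hg : SolvesMultiplierEq v a g) : g =ᵐ[volume.restrict (Icc 0 a)] multiplier v₁ a := by
  have hv := h.cont
  have hgi : IntervalIntegrable g volume 0 a :=
    (intervalIntegrable_iff_integrableOn_Icc_of_le ha.le).2 hg.1
  have h0 := h.ae_eq_zero_of_volterra ha ⟨ha.le, le_rfl⟩ (φ := fun s => g s - multiplier v₁ a s)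
    (hg.1.sub (h.integrableOn_multiplier ha a)) fun u hu => by
    obtain ⟨h1, h2⟩ := h.multiplier_identity ha hu
    have h3 := hg.2 u hu
    have hsubset : uIcc 0 u ⊆ uIcc 0 a := by
      rw [uIcc_of_le hu.1, uIcc_of_le ha.le]; exact Icc_subset_Icc_right hu.2
    have h4 : IntervalIntegrable (fun s => v (Real.exp (-(u - s))) * g s) volume 0 u :=
      (hgi.mono_set hsubset).continuousOn_mul (by fun_prop)
    have e : ∀ s, -u + s = -(u - s) := fun s => by ring
    simp only [e] at h3
    simp only [mul_sub]
    rw [intervalIntegral.integral_sub h4 h1, h2]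
    linarith
  filter_upwards [h0] with x hx
  simp only [Pi.zero_apply] at hx
  linarith

end IsLossWeight

/-- The dynamic problem. -/
theorem dynamic_problem {w : ℝ → ℝ} (hw : IsWeightingFunction w) {θ : ℝ} (hθ : 0 < θ) :
    ∃ (p₁ t₀ : ℝ) (g₀ f : ℝ → ℝ),
      (p₁ ∈ Ioo (0 : ℝ) 1 ∧ dualWeight w p₁ = p₁ ∧
        ∀ q ∈ Ioo (0 : ℝ) 1, dualWeight w q = q → q = p₁) ∧
      (SolvesMultiplierEq (dualWeight w) (-Real.log p₁) g₀ ∧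
        ContinuousOn g₀ (Ioc 0 (-Real.log p₁)) ∧
        ∀ g : ℝ → ℝ, SolvesMultiplierEq (dualWeight w) (-Real.log p₁) g →
          g =ᵐ[volume.restrict (Icc 0 (-Real.log p₁))] g₀) ∧
      IsLeast {t : ℝ | t ∈ Ioc 0 (-Real.log p₁) ∧ g₀ t ≤ 0} t₀ ∧
      (SolvesFlowEq (dualWeight w) t₀ f ∧
        ∀ h : ℝ → ℝ, SolvesFlowEq (dualWeight w) t₀ h →
          h =ᵐ[volume.restrict (Icc 0 t₀)] f) ∧
      ∃ m₀ : DynamicProcess,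
        m₀.HasExponentialTime ∧
        (∀ t : ℝ, 0 ≤ t → m₀.T t = paymentFunction θ t₀ f t) ∧
        m₀.IsOptimal w θ ∧
        ∀ m : DynamicProcess, m.IsOptimal w θ ↔
          m.P {ω | m.τ ω < ⊤} = 1 ∧
          ∀ y : ℝ, 0 ≤ y →
            m.P {ω | m.payment ω ≤ ENNReal.ofReal y} =
              m₀.P {ω | m₀.payment ω ≤ ENNReal.ofReal y} := by
  have hv := hw.isLossWeight
  obtain ⟨p, hp, hvp, huniq⟩ := hv.exists_fixed
  obtain ⟨t₀, hleast, hs⟩ := hv.exists_stoppingLevel hp hvp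
  have ha : 0 < -Real.log p := by linarith [Real.log_neg hp.1 hp.2]
  set a := -Real.log p with hadef
  have hIoo : ∀ q ∈ Ioo (0 : ℝ) 1, clampDual w q = dualWeight w q := fun q hq =>
    clampDual_eq w ⟨hq.1.le, hq.2.le⟩
  have hcl : ∀ q ∈ Icc (0 : ℝ) 1, clampDual w q = dualWeight w q := fun q hq => clampDual_eq w hq
  have hcl' : ∀ q ∈ Icc (0 : ℝ) 1, dualWeight w q = clampDual w q := fun q hq => (hcl q hq).symm
  obtain ⟨m₀, hexp, hT₀⟩ := exists_exponential_process
    (hv.isRegularPayment_paymentFunction ha hs.mem.1 hθ.le)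
  have hc : IsCandidate (fun p => deriv w (1 - p)) a t₀ θ m₀ := ⟨hexp, fun t _ => by rw [hT₀]⟩
  have hdir₀ : m₀.DIR w θ := m₀.dir_of_relaxed hw hθ.le hexp.τ_lt_top fun t ht =>
    hc.tailConstraint_le hv hs.mem hθ ht
  have hF₀ := m₀.isRelaxedFeasible hw hθ.le hdir₀
  have hrev₀ : ∫⁻ y in Ioi 0, ENNReal.ofReal (m₀.tail y) =
      relaxedValue (fun p => deriv w (1 - p)) a t₀ θ :=
    hs.revenue_eq_of_tight hv hF₀.measurable hF₀.mem (fun y _ => hc.tail_values hs.mem.1 hθ y)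
      fun t ht => hc.tailConstraint_eq hv hs.mem hθ ht
  have hub : ∀ m : DynamicProcess, m.DIR w θ → m.revenue ≤ m₀.revenue := fun m hm => by
    rw [m.revenue_eq_tail, m₀.revenue_eq_tail, hrev₀]
    exact hs.revenue_le hv (m.isRelaxedFeasible hw hθ.le hm)
  refine ⟨p, t₀, multiplier (fun p => deriv w (1 - p)) a, optimalFlow (fun p => deriv w (1 - p)) a t₀,
    ⟨hp, by rw [← hIoo p hp, hvp], fun q hq hq' => huniq q hq (by rw [hIoo q hq, hq'])⟩,
    ⟨solvesMultiplierEq_congr hcl (hv.solvesMultiplierEq ha), hv.continuousOn_multiplier ha,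
      fun g hg => hv.multiplier_unique ha (solvesMultiplierEq_congr hcl' hg)⟩, hleast,
    ⟨solvesFlowEq_congr hcl ⟨(hv.integrable_optimalFlow ha t₀).integrableOn,
      fun t ht => (hv.flow_eq hs.mem ht).2⟩,
      fun φ hφ => hv.flow_unique hs.mem (solvesFlowEq_congr hcl' hφ)⟩,
    m₀, hexp, hc.pay, ⟨hdir₀, hub⟩, fun m => ?_⟩
  have htail : ∀ (m : DynamicProcess) (y : ℝ),
      m.P {ω | m.payment ω ≤ ENNReal.ofReal y} = ENNReal.ofReal (1 - m.tail y) := fun m y => by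
    have : {ω | m.payment ω ≤ ENNReal.ofReal y} = {ω | ENNReal.ofReal y < m.payment ω}ᶜ := by
      ext ω; simp
    rw [this, ← ofReal_measureReal, probReal_compl_eq_one_sub
      (measurableSet_lt measurable_const m.measurable_payment)]
    rfl
  have hiff : ∀ y : ℝ, m.P {ω | m.payment ω ≤ ENNReal.ofReal y} =
      m₀.P {ω | m₀.payment ω ≤ ENNReal.ofReal y} ↔ m.tail y = m₀.tail y := fun y => by
    rw [htail, htail, ENNReal.ofReal_eq_ofReal_iff (by linarith [(m.tail_mem y).2])
      (by linarith [(m₀.tail_mem y).2])]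
    constructor <;> intro <;> linarith
  simp only [hiff]
  have hτm : MeasurableSet {ω | m.τ ω < ⊤} := measurableSet_lt m.measurable_τ measurable_const
  rw [← mem_ae_iff_prob_eq_one hτm]
  constructor
  · rintro ⟨hdir, hopt⟩
    have hF := m.isRelaxedFeasible hw hθ.le hdir
    have hrev : ∫⁻ y in Ioi 0, ENNReal.ofReal (m.tail y) =
        relaxedValue (fun p => deriv w (1 - p)) a t₀ θ := by
      rw [← hrev₀, ← m.revenue_eq_tail, ← m₀.revenue_eq_tail]
      exact le_antisymm (hub m hdir) (hopt m₀ hdir₀)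
    refine ⟨m.τ_lt_top_of_tight hw hθ hdir ?_, fun y hy =>
      hs.unique hv hF hF₀ m.isTail_tail m₀.isTail_tail hrev hrev₀ hy⟩
    rw [← tailConstraint_zero hF.mem]
    exact (hs.tight_of_revenue_eq hv hF hrev).2.1
  · rintro ⟨hτ, hG⟩
    -- Under sure delivery both feasibility and revenue depend only on the tail of the total
    -- payment, so any process sharing it with the candidate is optimal.
    have hGeq : ∀ t, tailConstraint (clampDual w) m.tail t =
        tailConstraint (clampDual w) m₀.tail t := fun t =>
      setLIntegral_congr_fun measurableSet_Ioi fun y hy => by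
        simp only [hG y (le_of_lt hy)]
    refine ⟨m.dir_of_relaxed hw hθ.le hτ fun t ht => ?_, fun m' hm' => ?_⟩
    · rw [hGeq]; exact hF₀.le t ht
    · have : m.revenue = m₀.revenue := by
        rw [m.revenue_eq_tail, m₀.revenue_eq_tail]
        exact setLIntegral_congr_fun measurableSet_Ioi fun y hy => by
          simp only [hG y (le_of_lt hy)]
      rw [this]
      exact hub m' hm'

theorem mainTheorem6 (w : ℝ → ℝ) (hw : IsWeightingFunction w) (θ : ℝ) (hθ : 0 < θ) :
    -- sure delivery: the RDEU payoff is the CPT payoff with `w₋ = dualWeight w` and `λ = 1`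
    (∀ (wplus : ℝ → ℝ), IsWeightingFunction wplus →
      ∀ (Ω : Type*) [MeasurableSpace Ω] (P : Measure Ω) [IsProbabilityMeasure P] (X T : Ω → ℝ),
        (∀ᵐ ω ∂P, X ω = 1) → Measurable T → (∀ ω, 0 ≤ T ω) →
          rdeuMenu w θ P X T = cptMenu wplus (dualWeight w) 1 θ P X T) ∧
    -- the static problem
    (∃ μ p : ℝ,
      IsGreatest ((fun q : ℝ => q / dualWeight w q) '' Ioc 0 1) μ ∧ 1 < μ ∧
      p ∈ Ioo (0 : ℝ) 1 ∧ μ * dualWeight w p = p ∧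
      (∀ q ∈ Ioo (0 : ℝ) 1, μ * dualWeight w q = q → q = p) ∧
      IsGreatest (StaticMechanism.revenue '' {m | m.Feasible w θ}) (ENNReal.ofReal (μ * θ)) ∧
      ∀ m : StaticMechanism, m.IsOptimal w θ ↔
        m.P {ω | m.X ω = 1} = 1 ∧
        ∀ y : ℝ, 0 ≤ y →
          m.P.real {ω | y < m.T ω} = if y < μ * θ / p then p else 0) ∧
    -- the dynamic problem
    (∃ (p₁ t₀ : ℝ) (g₀ f : ℝ → ℝ),
      (p₁ ∈ Ioo (0 : ℝ) 1 ∧ dualWeight w p₁ = p₁ ∧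
        ∀ q ∈ Ioo (0 : ℝ) 1, dualWeight w q = q → q = p₁) ∧
      (SolvesMultiplierEq (dualWeight w) (-Real.log p₁) g₀ ∧
        ContinuousOn g₀ (Ioc 0 (-Real.log p₁)) ∧
        ∀ g : ℝ → ℝ, SolvesMultiplierEq (dualWeight w) (-Real.log p₁) g →
          g =ᵐ[volume.restrict (Icc 0 (-Real.log p₁))] g₀) ∧
      IsLeast {t : ℝ | t ∈ Ioc 0 (-Real.log p₁) ∧ g₀ t ≤ 0} t₀ ∧
      (SolvesFlowEq (dualWeight w) t₀ f ∧
        ∀ h : ℝ → ℝ, SolvesFlowEq (dualWeight w) t₀ h →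
          h =ᵐ[volume.restrict (Icc 0 t₀)] f) ∧
      ∃ m₀ : DynamicProcess,
        m₀.HasExponentialTime ∧
        (∀ t : ℝ, 0 ≤ t → m₀.T t = paymentFunction θ t₀ f t) ∧
        m₀.IsOptimal w θ ∧
        ∀ m : DynamicProcess, m.IsOptimal w θ ↔
          m.P {ω | m.τ ω < ⊤} = 1 ∧
          ∀ y : ℝ, 0 ≤ y →
            m.P {ω | m.payment ω ≤ ENNReal.ofReal y} =
              m₀.P {ω | m₀.payment ω ≤ ENNReal.ofReal y}) := by
  exact ⟨fun wplus hwp Ω _ P _ X T hX hT hT0 => rdeuMenu_eq_cptMenu hw hwp hθ.le P hX hT hT0,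
    static_problem hw hθ, dynamic_problem hw hθ⟩
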